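/- Let $\nu$ be a $\sigma$-finite measure on a measurable space $\mathcal X$, let $t:\mathcal X\to\mathbb R^p$ ($p\ge 1$) be measurable and not $\nu$-almost everywhere in an affine hyperplane, and let $\Theta\subseteq\mathbb R^p$ be an open set with $\int e^{\langle\theta,t\rangle}\,d\nu<\infty$ for all $\theta\in\Theta$. Let $x=(X_1,\dots,X_n)$, $n\ge1$, be an i.i.d. sample from the exponential family with canonical parameter $\theta\in\Theta$ and densities $e^{\langle\theta,t(\cdot)\rangle-K(\theta)}$ with respect to $\nu$, where $K(\theta)=\log\int e^{\langle\theta,t\rangle}d\nu$. Let $f(x|\theta)$ be the joint density of $x$ with respect to $\nu^{\otimes n}$, and $|I_x(\theta)|$ the determinant of the Fisher information matrix $I_x(\theta)=E_\theta[\nabla_\theta\log f(x|\theta)\,\nabla_\theta\log f(x|\theta)^{\top}]$. For each $n\ge1$ take a prior $h=h_n$ on $\Theta$ with $h(\theta)\propto|I_x(\theta)|$. An MML87 estimate is a maximizer over $\Theta$ of $\log h(\theta)+\log f(x|\theta)-\frac12\log|I_x(\theta)|$; a Firth estimate is a maximizer over $\Theta$ of the penalized likelihood $f(x|\theta)\,|I_x(\theta)|^{1/2}$;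 an MLE is a maximizer over $\Theta$ of $f(x|\theta)$. An MML87 (ML) estimator is a sequence of measurable functions $T_n$ of the sample such that $T_n(x)$ is an MML87 estimate (an MLE) for every $x$ for which one exists. 1. For every $n\ge1$ and every $x$, the MML87 estimates are exactly the Firth estimates. 2. For every $\theta\in\Theta$ there is $b=b(\theta)\in\mathbb R^p$ such that every ML estimator has bias $b/n+O(n^{-2})$ at $\theta$, while every MML87 estimator has bias $O(n^{-2})$ at $\theta$: the $O(n^{-1})$ term is removed. (For the MML87 estimator it is assumed that an MML87 estimate exists for at least one sample of at least one size $m\ge1$.) Here "$T_n$ has bias $\beta/n+O(n^{-2})$ at $\theta$" means the following: (a) for every $\delta>0$ there are $C$ and $c>0$ with $P_\theta(\|T_n-\theta\|>\delta)\le Ce^{-cn}$ for all $n$; (b) for every $\delta>0$, $E_\theta\big[(T_n-\theta)\mathbf 1\{\|T_n-\theta\|\le\delta\}\big]=\beta/n+O(n^{-2})$ as $n\to\infty$; (c) if for some $r>1$ the moment $E_\theta\|T_n\|^r$ is bounded, for all large $n$, by a polynomial in $n$, then $T_n$ is integrable for all large $n$ and $E_\theta[T_n]-\theta=\beta/n+O(n^{-2})$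 as $n\to\infty$. -/

import Mathlib

open MeasureTheory Filter Asymptotics
open scoped Topology RealInnerProductSpace

noncomputable section

namespace MMLFirth

/-! ### Parametric models given by a density `f θ x` with respect to a base measure `ν` -/

section Model

variable {Ω : Type*} [MeasurableSpace Ω] {p : ℕ}

/-- The score `∂ log f(x|θ) / ∂θᵢ`. -/
def score (f : EuclideanSpace ℝ (Fin p) → Ω → ℝ) (θ : EuclideanSpace ℝ (Fin p)) (x : Ω)
    (i : Fin p) : ℝ :=
  fderiv ℝ (fun θ' => Real.log (f θ' x)) θ (EuclideanSpace.single i 1)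

/-- The Fisher information matrix `I_x(θ) = E_θ[score score^T]` of the data `x`. -/
def fisherInfo (ν : Measure Ω) (f : EuclideanSpace ℝ (Fin p) → Ω → ℝ)
    (θ : EuclideanSpace ℝ (Fin p)) : Matrix (Fin p) (Fin p) ℝ :=
  Matrix.of fun i j => ∫ x, score f θ x i * score f θ x j * f θ x ∂ν

/-- The MML87 objective `log h(θ) + log f(x|θ) - (1/2) log |I_x(θ)|` with prior `h`. -/
def mmlObjective (h : EuclideanSpace ℝ (Fin p) → ℝ) (ν : Measure Ω)
    (f : EuclideanSpace ℝ (Fin p) → Ω → ℝ) (x : Ω) (θ : EuclideanSpace ℝ (Fin p)) : ℝ :=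
  Real.log (h θ) + Real.log (f θ x) - 1 / 2 * Real.log (fisherInfo ν f θ).det

/-- Firth's penalized likelihood `f(x|θ) |I_x(θ)|^{1/2}`. -/
def firthLikelihood (ν : Measure Ω) (f : EuclideanSpace ℝ (Fin p) → Ω → ℝ) (x : Ω)
    (θ : EuclideanSpace ℝ (Fin p)) : ℝ :=
  f θ x * Real.sqrt (fisherInfo ν f θ).det

/-- `θ'` is a maximum likelihood estimate over the parameter set `Θ` from the data `x`. -/
def IsMLE (Θ : Set (EuclideanSpace ℝ (Fin p))) (f : EuclideanSpace ℝ (Fin p) → Ω → ℝ) (x : Ω)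
    (θ' : EuclideanSpace ℝ (Fin p)) : Prop :=
  θ' ∈ Θ ∧ IsMaxOn (fun θ => f θ x) Θ θ'

/-- `θ'` is an MML87 estimate over `Θ` from the data `x`, for the prior `h`. -/
def IsMMLEstimate (Θ : Set (EuclideanSpace ℝ (Fin p))) (h : EuclideanSpace ℝ (Fin p) → ℝ)
    (ν : Measure Ω) (f : EuclideanSpace ℝ (Fin p) → Ω → ℝ) (x : Ω)
    (θ' : EuclideanSpace ℝ (Fin p)) : Prop :=
  θ' ∈ Θ ∧ IsMaxOn (mmlObjective h ν f x) Θ θ'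

/-- `θ'` is a Firth penalized-likelihood estimate over `Θ` from the data `x`. -/
def IsFirthEstimate (Θ : Set (EuclideanSpace ℝ (Fin p))) (ν : Measure Ω)
    (f : EuclideanSpace ℝ (Fin p) → Ω → ℝ) (x : Ω) (θ' : EuclideanSpace ℝ (Fin p)) : Prop :=
  θ' ∈ Θ ∧ IsMaxOn (firthLikelihood ν f x) Θ θ'

end Model

/-! ### Exponential families in canonical parametrization and i.i.d. samples -/

section ExpFamily

variable {X : Type*} [MeasurableSpace X] {p : ℕ}

/-- The cumulant function `K(θ) = log ∫ exp ⟪θ, t(x)⟫ dν(x)`. -/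
def cumulant (ν : Measure X) (t : X → EuclideanSpace ℝ (Fin p))
    (θ : EuclideanSpace ℝ (Fin p)) : ℝ :=
  Real.log (∫ x, Real.exp ⟪θ, t x⟫ ∂ν)

/-- The density `exp (⟪θ, t(x)⟫ - K(θ))` with respect to the carrier measure `ν`. -/
def expDensity (ν : Measure X) (t : X → EuclideanSpace ℝ (Fin p))
    (θ : EuclideanSpace ℝ (Fin p)) (x : X) : ℝ :=
  Real.exp (⟪θ, t x⟫ - cumulant ν t θ)

/-- The joint density of `n` independent observations, with respect to `ν ⊗ ⋯ ⊗ ν`. -/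
def sampleDensity (ν : Measure X) (t : X → EuclideanSpace ℝ (Fin p)) (n : ℕ)
    (θ : EuclideanSpace ℝ (Fin p)) (x : Fin n → X) : ℝ :=
  ∏ i, expDensity ν t θ (x i)

/-- The base measure `ν ⊗ ⋯ ⊗ ν` of the sample. -/
def sampleBase (ν : Measure X) (n : ℕ) : Measure (Fin n → X) :=
  Measure.pi fun _ => ν

/-- The law under `θ` of `n` independent observations. -/
def sampleLaw (ν : Measure X) (t : X → EuclideanSpace ℝ (Fin p))
    (θ : EuclideanSpace ℝ (Fin p)) (n : ℕ) : Measure (Fin n → X) :=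
  Measure.pi fun _ => ν.withDensity fun x => ENNReal.ofReal (expDensity ν t θ x)

/-- `T n` is, for each sample size `n`, a measurable function of the sample that is an estimate
in the sense of `IsEst n` at every sample for which there is such an estimate. -/
def IsEstimator (IsEst : ∀ n : ℕ, (Fin n → X) → EuclideanSpace ℝ (Fin p) → Prop)
    (T : ∀ n : ℕ, (Fin n → X) → EuclideanSpace ℝ (Fin p)) : Prop :=
  ∀ n, Measurable (T n) ∧ ∀ x, (∃ θ', IsEst n x θ') → IsEst n x (T n x)

/-- Some moment of `T n` of order larger than one is finite for large `n`, and grows at most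
polynomially in `n`. -/
def HasPolynomialMoment (P : ∀ n : ℕ, Measure (Fin n → X))
    (T : ∀ n : ℕ, (Fin n → X) → EuclideanSpace ℝ (Fin p)) : Prop :=
  ∃ r : ℝ, 1 < r ∧ ∃ (k : ℕ) (C : ℝ), ∀ᶠ n : ℕ in atTop,
    ∫⁻ x, ‖T n x‖ₑ ^ r ∂(P n) ≤ ENNReal.ofReal (C * (n : ℝ) ^ k)

/-- The bias of `T n` as an estimator of `θ` has the expansion `b / n + O(n⁻²)`.

As the expectation of an estimator need not exist (the estimate may fail to exist for some
samples, where `T n` is then arbitrary), this consists of three statements: `T n` leaves any ball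
around `θ` with exponentially small probability; the bias restricted to such a ball has the
expansion; and the bias `E_θ[T n] - θ` itself has the expansion, if a moment of `T n` of order
larger than one grows at most polynomially. The second statement determines `b`. -/
def HasBiasExpansion (P : ∀ n : ℕ, Measure (Fin n → X))
    (T : ∀ n : ℕ, (Fin n → X) → EuclideanSpace ℝ (Fin p))
    (θ b : EuclideanSpace ℝ (Fin p)) : Prop :=
  (∀ δ : ℝ, 0 < δ → ∃ C c : ℝ, 0 < c ∧ ∀ n : ℕ,
    P n {x | δ < ‖T n x - θ‖} ≤ ENNReal.ofReal (C * Real.exp (-c * n))) ∧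
  (∀ δ : ℝ, 0 < δ →
    (fun n : ℕ => (∫ x in {x | ‖T n x - θ‖ ≤ δ}, (T n x - θ) ∂(P n)) - (1 / (n : ℝ)) • b)
      =O[atTop] fun n : ℕ => 1 / (n : ℝ) ^ 2) ∧
  (HasPolynomialMoment P T →
    (∀ᶠ n : ℕ in atTop, Integrable (T n) (P n)) ∧
    (fun n : ℕ => ((∫ x, T n x ∂(P n)) - θ) - (1 / (n : ℝ)) • b)
      =O[atTop] fun n : ℕ => 1 / (n : ℝ) ^ 2)

end ExpFamily

end MMLFirth

end

noncomputable section

namespace MMLFirth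

open scoped ContDiff

local notation "𝔼" p => EuclideanSpace ℝ (Fin p)

/-! ### Exponential integrals and their smoothness in the parameter. -/

section ExpIntegral

variable {X : Type*} {p : ℕ}

/-! Let `m` be the mean of `t` as a function of the parameter, `A` its derivative at the true value
`θ₀` (the covariance of `t`), and `Z` the deviation of the sample mean of `t` from `m θ₀`. The
information of the sample is `n` times the covariance matrix, so a prior proportional to its
determinant turns the MML87 objective into log-likelihood plus half the log-determinant of the
covariance, up to a constant. Firth's objective is a positive multiple of the exponential of the
same function. Hence part 1, and both estimators of part 2 maximize a log-likelihood penalized by a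
fixed function `G`: zero for the MLE, `halfLogDet` for MML87.

With `γ` the gradient of `G`, a maximizer `T` solves `m T = m θ₀ + Z + n⁻¹ γ(T)`
(`mean_eq_of_isMaxOn`). Inverting `m` locally expands `T - θ₀` as a cubic polynomial in `Z`, plus
`n⁻¹` times an affine function of `Z`, up to `O(‖Z‖⁴ + n⁻²)` (`exists_estimate_expansion`). Since
`Z` has mean zero, covariance `A / n`, third moments of order `n⁻²` and fourth moment `O(n⁻²)`, the
coefficient of `1 / n` in the expectation is `A⁻¹(γ(θ₀) - ½ ∑ⱼ D²m(eⱼ, A⁻¹eⱼ))`. The sum comes from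
the second derivative of the inverse of `m`. By Jacobi's formula and the total symmetry of `D²m`,
which is the third derivative of the cumulant function, half that sum is exactly the gradient of
half the log-determinant (`fderiv_log_det_covMatrix`). So the bracket vanishes for MML87.

The expansion is local while the maximizers are global. The divergence from `θ₀` grows at least
linearly away from `θ₀` (`exists_divergence_ge`), so when `Z` is small and `n` large a maximizer
exists and all maximizers lie near `θ₀`, provided `G` is at most an affine function of `‖θ - θ₀‖`
plus a multiple of the divergence. For `halfLogDet` this bound is what the existence of a single
estimate at some sample size gives (`exists_penalty_le`). Large `Z` has exponentially small
probability by a Chernoff bound. This tail, combined with a polynomially bounded moment of order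
above one, passes from the truncated to the full bias (`bias_of_polynomialMoment`). -/

theorem norm_le_mul_abs_coord (hp : 1 ≤ p) (v : 𝔼 p) : ∃ i, ‖v‖ ≤ p * |v i| := by
  have : Nonempty (Fin p) := ⟨⟨0, hp⟩⟩
  obtain ⟨i, -, hi⟩ := Finset.exists_max_image Finset.univ (fun i => |v i|) Finset.univ_nonempty
  refine ⟨i, ?_⟩
  calc ‖v‖ = ‖∑ j, v j • EuclideanSpace.single j (1 : ℝ)‖ := by
        congr 1
        have := (EuclideanSpace.basisFun (Fin p) ℝ).sum_repr v
        simpa using this.symm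
    _ ≤ ∑ j, ‖v j • EuclideanSpace.single j (1 : ℝ)‖ := norm_sum_le _ _
    _ ≤ ∑ _j : Fin p, |v i| := by
        refine Finset.sum_le_sum fun j _ => ?_
        simpa [norm_smul] using hi j (Finset.mem_univ j)
    _ = p * |v i| := by simp

/-- Some coordinate has absolute value at least `‖v‖ / p`. This reduces exponential moments of a
norm to those of `2p` linear functionals, at the price of a factor `p` in the exponent. -/
theorem exp_norm_le_sum (hp : 1 ≤ p) {r : ℝ} (hr : 0 ≤ r) (v : 𝔼 p) :
    Real.exp (r * ‖v‖) ≤ ∑ i, (Real.exp (p * r * v i) + Real.exp (-(p * r * v i))) := by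
  obtain ⟨i, hi⟩ := norm_le_mul_abs_coord hp v
  have h1 : r * ‖v‖ ≤ |p * r * v i| := by
    rw [abs_mul, abs_of_nonneg (by positivity : (0 : ℝ) ≤ p * r)]
    nlinarith
  calc Real.exp (r * ‖v‖) ≤ Real.exp |p * r * v i| := Real.exp_le_exp.2 h1
    _ ≤ Real.exp (p * r * v i) + Real.exp (-(p * r * v i)) := by
        rcases abs_choice (p * r * v i) with h | h <;> rw [h] <;>
          linarith [Real.exp_pos (p * r * v i), Real.exp_pos (-(p * r * v i))]
    _ ≤ _ := Finset.single_le_sum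
        (f := fun i => Real.exp (p * r * v i) + Real.exp (-(p * r * v i)))
        (fun j _ => by positivity) (Finset.mem_univ i)

variable [MeasurableSpace X] {ν : Measure X} {t : X → 𝔼 p} {Θ : Set (𝔼 p)}

/-- Openness of `Θ` leaves room to move the parameter along every axis. The surplus `r * ‖t x‖` pays
for weights of moderate growth and for domination under the integral sign. -/
theorem exists_integrable_exp_inner_add_norm (hp : 1 ≤ p) (ht : Measurable t) (hΘ : IsOpen Θ)
    (hint : ∀ θ ∈ Θ, Integrable (fun x => Real.exp ⟪θ, t x⟫) ν) {θ : 𝔼 p} (hθ : θ ∈ Θ) :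
    ∃ r > 0, Integrable (fun x => Real.exp (⟪θ, t x⟫ + r * ‖t x‖)) ν := by
  obtain ⟨ε, hε, hball⟩ := Metric.isOpen_iff.1 hΘ θ hθ
  have hp' : (0 : ℝ) < p := by exact_mod_cast hp
  have hmem : ∀ (i : Fin p) (s : ℝ), |s| < ε → θ + s • EuclideanSpace.single i (1 : ℝ) ∈ Θ := by
    intro i s hs
    apply hball
    simpa [norm_smul] using hs
  -- Division by `p` offsets the factor in `exp_norm_le_sum`: the shifts along the axes become `±ε /
  -- 2`, inside the ball in `Θ`.
  refine ⟨ε / 2 / p, by positivity, ?_⟩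
  have hI : Integrable (fun x => ∑ i : Fin p,
      (Real.exp ⟪θ + (ε / 2) • EuclideanSpace.single i (1 : ℝ), t x⟫ +
        Real.exp ⟪θ + (-(ε / 2)) • EuclideanSpace.single i (1 : ℝ), t x⟫)) ν := by
    refine integrable_finsetSum _ fun i _ => (hint _ (hmem i _ ?_)).add (hint _ (hmem i _ ?_))
    · rw [abs_of_pos (by positivity)]; linarith
    · rw [abs_neg, abs_of_pos (by positivity)]; linarith
  refine hI.mono' (by fun_prop) (ae_of_all _ fun x => ?_)
  rw [Real.norm_of_nonneg (Real.exp_pos _).le, Real.exp_add]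
  calc _ ≤ Real.exp ⟪θ, t x⟫ * ∑ i, (Real.exp (p * (ε / 2 / p) * t x i) +
        Real.exp (-(p * (ε / 2 / p) * t x i))) := by
        gcongr; exact exp_norm_le_sum hp (by positivity) _
    _ = _ := by
        rw [Finset.mul_sum]
        refine Finset.sum_congr rfl fun i _ => ?_
        rw [mul_div_cancel₀ _ hp'.ne', mul_add, ← Real.exp_add, ← Real.exp_add]
        simp [inner_add_left, inner_smul_left, EuclideanSpace.inner_single_left]

/-- A strongly measurable weight that grows slower than every exponential of `‖t‖`. -/
structure ModerateGrowth {F : Type*} [NormedAddCommGroup F] (t : X → 𝔼 p) (w : X → F) :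
    Prop where
  meas : StronglyMeasurable w
  bound : ∀ ε > 0, ∃ C, 0 ≤ C ∧ ∀ x, ‖w x‖ ≤ C * Real.exp (ε * ‖t x‖)

section Growth

variable {F G H : Type*} [NormedAddCommGroup F] [NormedAddCommGroup G] [NormedAddCommGroup H]

/-- Every exponential rate is available, so each factor can use half of it. All products of weights
below reduce to this bound. -/
theorem ModerateGrowth.of_norm_le {w : X → F} {w₁ : X → G} {w₂ : X → H}
    (h₁ : ModerateGrowth t w₁) (h₂ : ModerateGrowth t w₂) (hw : StronglyMeasurable w)
    (hle : ∀ x, ‖w x‖ ≤ ‖w₁ x‖ * ‖w₂ x‖) : ModerateGrowth t w := by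
  refine ⟨hw, fun ε hε => ?_⟩
  obtain ⟨C₁, hC₁, h₁⟩ := h₁.bound (ε / 2) (by positivity)
  obtain ⟨C₂, hC₂, h₂⟩ := h₂.bound (ε / 2) (by positivity)
  refine ⟨C₁ * C₂, by positivity, fun x => (hle x).trans ?_⟩
  calc _ ≤ (C₁ * Real.exp (ε / 2 * ‖t x‖)) * (C₂ * Real.exp (ε / 2 * ‖t x‖)) :=
        mul_le_mul (h₁ x) (h₂ x) (norm_nonneg _) (by positivity)
    _ = C₁ * C₂ * (Real.exp (ε / 2 * ‖t x‖) * Real.exp (ε / 2 * ‖t x‖)) := by ring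
    _ = _ := by rw [← Real.exp_add]; congr 2; ring

theorem ModerateGrowth.const (c : F) : ModerateGrowth t (fun _ : X => c) :=
  ⟨stronglyMeasurable_const, fun ε hε => ⟨‖c‖, norm_nonneg _, fun x =>
    le_mul_of_one_le_right (norm_nonneg _) (Real.one_le_exp (by positivity))⟩⟩

theorem ModerateGrowth.self (ht : Measurable t) : ModerateGrowth t t := by
  refine ⟨ht.stronglyMeasurable, fun ε hε => ⟨1 / ε, by positivity, fun x => ?_⟩⟩
  have := Real.add_one_le_exp (ε * ‖t x‖)
  rw [div_mul_eq_mul_div, one_mul, le_div_iff₀ hε]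
  linarith

theorem ModerateGrowth.add {v w : X → F} (hv : ModerateGrowth t v) (hw : ModerateGrowth t w) :
    ModerateGrowth t (fun x => v x + w x) := by
  refine ⟨hv.meas.add hw.meas, fun ε hε => ?_⟩
  obtain ⟨C₁, hC₁, h₁⟩ := hv.bound ε hε
  obtain ⟨C₂, hC₂, h₂⟩ := hw.bound ε hε
  refine ⟨C₁ + C₂, by positivity, fun x => (norm_add_le _ _).trans ?_⟩
  rw [add_mul]
  exact add_le_add (h₁ x) (h₂ x)

theorem ModerateGrowth.sub_const {v : X → F} (hv : ModerateGrowth t v) (c : F) :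
    ModerateGrowth t (fun x => v x - c) := by
  simpa [sub_eq_add_neg] using hv.add (ModerateGrowth.const (-c))

theorem ModerateGrowth.clm [NormedSpace ℝ F] [NormedSpace ℝ G] (L : F →L[ℝ] G) {w : X → F}
    (hw : ModerateGrowth t w) : ModerateGrowth t (fun x => L (w x)) :=
  (ModerateGrowth.const L).of_norm_le hw (L.continuous.comp_stronglyMeasurable hw.meas)
    fun _ => L.le_opNorm _

theorem ModerateGrowth.mul {v w : X → ℝ} (hv : ModerateGrowth t v) (hw : ModerateGrowth t w) :
    ModerateGrowth t (fun x => v x * w x) :=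
  hv.of_norm_le hw (hv.meas.mul hw.meas) fun _ => (norm_mul _ _).le

theorem ModerateGrowth.smul [NormedSpace ℝ F] {v : X → ℝ} {w : X → F} (hv : ModerateGrowth t v)
    (hw : ModerateGrowth t w) : ModerateGrowth t (fun x => v x • w x) :=
  hv.of_norm_le hw (hv.meas.smul hw.meas) fun _ => (norm_smul _ _).le

theorem ModerateGrowth.inner_left (a : 𝔼 p) {w : X → 𝔼 p} (hw : ModerateGrowth t w) :
    ModerateGrowth t (fun x => ⟪a, w x⟫) :=
  hw.clm (innerSL ℝ a)

/-- This is the weight produced by one differentiation in `θ`; that it stays in the class makes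
induction on the order possible. -/
theorem ModerateGrowth.inner_smulRight [NormedSpace ℝ F] (ht : Measurable t) {w : X → F}
    (hw : ModerateGrowth t w) :
    ModerateGrowth t (fun x => (innerSL ℝ (t x)).smulRight (w x)) := by
  refine (ModerateGrowth.self ht).of_norm_le hw ?_ fun x => ?_
  · have h1 : StronglyMeasurable fun x => innerSL ℝ (t x) :=
      (innerSL ℝ).continuous.comp_stronglyMeasurable ht.stronglyMeasurable
    exact (ContinuousLinearMap.smulRightL ℝ (𝔼 p) F).continuous₂.comp_stronglyMeasurable
      (h1.prodMk hw.meas)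
  · rw [ContinuousLinearMap.norm_smulRight_apply, innerSL_apply_norm]

end Growth

section Deriv

variable {F : Type*} [NormedAddCommGroup F]

theorem ModerateGrowth.integrable_add_norm (hp : 1 ≤ p) (ht : Measurable t) (hΘ : IsOpen Θ)
    (hint : ∀ θ ∈ Θ, Integrable (fun x => Real.exp ⟪θ, t x⟫) ν) {w : X → F}
    (hw : ModerateGrowth t w) {θ : 𝔼 p} (hθ : θ ∈ Θ) :
    ∃ r > 0, Integrable (fun x => Real.exp (⟪θ, t x⟫ + r * ‖t x‖) * ‖w x‖) ν := by
  obtain ⟨r, hr, hI⟩ := exists_integrable_exp_inner_add_norm hp ht hΘ hint hθ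
  refine ⟨r / 2, by positivity, ?_⟩
  obtain ⟨C, hC, hb⟩ := hw.bound (r / 2) (by positivity)
  refine (hI.const_mul C).mono' ?_ (ae_of_all _ fun x => ?_)
  · have := hw.meas.norm.aestronglyMeasurable (μ := ν)
    refine AEStronglyMeasurable.mul ?_ this
    fun_prop
  · rw [Real.norm_of_nonneg (by positivity)]
    calc _ ≤ Real.exp (⟪θ, t x⟫ + r / 2 * ‖t x‖) * (C * Real.exp (r / 2 * ‖t x‖)) := by
          gcongr; exact hb x
      _ = C * (Real.exp (⟪θ, t x⟫ + r / 2 * ‖t x‖) * Real.exp (r / 2 * ‖t x‖)) := by ring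
      _ = _ := by rw [← Real.exp_add]; congr 2; ring

variable [NormedSpace ℝ F]

theorem ModerateGrowth.integrable (hp : 1 ≤ p) (ht : Measurable t) (hΘ : IsOpen Θ)
    (hint : ∀ θ ∈ Θ, Integrable (fun x => Real.exp ⟪θ, t x⟫) ν) {w : X → F}
    (hw : ModerateGrowth t w) {θ : 𝔼 p} (hθ : θ ∈ Θ) :
    Integrable (fun x => Real.exp ⟪θ, t x⟫ • w x) ν := by
  obtain ⟨r, hr, hI⟩ := hw.integrable_add_norm hp ht hΘ hint hθ
  refine hI.mono' ?_ (ae_of_all _ fun x => ?_)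
  · refine AEStronglyMeasurable.smul ?_ hw.meas.aestronglyMeasurable
    fun_prop
  · rw [norm_smul, Real.norm_of_nonneg (by positivity)]
    gcongr
    nlinarith [norm_nonneg (t x)]

/-- Differentiation under the integral: on a ball of radius `r` around `θ` the exponent changes by
at most `r * ‖t x‖`, which the surplus in `integrable_add_norm` dominates. -/
theorem ModerateGrowth.hasFDerivAt (hp : 1 ≤ p) (ht : Measurable t) (hΘ : IsOpen Θ)
    (hint : ∀ θ ∈ Θ, Integrable (fun x => Real.exp ⟪θ, t x⟫) ν) {w : X → F}
    (hw : ModerateGrowth t w) {θ : 𝔼 p} (hθ : θ ∈ Θ) :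
    HasFDerivAt (fun θ' => ∫ x, Real.exp ⟪θ', t x⟫ • w x ∂ν)
      (∫ x, Real.exp ⟪θ, t x⟫ • (innerSL ℝ (t x)).smulRight (w x) ∂ν) θ := by
  have hw' := hw.inner_smulRight ht
  obtain ⟨r, hr, hI⟩ := hw'.integrable_add_norm hp ht hΘ hint hθ
  refine hasFDerivAt_integral_of_dominated_of_fderiv_le (s := Metric.ball θ r)
    (F' := fun θ' x => Real.exp ⟪θ', t x⟫ • (innerSL ℝ (t x)).smulRight (w x))
    (Metric.ball_mem_nhds θ hr) (Eventually.of_forall fun θ' => ?_)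
    (hw.integrable hp ht hΘ hint hθ) (hw'.integrable hp ht hΘ hint hθ).1
    (ae_of_all _ fun x θ' hθ' => ?_) hI (ae_of_all _ fun x θ' hθ' => ?_)
  · refine AEStronglyMeasurable.smul ?_ hw.meas.aestronglyMeasurable
    fun_prop
  · rw [norm_smul, Real.norm_of_nonneg (by positivity)]
    gcongr
    have h1 : ⟪θ' - θ, t x⟫ ≤ r * ‖t x‖ := (real_inner_le_norm _ _).trans (by
      gcongr; exact (mem_ball_iff_norm.1 hθ').le)
    rw [inner_sub_left] at h1
    linarith
  · have h1 : HasFDerivAt (fun θ' : 𝔼 p => ⟪θ', t x⟫) (innerSL ℝ (t x)) θ' := by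
      have := (innerSL ℝ (t x)).hasFDerivAt (x := θ')
      refine this.congr_of_eventuallyEq (Eventually.of_forall fun y => ?_)
      simp [real_inner_comm]
    convert! h1.exp.smul_const (w x) using 1
    ext v
    simp [smul_smul]

/-- The derivative is an integral of the same kind with values in a space of linear maps, hence an
induction over all target spaces `F` at once. -/
theorem ModerateGrowth.contDiffOn (hp : 1 ≤ p) (ht : Measurable t) (hΘ : IsOpen Θ)
    (hint : ∀ θ ∈ Θ, Integrable (fun x => Real.exp ⟪θ, t x⟫) ν) {F : Type}
    [NormedAddCommGroup F] [NormedSpace ℝ F] {w : X → F} (hw : ModerateGrowth t w) :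
    ContDiffOn ℝ ∞ (fun θ' => ∫ x, Real.exp ⟪θ', t x⟫ • w x ∂ν) Θ := by
  rw [contDiffOn_infty]
  intro n
  induction n generalizing F with
  | zero =>
    simp only [Nat.cast_zero, contDiffOn_zero]
    exact fun θ hθ => (hw.hasFDerivAt hp ht hΘ hint hθ).continuousAt.continuousWithinAt
  | succ n ih =>
    rw [Nat.cast_add, Nat.cast_one, contDiffOn_succ_iff_fderiv_of_isOpen hΘ]
    refine ⟨fun θ hθ => (hw.hasFDerivAt hp ht hΘ hint hθ).differentiableAt.differentiableWithinAt,
      by simp, ?_⟩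
    exact (ih (hw.inner_smulRight ht)).congr fun θ hθ => (hw.hasFDerivAt hp ht hΘ hint hθ).fderiv

end Deriv

end ExpIntegral

/-! ### Cumulant function, mean, covariance and divergence of the family. -/

section Family

variable {X : Type*} [MeasurableSpace X] {p : ℕ}

/-- The standing hypotheses on an exponential family over an open parameter set. -/
structure MinimalFamily (ν : Measure X) (t : X → 𝔼 p) (Θ : Set (𝔼 p)) : Prop where
  one_le : 1 ≤ p
  meas : Measurable t
  isOpen : IsOpen Θ
  integrable : ∀ θ ∈ Θ, Integrable (fun x => Real.exp ⟪θ, t x⟫) ν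
  minimal : ∀ a : 𝔼 p, a ≠ 0 → ∀ c : ℝ, ¬ ∀ᵐ x ∂ν, ⟪a, t x⟫ = c

/-- The law of one observation. -/
def law (ν : Measure X) (t : X → 𝔼 p) (θ : 𝔼 p) : Measure X :=
  ν.withDensity fun x => ENNReal.ofReal (expDensity ν t θ x)

/-- The mean of the canonical statistic. -/
def mean (ν : Measure X) (t : X → 𝔼 p) (θ : 𝔼 p) : 𝔼 p :=
  ∫ x, t x ∂(law ν t θ)

/-- The covariance operator of the canonical statistic. -/
def cov (ν : Measure X) (t : X → 𝔼 p) (θ : 𝔼 p) : (𝔼 p) →L[ℝ] (𝔼 p) :=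
  ∫ x, (innerSL ℝ (t x - mean ν t θ)).smulRight (t x - mean ν t θ) ∂(law ν t θ)

/-- The Kullback-Leibler divergence of the law under `θ₀` from the law under `θ`. -/
def divergence (ν : Measure X) (t : X → 𝔼 p) (θ₀ θ : 𝔼 p) : ℝ :=
  cumulant ν t θ - cumulant ν t θ₀ - ⟪θ - θ₀, mean ν t θ₀⟫

variable {ν : Measure X} {t : X → 𝔼 p} {Θ : Set (𝔼 p)}

theorem expDensity_pos (θ : 𝔼 p) (x : X) : 0 < expDensity ν t θ x := Real.exp_pos _

theorem measurable_expDensity (ht : Measurable t) (θ : 𝔼 p) :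
    Measurable (expDensity ν t θ) := by
  unfold expDensity
  fun_prop

theorem expDensity_eq (θ : 𝔼 p) (x : X) :
    expDensity ν t θ x = Real.exp (-cumulant ν t θ) * Real.exp ⟪θ, t x⟫ := by
  rw [expDensity, ← Real.exp_add]; congr 1; ring

theorem integral_law {G : Type*} [NormedAddCommGroup G] [NormedSpace ℝ G] (ht : Measurable t)
    (θ : 𝔼 p) (g : X → G) :
    ∫ x, g x ∂(law ν t θ) = Real.exp (-cumulant ν t θ) • ∫ x, Real.exp ⟪θ, t x⟫ • g x ∂ν := by
  rw [law, integral_withDensity_eq_integral_toReal_smul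
    (measurable_expDensity ht θ).ennreal_ofReal (ae_of_all _ fun _ => ENNReal.ofReal_lt_top),
    ← integral_smul]
  refine integral_congr_ae (ae_of_all _ fun x => ?_)
  simp only [ENNReal.toReal_ofReal (expDensity_pos θ x).le]
  rw [expDensity_eq, mul_smul]

/-- The density is strictly positive, so the null sets agree; this carries minimality from `ν` to
the laws. -/
theorem ae_law_iff (ht : Measurable t) (θ : 𝔼 p) {P : X → Prop} :
    (∀ᵐ x ∂(law ν t θ), P x) ↔ ∀ᵐ x ∂ν, P x := by
  rw [law, ae_withDensity_iff (measurable_expDensity ht θ).ennreal_ofReal]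
  refine eventually_congr (ae_of_all _ fun x => ?_)
  simp [expDensity_pos]

namespace MinimalFamily

variable (hF : MinimalFamily ν t Θ)
include hF

theorem base_ne_zero : ν ≠ 0 := by
  rintro rfl
  refine hF.minimal (EuclideanSpace.single ⟨0, hF.one_le⟩ 1) ?_ 0 (by simp)
  simp

theorem exp_cumulant {θ : 𝔼 p} (hθ : θ ∈ Θ) :
    Real.exp (cumulant ν t θ) = ∫ x, Real.exp ⟪θ, t x⟫ ∂ν := by
  have : NeZero ν := ⟨hF.base_ne_zero⟩
  rw [cumulant, Real.exp_log (integral_exp_pos (hF.integrable θ hθ))]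

theorem integrable_law {G : Type*} [NormedAddCommGroup G] [NormedSpace ℝ G] {w : X → G}
    (hw : ModerateGrowth t w) {θ : 𝔼 p} (hθ : θ ∈ Θ) : Integrable w (law ν t θ) := by
  rw [law, integrable_withDensity_iff_integrable_smul'
    (measurable_expDensity hF.meas θ).ennreal_ofReal (ae_of_all _ fun _ => ENNReal.ofReal_lt_top)]
  refine ((hw.integrable hF.one_le hF.meas hF.isOpen hF.integrable hθ).smul
    (Real.exp (-cumulant ν t θ))).congr (ae_of_all _ fun x => ?_)
  simp only [ENNReal.toReal_ofReal (expDensity_pos θ x).le, Pi.smul_apply]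
  rw [expDensity_eq, mul_smul]

theorem isProbabilityMeasure_law {θ : 𝔼 p} (hθ : θ ∈ Θ) : IsProbabilityMeasure (law ν t θ) := by
  have hfin : IsFiniteMeasure (law ν t θ) := by
    have := hF.integrable_law (ModerateGrowth.const (1 : ℝ)) hθ
    exact (integrable_const_iff_isFiniteMeasure one_ne_zero).1 this
  have h1 : ∫ _, (1 : ℝ) ∂(law ν t θ) = 1 := by
    rw [integral_law hF.meas]
    simp only [smul_eq_mul, mul_one]
    rw [← hF.exp_cumulant hθ, ← Real.exp_add]
    simp
  simp only [integral_const, smul_eq_mul, mul_one] at h1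
  constructor
  rw [measureReal_def] at h1
  rwa [← ENNReal.toReal_eq_one_iff]

theorem growth_centered (θ : 𝔼 p) : ModerateGrowth t (fun x => t x - mean ν t θ) :=
  (ModerateGrowth.self hF.meas).sub_const _

theorem integral_centered {θ : 𝔼 p} (hθ : θ ∈ Θ) : ∫ x, (t x - mean ν t θ) ∂(law ν t θ) = 0 := by
  have := hF.isProbabilityMeasure_law hθ
  rw [integral_sub (hF.integrable_law (ModerateGrowth.self hF.meas) hθ) (integrable_const _)]
  simp [mean]

theorem integral_inner_centered {θ : 𝔼 p} (hθ : θ ∈ Θ) (u : 𝔼 p) :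
    ∫ x, ⟪u, t x - mean ν t θ⟫ ∂(law ν t θ) = 0 := by
  rw [integral_inner (hF.integrable_law (hF.growth_centered θ) hθ), hF.integral_centered hθ,
    inner_zero_right]

theorem cov_apply {θ : 𝔼 p} (hθ : θ ∈ Θ) (u : 𝔼 p) : cov ν t θ u =
    ∫ x, ⟪t x - mean ν t θ, u⟫ • (t x - mean ν t θ) ∂(law ν t θ) := by
  rw [cov, ContinuousLinearMap.integral_apply]
  · rfl
  · refine hF.integrable_law ?_ hθ
    refine (hF.growth_centered θ).of_norm_le (hF.growth_centered θ) ?_ fun x => ?_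
    · have h1 : StronglyMeasurable fun x => innerSL ℝ (t x - mean ν t θ) :=
        (innerSL ℝ).continuous.comp_stronglyMeasurable (hF.growth_centered θ).meas
      exact (ContinuousLinearMap.smulRightL ℝ (𝔼 p) (𝔼 p)).continuous₂.comp_stronglyMeasurable
        (h1.prodMk (hF.growth_centered θ).meas)
    · rw [ContinuousLinearMap.norm_smulRight_apply, innerSL_apply_norm]

theorem inner_cov {θ : 𝔼 p} (hθ : θ ∈ Θ) (u v : 𝔼 p) : ⟪v, cov ν t θ u⟫ =
    ∫ x, ⟪v, t x - mean ν t θ⟫ * ⟪u, t x - mean ν t θ⟫ ∂(law ν t θ) := by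
  have hg := hF.growth_centered θ
  rw [hF.cov_apply hθ, ← integral_inner]
  · refine integral_congr_ae (ae_of_all _ fun x => ?_)
    simp only [inner_smul_right]
    rw [real_inner_comm u, mul_comm]
  · refine hF.integrable_law (ModerateGrowth.smul ?_ hg) hθ
    simpa only [real_inner_comm] using hg.inner_left u

theorem inner_cov_comm {θ : 𝔼 p} (hθ : θ ∈ Θ) (u v : 𝔼 p) :
    ⟪v, cov ν t θ u⟫ = ⟪u, cov ν t θ v⟫ := by
  rw [hF.inner_cov hθ, hF.inner_cov hθ]
  simp only [mul_comm]

/-- Zero variance of `⟪u, t⟫` would put `t` almost everywhere in a hyperplane, against minimality.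
-/
theorem inner_cov_pos {θ : 𝔼 p} (hθ : θ ∈ Θ) {u : 𝔼 p} (hu : u ≠ 0) :
    0 < ⟪u, cov ν t θ u⟫ := by
  have hg := (hF.growth_centered θ).inner_left u
  rw [hF.inner_cov hθ]
  have h0 : 0 ≤ ∫ x, ⟪u, t x - mean ν t θ⟫ * ⟪u, t x - mean ν t θ⟫ ∂(law ν t θ) :=
    integral_nonneg fun x => mul_self_nonneg _
  refine h0.lt_of_ne fun h => ?_
  rw [eq_comm, integral_eq_zero_iff_of_nonneg (fun x => mul_self_nonneg _)
    (hF.integrable_law (hg.mul hg) hθ)] at h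
  refine hF.minimal u hu ⟪u, mean ν t θ⟫ ((ae_law_iff hF.meas θ).1 ?_)
  filter_upwards [h] with x hx
  have : ⟪u, t x - mean ν t θ⟫ = 0 := mul_self_eq_zero.1 hx
  rwa [inner_sub_right, sub_eq_zero] at this

theorem hasFDerivAt_cumulant {θ : 𝔼 p} (hθ : θ ∈ Θ) :
    HasFDerivAt (cumulant ν t) (innerSL ℝ (mean ν t θ)) θ := by
  have h1 := (ModerateGrowth.const (t := t) (1 : ℝ)).hasFDerivAt hF.one_le hF.meas hF.isOpen
    hF.integrable hθ
  simp only [smul_eq_mul, mul_one] at h1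
  have hpos : 0 < ∫ x, Real.exp ⟪θ, t x⟫ ∂ν := by
    rw [← hF.exp_cumulant hθ]; exact Real.exp_pos _
  have h2 := h1.log hpos.ne'
  refine h2.congr_fderiv ?_
  ext v
  rw [← hF.exp_cumulant hθ, ← Real.exp_neg, smul_apply,
    ContinuousLinearMap.integral_apply, innerSL_apply_apply, real_inner_comm, mean,
    ← integral_inner (hF.integrable_law (ModerateGrowth.self hF.meas) hθ), integral_law hF.meas]
  · simp [real_inner_comm]
  · exact ((ModerateGrowth.const (1 : ℝ)).inner_smulRight hF.meas).integrable hF.one_le hF.meas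
      hF.isOpen hF.integrable hθ

theorem contDiffOn_cumulant : ContDiffOn ℝ ∞ (cumulant ν t) Θ := by
  have h1 := (ModerateGrowth.const (t := t) (1 : ℝ)).contDiffOn hF.one_le hF.meas hF.isOpen
    hF.integrable
  simp only [smul_eq_mul, mul_one] at h1
  refine h1.log fun θ hθ => ?_
  rw [← hF.exp_cumulant hθ]; exact (Real.exp_pos _).ne'

theorem contDiffOn_mean : ContDiffOn ℝ ∞ (mean ν t) Θ := by
  have h1 := (ModerateGrowth.self hF.meas).contDiffOn hF.one_le hF.meas hF.isOpen
    hF.integrable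
  refine (hF.contDiffOn_cumulant.neg.exp.smul h1).congr fun θ _ => ?_
  rw [mean, integral_law hF.meas]
  rfl

theorem hasFDerivAt_mean {θ : 𝔼 p} (hθ : θ ∈ Θ) :
    HasFDerivAt (mean ν t) (cov ν t θ) θ := by
  have := hF.isProbabilityMeasure_law hθ
  have hg := ModerateGrowth.self hF.meas
  have h1 := hg.hasFDerivAt hF.one_le hF.meas hF.isOpen hF.integrable hθ
  have h2 := (hF.hasFDerivAt_cumulant hθ).neg.exp.smul h1
  have h3 : mean ν t = fun θ' => Real.exp (-cumulant ν t θ') • ∫ x, Real.exp ⟪θ', t x⟫ • t x ∂ν := by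
    funext θ'
    rw [mean, integral_law hF.meas]
  refine (h2.congr_of_eventuallyEq (Eventually.of_forall fun θ' => congrFun h3 θ')).congr_fderiv ?_
  ext1 u
  have hu : ModerateGrowth t (fun x => ⟪t x, u⟫) := by
    simpa only [real_inner_comm] using hg.inner_left u
  -- The product rule yields the uncentred form of the covariance; the two forms differ by a
  -- multiple of `t - mean`, whose integral is zero.
  have h4 : cov ν t θ u = ∫ x, ⟪t x, u⟫ • t x ∂(law ν t θ) - ⟪mean ν t θ, u⟫ • mean ν t θ := by
    have h5 : ∀ x, ⟪t x - mean ν t θ, u⟫ • (t x - mean ν t θ) =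
        ⟪t x, u⟫ • t x - ⟪t x, u⟫ • mean ν t θ - ⟪mean ν t θ, u⟫ • (t x - mean ν t θ) := by
      intro x
      rw [inner_sub_left, sub_smul, smul_sub]
    have h6 : ∫ x, ⟪t x, u⟫ ∂(law ν t θ) = ⟪mean ν t θ, u⟫ := by
      simp_rw [real_inner_comm u]
      rw [integral_inner (hF.integrable_law hg hθ)]
      rfl
    rw [hF.cov_apply hθ]
    simp_rw [h5]
    rw [integral_sub, integral_sub, integral_smul, hF.integral_centered hθ, smul_zero, sub_zero,
      integral_smul_const, h6]
    · exact hF.integrable_law (hu.smul hg) hθ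
    · exact (hF.integrable_law hu hθ).smul_const _
    · exact (hF.integrable_law (hu.smul hg) hθ).sub ((hF.integrable_law hu hθ).smul_const _)
    · exact hF.integrable_law ((ModerateGrowth.const _).smul (hF.growth_centered θ)) hθ
  rw [h4, integral_law hF.meas]
  simp only [add_apply, smul_apply, neg_apply, ContinuousLinearMap.smulRight_apply,
    innerSL_apply_apply]
  rw [ContinuousLinearMap.integral_apply]
  · have h7 : mean ν t θ = Real.exp (-cumulant ν t θ) • ∫ x, Real.exp ⟪θ, t x⟫ • t x ∂ν :=
      congrFun h3 θ
    simp only [smul_apply, ContinuousLinearMap.smulRight_apply, innerSL_apply_apply, smul_eq_mul,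
      Pi.neg_apply]
    generalize (∫ x, Real.exp ⟪θ, t x⟫ • t x ∂ν) = I at h7 ⊢
    rw [mul_neg, mul_comm, neg_smul, mul_smul, ← h7, sub_eq_add_neg]
  · exact (hg.inner_smulRight hF.meas).integrable hF.one_le hF.meas
      hF.isOpen hF.integrable hθ

/-- The divergence is the cumulant generating function of the centred statistic. Its positivity, its
convexity along segments and the Chernoff bound all come from this identity. -/
theorem integral_exp_inner_centered {θ₀ θ : 𝔼 p} (hθ : θ ∈ Θ) :
    ∫ x, Real.exp ⟪θ - θ₀, t x - mean ν t θ₀⟫ ∂(law ν t θ₀) = Real.exp (divergence ν t θ₀ θ) := by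
  rw [integral_law hF.meas, divergence]
  have : ∀ x, Real.exp ⟪θ₀, t x⟫ • Real.exp ⟪θ - θ₀, t x - mean ν t θ₀⟫ =
      Real.exp (-⟪θ - θ₀, mean ν t θ₀⟫) * Real.exp ⟪θ, t x⟫ := by
    intro x
    rw [smul_eq_mul, ← Real.exp_add, ← Real.exp_add, inner_sub_right, inner_sub_left]
    congr 1; ring
  simp_rw [this]
  rw [integral_const_mul, ← hF.exp_cumulant hθ, smul_eq_mul, ← Real.exp_add, ← Real.exp_add]
  congr 1; ring

theorem integrable_exp_inner_centered {θ₀ θ : 𝔼 p} (hθ₀ : θ₀ ∈ Θ) (hθ : θ ∈ Θ) :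
    Integrable (fun x => Real.exp ⟪θ - θ₀, t x - mean ν t θ₀⟫) (law ν t θ₀) := by
  have := hF.isProbabilityMeasure_law hθ₀
  -- A non-integrable function has Bochner integral zero, whereas this integral is an exponential.
  refine not_imp_comm.1 integral_undef ?_
  rw [hF.integral_exp_inner_centered hθ]
  exact (Real.exp_pos _).ne'

/-- The inequality `1 + V ≤ exp V` is integrated with `V` centred; it is strict unless `V = 0`, and
`V = 0` almost everywhere is excluded by minimality. -/
theorem divergence_pos {θ₀ θ : 𝔼 p} (hθ₀ : θ₀ ∈ Θ) (hθ : θ ∈ Θ) (hne : θ ≠ θ₀) :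
    0 < divergence ν t θ₀ θ := by
  have := hF.isProbabilityMeasure_law hθ₀
  have hi := hF.integrable_exp_inner_centered hθ₀ hθ
  have hV := hF.integrable_law ((hF.growth_centered θ₀).inner_left (θ - θ₀)) hθ₀
  rw [← Real.exp_lt_exp, Real.exp_zero, ← hF.integral_exp_inner_centered hθ]
  have h1 : ∫ x, (1 + ⟪θ - θ₀, t x - mean ν t θ₀⟫) ∂(law ν t θ₀) = 1 := by
    rw [integral_add (integrable_const _) hV, hF.integral_inner_centered hθ₀]
    simp
  conv_lhs => rw [← h1]
  refine (integral_mono ((integrable_const _).add hV) hi fun x => ?_).lt_of_ne fun h => ?_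
  · simpa [add_comm] using Real.add_one_le_exp ⟪θ - θ₀, t x - mean ν t θ₀⟫
  · rw [integral_eq_iff_of_ae_le ((integrable_const _).add hV) hi
      (ae_of_all _ fun x => by
        simpa [add_comm] using Real.add_one_le_exp ⟪θ - θ₀, t x - mean ν t θ₀⟫)] at h
    refine hF.minimal (θ - θ₀) (sub_ne_zero.2 hne) ⟪θ - θ₀, mean ν t θ₀⟫
      ((ae_law_iff hF.meas θ₀).1 ?_)
    filter_upwards [h] with x hx
    by_contra hc
    have : ⟪θ - θ₀, t x - mean ν t θ₀⟫ ≠ 0 := by rwa [inner_sub_right, sub_ne_zero]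
    have := Real.add_one_lt_exp this
    simp only [Pi.add_apply] at hx
    linarith

/-- Convexity of the divergence, which vanishes at `θ₀`. `Θ` need not be convex, so the inequality
is obtained under the integral from convexity of `exp`, using only the points that occur in it. -/
theorem divergence_segment {θ₀ θ : 𝔼 p} (hθ₀ : θ₀ ∈ Θ) (hθ : θ ∈ Θ) {s : ℝ} (hs0 : 0 ≤ s)
    (hs1 : s ≤ 1) (hs : θ₀ + s • (θ - θ₀) ∈ Θ) :
    divergence ν t θ₀ (θ₀ + s • (θ - θ₀)) ≤ s * divergence ν t θ₀ θ := by
  have := hF.isProbabilityMeasure_law hθ₀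
  have hi := hF.integrable_exp_inner_centered hθ₀ hθ
  have hi' := hF.integrable_exp_inner_centered hθ₀ hs
  set d := divergence ν t θ₀ θ with hd
  -- Convexity is applied to `V - d`: since `exp (V - d)` has integral one, the bracket on the right
  -- integrates to one.
  have key : ∫ x, Real.exp ⟪θ₀ + s • (θ - θ₀) - θ₀, t x - mean ν t θ₀⟫ ∂(law ν t θ₀) ≤
      ∫ x, Real.exp (s * d) * (s * (Real.exp (-d) * Real.exp ⟪θ - θ₀, t x - mean ν t θ₀⟫)
        + (1 - s)) ∂(law ν t θ₀) := by
    refine integral_mono hi' ((((hi.const_mul _).const_mul _).add (integrable_const _)).const_mul _)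
      fun x => ?_
    simp only [add_sub_cancel_left, inner_smul_left]
    set V := ⟪θ - θ₀, t x - mean ν t θ₀⟫
    have hc := convexOn_exp.2 (Set.mem_univ (V - d)) (Set.mem_univ 0) hs0 (sub_nonneg.2 hs1)
      (by ring)
    simp only [smul_eq_mul, mul_zero, add_zero, Real.exp_zero, mul_one] at hc
    calc Real.exp (s * V) = Real.exp (s * d) * Real.exp (s * (V - d)) := by
          rw [← Real.exp_add]; congr 1; ring
      _ ≤ _ := by
          rw [← Real.exp_add (-d), neg_add_eq_sub]
          gcongr
  rw [integral_const_mul, integral_add ((hi.const_mul _).const_mul _) (integrable_const _),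
    integral_const_mul, integral_const_mul, hF.integral_exp_inner_centered hθ,
    hF.integral_exp_inner_centered hs, ← hd, ← Real.exp_add] at key
  simp at key
  exact key

/-- The divergence has a positive minimum on the compact sphere of radius `ρ`, and
`divergence_segment` propagates it linearly outwards. -/
theorem exists_divergence_ge {θ₀ : 𝔼 p} {ρ : ℝ} (hρ : 0 < ρ)
    (hball : Metric.closedBall θ₀ ρ ⊆ Θ) :
    ∃ c > 0, ∀ θ ∈ Θ, ρ ≤ ‖θ - θ₀‖ → c * ‖θ - θ₀‖ ≤ divergence ν t θ₀ θ := by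
  have hθ₀ : θ₀ ∈ Θ := hball (Metric.mem_closedBall_self hρ.le)
  have hcont : ContinuousOn (divergence ν t θ₀) (Metric.sphere θ₀ ρ) := by
    have h1 := hF.contDiffOn_cumulant.continuousOn.mono
      (Metric.sphere_subset_closedBall.trans hball)
    unfold divergence
    fun_prop
  obtain ⟨c, hc, hle⟩ := (isCompact_sphere θ₀ ρ).exists_forall_le' hcont (a := 0)
    fun θ hθ => hF.divergence_pos hθ₀ (hball (Metric.sphere_subset_closedBall hθ)) (by
      rintro rfl; simp at hθ; exact hρ.ne hθ)
  refine ⟨c / ρ, by positivity, fun θ hθ hn => ?_⟩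
  have hn0 : 0 < ‖θ - θ₀‖ := hρ.trans_le hn
  set s := ρ / ‖θ - θ₀‖ with hs
  have hs0 : 0 < s := by positivity
  have hmem : θ₀ + s • (θ - θ₀) ∈ Metric.sphere θ₀ ρ := by
    rw [mem_sphere_iff_norm, add_sub_cancel_left, norm_smul, Real.norm_of_nonneg hs0.le, hs]
    field_simp
  have h1 := hF.divergence_segment hθ₀ hθ hs0.le ((div_le_one hn0).2 hn)
    (hball (Metric.sphere_subset_closedBall hmem))
  have h2 := (hle _ hmem).trans h1
  rw [hs] at h2
  rw [div_mul_eq_mul_div, div_le_iff₀ hρ]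
  rw [div_mul_eq_mul_div, le_div_iff₀ hn0] at h2
  linarith

/-- The gradient of the divergence at `y` is the difference of the means at `y` and `θ₀`, of size
`O(‖y - θ₀‖)`; the mean value inequality gives the quadratic bound behind the Gaussian-type
exponential moments. -/
theorem exists_divergence_le {θ₀ : 𝔼 p} (hθ₀ : θ₀ ∈ Θ) :
    ∃ C r : ℝ, 0 ≤ C ∧ 0 < r ∧ ∀ h : 𝔼 p, ‖h‖ ≤ r → θ₀ + h ∈ Θ ∧
      divergence ν t θ₀ (θ₀ + h) ≤ C * ‖h‖ ^ 2 := by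
  obtain ⟨C, hC, hO⟩ := (hF.hasFDerivAt_mean hθ₀).isBigO_sub.exists_nonneg
  obtain ⟨r, hr, hb⟩ := Metric.eventually_nhds_iff_ball.1
    (hO.bound.and (hF.isOpen.mem_nhds hθ₀))
  refine ⟨C, r / 2, hC, by positivity, fun h hh => ?_⟩
  have hmem : ∀ y ∈ Metric.closedBall θ₀ ‖h‖, y ∈ Metric.ball θ₀ r := fun y hy =>
    Metric.mem_ball.2 ((Metric.mem_closedBall.1 hy).trans_lt (by linarith))
  have h1 : θ₀ + h ∈ Metric.closedBall θ₀ ‖h‖ := by simp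
  refine ⟨(hb _ (hmem _ h1)).2, ?_⟩
  have hd : ∀ y ∈ Metric.closedBall θ₀ ‖h‖, HasFDerivWithinAt (divergence ν t θ₀)
      (innerSL ℝ (mean ν t y - mean ν t θ₀)) (Metric.closedBall θ₀ ‖h‖) y := by
    intro y hy
    have h2 : HasFDerivAt (fun y => ⟪y - θ₀, mean ν t θ₀⟫) (innerSL ℝ (mean ν t θ₀)) y := by
      have := ((innerSL ℝ (mean ν t θ₀)).hasFDerivAt (x := y - θ₀)).comp y
        ((hasFDerivAt_id y).sub_const θ₀)
      refine this.congr_of_eventuallyEq (Eventually.of_forall fun y => ?_)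
      simp [real_inner_comm]
    have h3 := ((hF.hasFDerivAt_cumulant (hb _ (hmem _ hy)).2).sub_const
      (cumulant ν t θ₀)).sub h2
    rw [map_sub]
    exact h3.hasFDerivWithinAt
  have hbound := (convex_closedBall θ₀ ‖h‖).norm_image_sub_le_of_norm_hasFDerivWithin_le
    (C := C * ‖h‖) hd (fun y hy => ?_) (Metric.mem_closedBall_self (norm_nonneg _)) h1
  · have h0 : divergence ν t θ₀ θ₀ = 0 := by simp [divergence]
    rw [h0, sub_zero, add_sub_cancel_left] at hbound
    calc _ ≤ _ := le_abs_self _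
      _ ≤ _ := hbound
      _ = _ := by ring
  · rw [innerSL_apply_norm]
    refine (hb _ (hmem _ hy)).1.trans ?_
    gcongr
    exact mem_closedBall_iff_norm.1 hy

end MinimalFamily

end Family

/-! ### Moments of sums of independent centred variables. -/

section ProductMoments

variable {X : Type*} [MeasurableSpace X] {μ : Measure X} [IsProbabilityMeasure μ] {n : ℕ}
  {f g h : X → ℝ}

/-- Factors indexed by `l`, equal to one except at `i`, `j`, `k`, let Fubini treat coinciding and
distinct indices together. -/
theorem integrable_comp_eval_mul_mul
    (hf : Integrable f μ) (hg : Integrable g μ) (hh : Integrable h μ)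
    (hfg : Integrable (fun x => f x * g x) μ) (hfh : Integrable (fun x => f x * h x) μ)
    (hgh : Integrable (fun x => g x * h x) μ) (hfgh : Integrable (fun x => f x * g x * h x) μ)
    (i j k : Fin n) :
    Integrable (fun x : Fin n → X => f (x i) * g (x j) * h (x k)) (Measure.pi fun _ => μ) ∧
    ∫ x, f (x i) * g (x j) * h (x k) ∂(Measure.pi fun _ => μ) =
      ∏ l, ∫ y, (if l = i then f y else 1) * (if l = j then g y else 1) *
        (if l = k then h y else 1) ∂μ := by
  have h1 : ∀ x : Fin n → X, f (x i) * g (x j) * h (x k) =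
      ∏ l, ((if l = i then f (x l) else 1) * (if l = j then g (x l) else 1) *
        (if l = k then h (x l) else 1)) := by
    intro x
    simp only [Finset.prod_mul_distrib, Finset.prod_ite_eq', Finset.mem_univ, if_true]
  simp_rw [h1]
  constructor
  · refine Integrable.fintype_prod (f := fun l y => (if l = i then f y else 1) *
      (if l = j then g y else 1) * (if l = k then h y else 1)) fun l => ?_
    by_cases h₁ : l = i <;> by_cases h₂ : l = j <;> by_cases h₃ : l = k <;>
      simp only [if_true, if_false, h₁, h₂, h₃, mul_one] <;>
      first | assumption | exact integrable_const _ | skip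
    all_goals simp_all
  · exact integral_fintype_prod_eq_prod (fun l y => (if l = i then f y else 1) *
      (if l = j then g y else 1) * (if l = k then h y else 1))

/-- If `i`, `j`, `k` are not all equal, one of them occurs alone and its centred factor integrates
to zero. Only the `n` diagonal terms remain. -/
theorem integral_sum_mul_sum_mul_sum
    (hf : Integrable f μ) (hg : Integrable g μ) (hh : Integrable h μ)
    (hfg : Integrable (fun x => f x * g x) μ) (hfh : Integrable (fun x => f x * h x) μ)
    (hgh : Integrable (fun x => g x * h x) μ) (hfgh : Integrable (fun x => f x * g x * h x) μ)
    (hf0 : ∫ x, f x ∂μ = 0) (hg0 : ∫ x, g x ∂μ = 0) (hh0 : ∫ x, h x ∂μ = 0) :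
    ∫ x : Fin n → X, (∑ i, f (x i)) * (∑ i, g (x i)) * (∑ i, h (x i)) ∂(Measure.pi fun _ => μ) =
      n * ∫ x, f x * g x * h x ∂μ := by
  have key := integrable_comp_eval_mul_mul (n := n) hf hg hh hfg hfh hgh hfgh
  have hzero : ∀ i j k : Fin n, ¬ (i = j ∧ i = k) →
      ∫ x, f (x i) * g (x j) * h (x k) ∂(Measure.pi fun _ => μ) = 0 := by
    intro i j k hne
    rw [(key i j k).2]
    by_cases hij : i = j
    · have hik : i ≠ k := fun h => hne ⟨hij, h⟩
      refine Finset.prod_eq_zero (Finset.mem_univ k) ?_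
      simp [hik.symm, hij ▸ hik.symm, hh0]
    · by_cases hik : i = k
      · refine Finset.prod_eq_zero (Finset.mem_univ j) ?_
        have : j ≠ k := fun h => hij (hik.trans h.symm)
        simp [Ne.symm hij, this, hg0]
      · refine Finset.prod_eq_zero (Finset.mem_univ i) ?_
        simp [hij, hik, hf0]
  have hdiag : ∀ i : Fin n, ∫ x, f (x i) * g (x i) * h (x i) ∂(Measure.pi fun _ => μ) =
      ∫ x, f x * g x * h x ∂μ := by
    intro i
    rw [(key i i i).2, Finset.prod_eq_single i]
    · simp
    · intro l _ hl
      simp [hl]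
    · simp
  have hexp : ∀ x : Fin n → X, (∑ i, f (x i)) * (∑ i, g (x i)) * (∑ i, h (x i)) =
      ∑ i, ∑ j, ∑ k, f (x i) * g (x j) * h (x k) := by
    intro x
    rw [Finset.sum_mul_sum, Finset.sum_mul]
    refine Finset.sum_congr rfl fun i _ => ?_
    rw [Finset.sum_mul]
    exact Finset.sum_congr rfl fun j _ => Finset.mul_sum _ _ _
  simp_rw [hexp]
  rw [integral_finsetSum _ fun i _ => integrable_finsetSum _ fun j _ =>
    integrable_finsetSum _ fun k _ => (key i j k).1]
  have : ∀ i : Fin n, ∫ x, ∑ j, ∑ k, f (x i) * g (x j) * h (x k) ∂(Measure.pi fun _ => μ) =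
      ∫ x, f x * g x * h x ∂μ := by
    intro i
    rw [integral_finsetSum _ fun j _ => integrable_finsetSum _ fun k _ => (key i j k).1,
      Finset.sum_eq_single i, integral_finsetSum _ fun k _ => (key i i k).1,
      Finset.sum_eq_single i, hdiag]
    · exact fun k _ hk => hzero _ _ _ fun h => hk h.2.symm
    · simp
    · intro j _ hj
      rw [integral_finsetSum _ fun k _ => (key i j k).1]
      exact Finset.sum_eq_zero fun k _ => hzero _ _ _ fun h => hj h.1.symm
    · simp
  simp [this]

theorem integral_sum_mul_sum (hf : Integrable f μ) (hg : Integrable g μ)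
    (hfg : Integrable (fun x => f x * g x) μ) (hf0 : ∫ x, f x ∂μ = 0) :
    ∫ x : Fin n → X, (∑ i, f (x i)) * (∑ i, g (x i)) ∂(Measure.pi fun _ => μ) =
      n * ∫ x, f x * g x ∂μ := by
  have key := integrable_comp_eval_mul_mul (n := n) (h := fun _ => 1) hf hg (integrable_const _)
    hfg (by simpa using hf) (by simpa using hg) (by simpa using hfg)
  simp only [mul_one, ite_self] at key
  simp_rw [Finset.sum_mul_sum]
  have h1 : ∀ i j : Fin n, ∫ x, f (x i) * g (x j) ∂(Measure.pi fun _ => μ) =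
      if i = j then ∫ x, f x * g x ∂μ else 0 := by
    intro i j
    -- The third function is the constant one, so the third index is a dummy.
    rw [(key i j i).2]
    split_ifs with hij
    · subst hij
      rw [Finset.prod_eq_single i]
      · simp
      · intro l _ hl
        simp [hl]
      · simp
    · refine Finset.prod_eq_zero (Finset.mem_univ i) ?_
      simp [hij, hf0]
  rw [integral_finsetSum _ fun i _ => integrable_finsetSum _ fun j _ => (key i j i).1]
  have : ∀ i : Fin n, ∫ x, ∑ j, f (x i) * g (x j) ∂(Measure.pi fun _ => μ) =
      ∫ x, f x * g x ∂μ := by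
    intro i
    rw [integral_finsetSum _ fun j _ => (key i j i).1]
    simp [h1]
  simp [this]

theorem integral_sum_comp_eval (hf : Integrable f μ) :
    ∫ x : Fin n → X, ∑ i, f (x i) ∂(Measure.pi fun _ => μ) = n * ∫ x, f x ∂μ := by
  have key := integrable_comp_eval_mul_mul (n := n) (g := fun _ => 1) (h := fun _ => 1) hf
    (integrable_const _) (integrable_const _)
    (by simpa using hf) (by simpa using hf) (integrable_const _) (by simpa using hf)
  simp only [mul_one, ite_self] at key
  rw [integral_finsetSum _ fun i _ => (key i i i).1]
  have : ∀ i : Fin n, ∫ x, f (x i) ∂(Measure.pi fun _ => μ) = ∫ x, f x ∂μ := by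
    intro i
    rw [(key i i i).2, Finset.prod_eq_single i]
    · simp
    · intro l _ hl
      simp [hl]
    · simp
  simp [this]

end ProductMoments

/-! ### Moments and large deviations of the sample mean of the statistic. -/

section SampleMoments

variable {X : Type*} [MeasurableSpace X] {p : ℕ} {ν : Measure X} {t : X → 𝔼 p} {Θ : Set (𝔼 p)}

theorem sampleLaw_eq_pi (θ : 𝔼 p) (n : ℕ) :
    sampleLaw ν t θ n = Measure.pi fun _ => law ν t θ := rfl

/-- The deviation of the sample mean of the canonical statistic from its expectation. -/
def deviation (ν : Measure X) (t : X → 𝔼 p) (θ : 𝔼 p) (n : ℕ) (x : Fin n → X) : 𝔼 p :=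
  (n : ℝ)⁻¹ • ∑ i, (t (x i) - mean ν t θ)

theorem inner_deviation (u : 𝔼 p) (n : ℕ) (x : Fin n → X) :
    ⟪u, deviation ν t θ n x⟫ = (n : ℝ)⁻¹ * ∑ i, ⟪u, t (x i) - mean ν t θ⟫ := by
  rw [deviation, inner_smul_right, inner_sum]

namespace MinimalFamily

variable (hF : MinimalFamily ν t Θ) {θ : 𝔼 p}
include hF

theorem isProbabilityMeasure_sampleLaw (hθ : θ ∈ Θ) (n : ℕ) :
    IsProbabilityMeasure (sampleLaw ν t θ n) := by
  have := hF.isProbabilityMeasure_law hθ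
  rw [sampleLaw_eq_pi]
  infer_instance

theorem measurable_deviation (n : ℕ) : Measurable (deviation ν t θ n) := by
  have := hF.meas
  unfold deviation
  fun_prop

/-- The exponential moments of the norm of the centred sum are those of a Gaussian vector. -/
theorem exists_integral_exp_norm_deviation_le (hθ : θ ∈ Θ) :
    ∃ C r : ℝ, 0 ≤ C ∧ 0 < r ∧ ∀ (n : ℕ) (s : ℝ), 1 ≤ n → 0 ≤ s → s ≤ r →
      Integrable (fun x => Real.exp (n * s * ‖deviation ν t θ n x‖)) (sampleLaw ν t θ n) ∧
      ∫ x, Real.exp (n * s * ‖deviation ν t θ n x‖) ∂(sampleLaw ν t θ n) ≤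
        2 * p * Real.exp (C * n * s ^ 2) := by
  have := hF.isProbabilityMeasure_law hθ
  obtain ⟨C, r, hC, hr, hdiv⟩ := hF.exists_divergence_le hθ
  have hp : (0 : ℝ) < p := by exact_mod_cast hF.one_le
  -- The reduction to coordinates replaces `s` by `p * s`. Along a vector `v` of that norm,
  -- independence gives the exponential moment `exp (n * divergence)` at `θ + v`, and the divergence
  -- is at most `C * (p * s) ^ 2`.
  refine ⟨C * p ^ 2, r / p, by positivity, by positivity, fun n s hn hs0 hsr => ?_⟩
  have hn' : (0 : ℝ) < n := by exact_mod_cast hn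
  have hps : p * s ≤ r := by rwa [le_div_iff₀ hp, mul_comm] at hsr
  have hone : ∀ v : 𝔼 p, ‖v‖ = p * s →
      Integrable (fun x : Fin n → X => Real.exp (n * ⟪v, deviation ν t θ n x⟫))
        (sampleLaw ν t θ n) ∧
      ∫ x, Real.exp (n * ⟪v, deviation ν t θ n x⟫) ∂(sampleLaw ν t θ n) ≤
        Real.exp (C * p ^ 2 * n * s ^ 2) := by
    intro v hv
    obtain ⟨hmem, hle⟩ := hdiv v (by rw [hv]; exact hps)
    have hi := hF.integrable_exp_inner_centered hθ hmem
    have he := hF.integral_exp_inner_centered (θ₀ := θ) hmem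
    simp only [add_sub_cancel_left] at hi he
    have h1 : ∀ x : Fin n → X, Real.exp (n * ⟪v, deviation ν t θ n x⟫) =
        ∏ i, Real.exp ⟪v, t (x i) - mean ν t θ⟫ := by
      intro x
      rw [inner_deviation, ← mul_assoc, mul_inv_cancel₀ hn'.ne', one_mul, Real.exp_sum]
    simp_rw [h1, sampleLaw_eq_pi]
    refine ⟨Integrable.fintype_prod (f := fun _ y => Real.exp ⟪v, t y - mean ν t θ⟫)
      fun _ => hi, ?_⟩
    rw [integral_fintype_prod_eq_pow (fun y => Real.exp ⟪v, t y - mean ν t θ⟫), he,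
      Fintype.card_fin, ← Real.exp_nat_mul]
    refine Real.exp_le_exp.2 ?_
    rw [hv] at hle
    calc n * divergence ν t θ (θ + v) ≤ n * (C * (p * s) ^ 2) := by gcongr
      _ = _ := by ring
  have hnorm : ∀ i : Fin p, ‖(p * s) • EuclideanSpace.single i (1 : ℝ)‖ = p * s := by
    intro i
    rw [norm_smul, PiLp.norm_single, norm_one, mul_one,
      Real.norm_of_nonneg (by positivity)]
  have hsum : ∀ x, Real.exp (n * s * ‖deviation ν t θ n x‖) ≤ ∑ i : Fin p,
      (Real.exp (n * ⟪(p * s) • EuclideanSpace.single i (1 : ℝ), deviation ν t θ n x⟫) +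
      Real.exp (n * ⟪-((p * s) • EuclideanSpace.single i (1 : ℝ)), deviation ν t θ n x⟫)) := by
    intro x
    refine (exp_norm_le_sum hF.one_le (by positivity) _).trans (le_of_eq ?_)
    refine Finset.sum_congr rfl fun i _ => ?_
    simp only [inner_neg_left, inner_smul_left, EuclideanSpace.inner_single_left]
    simp only [map_one, one_mul, conj_trivial]
    congr 2 <;> ring
  have hone' : ∀ i : Fin p, Integrable (fun x =>
      Real.exp (n * ⟪(p * s) • EuclideanSpace.single i (1 : ℝ), deviation ν t θ n x⟫) +
      Real.exp (n * ⟪-((p * s) • EuclideanSpace.single i (1 : ℝ)), deviation ν t θ n x⟫))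
      (sampleLaw ν t θ n) := fun i =>
    (hone _ (hnorm i)).1.add (hone _ ((norm_neg _).trans (hnorm i))).1
  have hI : Integrable (fun x => ∑ i : Fin p,
      (Real.exp (n * ⟪(p * s) • EuclideanSpace.single i (1 : ℝ), deviation ν t θ n x⟫) +
      Real.exp (n * ⟪-((p * s) • EuclideanSpace.single i (1 : ℝ)), deviation ν t θ n x⟫)))
      (sampleLaw ν t θ n) :=
    integrable_finsetSum _ fun i _ => hone' i
  have hI' : Integrable (fun x => Real.exp (n * s * ‖deviation ν t θ n x‖))
      (sampleLaw ν t θ n) := by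
    refine hI.mono' ?_ (ae_of_all _ fun x => ?_)
    · have := hF.measurable_deviation (θ := θ) n
      exact (by fun_prop : Measurable fun x => Real.exp (n * s * ‖deviation ν t θ n x‖)).aestronglyMeasurable
    · rw [Real.norm_of_nonneg (Real.exp_pos _).le]
      exact hsum x
  refine ⟨hI', (integral_mono hI' hI hsum).trans ?_⟩
  rw [integral_finsetSum _ fun i _ => hone' i]
  calc _ ≤ ∑ i : Fin p, (2 * Real.exp (C * p ^ 2 * n * s ^ 2)) := by
        refine Finset.sum_le_sum fun i _ => ?_
        rw [integral_add (hone _ (hnorm i)).1 (hone _ ((norm_neg _).trans (hnorm i))).1, two_mul]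
        exact add_le_add (hone _ (hnorm i)).2 (hone _ ((norm_neg _).trans (hnorm i))).2
    _ = _ := by simp; ring

/-- At `s = r / √n` the exponential moment is bounded independently of `n`, and `y ^ 4 / 4! ≤ exp y`
at `y = r * √n * ‖Z‖` releases the factor `n⁻²`. -/
theorem exists_integral_norm_deviation_pow_four_le (hθ : θ ∈ Θ) :
    ∃ C : ℝ, 0 ≤ C ∧ ∀ n : ℕ, 1 ≤ n →
      Integrable (fun x => ‖deviation ν t θ n x‖ ^ 4) (sampleLaw ν t θ n) ∧
      ∫ x, ‖deviation ν t θ n x‖ ^ 4 ∂(sampleLaw ν t θ n) ≤ C / n ^ 2 := by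
  obtain ⟨C, r, hC, hr, hexp⟩ := hF.exists_integral_exp_norm_deviation_le hθ
  refine ⟨24 / r ^ 4 * (2 * p * Real.exp (C * r ^ 2)), by positivity, fun n hn => ?_⟩
  have hn' : (1 : ℝ) ≤ n := by exact_mod_cast hn
  have hsq : Real.sqrt n ^ 2 = n := Real.sq_sqrt (by positivity)
  have hs0 : 0 < Real.sqrt n := Real.sqrt_pos.2 (by positivity)
  have h1 : 1 ≤ Real.sqrt n := Real.one_le_sqrt.2 hn'
  obtain ⟨hI, hle⟩ := hexp n (r / Real.sqrt n) hn (by positivity)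
    (div_le_self hr.le h1)
  have hpt : ∀ x, ‖deviation ν t θ n x‖ ^ 4 ≤
      24 / r ^ 4 / n ^ 2 * Real.exp (n * (r / Real.sqrt n) * ‖deviation ν t θ n x‖) := by
    intro x
    have h2 : (n : ℝ) * (r / Real.sqrt n) = r * Real.sqrt n := by
      field_simp
      exact hsq.symm
    rw [h2]
    set d := ‖deviation ν t θ n x‖
    have h3 := Real.pow_div_factorial_le_exp (r * Real.sqrt n * d) (by positivity) 4
    have h4 : (r * Real.sqrt n * d) ^ 4 = r ^ 4 * n ^ 2 * d ^ 4 := by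
      calc _ = r ^ 4 * (Real.sqrt n ^ 2) ^ 2 * d ^ 4 := by ring
        _ = _ := by rw [hsq]
    rw [h4] at h3
    have h5 : d ^ 4 = 24 / r ^ 4 / n ^ 2 * (r ^ 4 * n ^ 2 * d ^ 4 / (Nat.factorial 4 : ℕ)) := by
      simp [Nat.factorial]
      field_simp
    rw [h5]
    gcongr
  have hI' : Integrable (fun x => ‖deviation ν t θ n x‖ ^ 4) (sampleLaw ν t θ n) := by
    refine (hI.const_mul (24 / r ^ 4 / n ^ 2)).mono' ?_ (ae_of_all _ fun x => ?_)
    · have := hF.measurable_deviation (θ := θ) n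
      exact (by fun_prop : Measurable fun x => ‖deviation ν t θ n x‖ ^ 4).aestronglyMeasurable
    · rw [Real.norm_of_nonneg (by positivity)]
      exact hpt x
  refine ⟨hI', (integral_mono hI' (hI.const_mul _) hpt).trans ?_⟩
  rw [integral_const_mul]
  calc _ ≤ 24 / r ^ 4 / n ^ 2 * (2 * p * Real.exp (C * n * (r / Real.sqrt n) ^ 2)) := by gcongr
    _ = _ := by
      rw [div_pow, hsq]
      have : C * n * (r ^ 2 / n) = C * r ^ 2 := by field_simp
      rw [this]
      field_simp

/-- Large deviations: the sample mean leaves a ball with exponentially small probability. -/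
theorem exists_measure_deviation_le (hθ : θ ∈ Θ) {ε : ℝ} (hε : 0 < ε) :
    ∃ C c : ℝ, 0 ≤ C ∧ 0 < c ∧ ∀ n : ℕ, 1 ≤ n →
      sampleLaw ν t θ n {x | ε < ‖deviation ν t θ n x‖} ≤
        ENNReal.ofReal (C * Real.exp (-c * n)) := by
  obtain ⟨C, r, hC, hr, hexp⟩ := hF.exists_integral_exp_norm_deviation_le hθ
  -- With this `s`, `C * s ≤ ε / 2`, so the quadratic term uses up at most half of the Chernoff
  -- exponent `n * s * ε`; `C + 1` avoids dividing by zero.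
  set s := min r (ε / (2 * (C + 1))) with hs
  have hs0 : 0 < s := by positivity
  refine ⟨2 * p, s * ε / 2, by positivity, by positivity, fun n hn => ?_⟩
  have := hF.isProbabilityMeasure_sampleLaw hθ n
  have hn' : (1 : ℝ) ≤ n := by exact_mod_cast hn
  obtain ⟨hI, hle⟩ := hexp n s hn hs0.le (min_le_left _ _)
  have hmk := mul_meas_ge_le_integral_of_nonneg (μ := sampleLaw ν t θ n)
    (ae_of_all _ fun x => (Real.exp_pos (n * s * ‖deviation ν t θ n x‖)).le) hI
    (Real.exp (n * s * ε))
  have h1 : (sampleLaw ν t θ n).real {x | ε < ‖deviation ν t θ n x‖} ≤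
      2 * p * Real.exp (-(s * ε / 2) * n) := by
    have h2 : (sampleLaw ν t θ n).real {x | ε < ‖deviation ν t θ n x‖} ≤
        (sampleLaw ν t θ n).real
          {x | Real.exp (n * s * ε) ≤ Real.exp (n * s * ‖deviation ν t θ n x‖)} := by
      refine measureReal_mono fun x hx => ?_
      simp only [Set.mem_ofPred_eq, Real.exp_le_exp] at hx ⊢
      gcongr
    have h3 : C * n * s ^ 2 ≤ s * ε / 2 * n := by
      have : C * s ≤ ε / 2 := by
        calc C * s ≤ (C + 1) * (ε / (2 * (C + 1))) := by
              gcongr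
              · linarith
              · exact min_le_right _ _
          _ = ε / 2 := by field_simp
      calc C * n * s ^ 2 = (C * s) * (n * s) := by ring
        _ ≤ ε / 2 * (n * s) := by gcongr
        _ = _ := by ring
    calc _ ≤ _ := h2
      _ ≤ Real.exp (-(n * s * ε)) *
          ∫ x, Real.exp (n * s * ‖deviation ν t θ n x‖) ∂(sampleLaw ν t θ n) := by
        rw [Real.exp_neg, inv_mul_eq_div, le_div_iff₀' (Real.exp_pos _)]
        exact hmk
      _ ≤ Real.exp (-(n * s * ε)) * (2 * p * Real.exp (s * ε / 2 * n)) := by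
        gcongr
        refine hle.trans ?_
        gcongr
      _ = 2 * p * (Real.exp (-(n * s * ε)) * Real.exp (s * ε / 2 * n)) := by ring
      _ = _ := by rw [← Real.exp_add]; congr 2; ring
  rw [← ofReal_measureReal]
  exact ENNReal.ofReal_le_ofReal h1

theorem integral_inner_deviation (hθ : θ ∈ Θ) (n : ℕ) (u : 𝔼 p) :
    ∫ x, ⟪u, deviation ν t θ n x⟫ ∂(sampleLaw ν t θ n) = 0 := by
  have := hF.isProbabilityMeasure_law hθ
  simp_rw [inner_deviation, sampleLaw_eq_pi]
  rw [integral_const_mul, integral_sum_comp_eval (f := fun y => ⟪u, t y - mean ν t θ⟫)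
    (hF.integrable_law ((hF.growth_centered θ).inner_left u) hθ), hF.integral_inner_centered hθ]
  simp

theorem integral_inner_mul_inner_deviation (hθ : θ ∈ Θ) (n : ℕ) (u v : 𝔼 p) :
    ∫ x, ⟪u, deviation ν t θ n x⟫ * ⟪v, deviation ν t θ n x⟫ ∂(sampleLaw ν t θ n) =
      (n : ℝ)⁻¹ * ⟪u, cov ν t θ v⟫ := by
  have := hF.isProbabilityMeasure_law hθ
  have hu := (hF.growth_centered θ).inner_left u
  have hv := (hF.growth_centered θ).inner_left v
  simp_rw [inner_deviation, sampleLaw_eq_pi, mul_mul_mul_comm]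
  rw [integral_const_mul, integral_sum_mul_sum (f := fun y => ⟪u, t y - mean ν t θ⟫)
    (g := fun y => ⟪v, t y - mean ν t θ⟫) (hF.integrable_law hu hθ) (hF.integrable_law hv hθ)
    (hF.integrable_law (hu.mul hv) hθ) (hF.integral_inner_centered hθ _),
    hF.inner_cov hθ]
  rcases eq_or_ne (n : ℝ) 0 with h | h
  · simp [h]
  · field_simp

/-- Three factors `n⁻¹` against `n` diagonal terms: third moments are of order `n⁻²` and cannot
enter the first-order bias. -/
theorem integral_inner_mul_inner_mul_inner_deviation (hθ : θ ∈ Θ) (u v w : 𝔼 p) :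
    ∃ k : ℝ, ∀ n : ℕ, ∫ x, ⟪u, deviation ν t θ n x⟫ * ⟪v, deviation ν t θ n x⟫ *
      ⟪w, deviation ν t θ n x⟫ ∂(sampleLaw ν t θ n) = k / (n : ℝ) ^ 2 := by
  have := hF.isProbabilityMeasure_law hθ
  have hu := (hF.growth_centered θ).inner_left u
  have hv := (hF.growth_centered θ).inner_left v
  have hw := (hF.growth_centered θ).inner_left w
  refine ⟨∫ y, ⟪u, t y - mean ν t θ⟫ * ⟪v, t y - mean ν t θ⟫ * ⟪w, t y - mean ν t θ⟫ ∂(law ν t θ),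
    fun n => ?_⟩
  simp_rw [inner_deviation, sampleLaw_eq_pi, mul_mul_mul_comm]
  rw [integral_const_mul, integral_sum_mul_sum_mul_sum (f := fun y => ⟪u, t y - mean ν t θ⟫)
    (g := fun y => ⟪v, t y - mean ν t θ⟫) (h := fun y => ⟪w, t y - mean ν t θ⟫)
    (hF.integrable_law hu hθ) (hF.integrable_law hv hθ) (hF.integrable_law hw hθ)
    (hF.integrable_law (hu.mul hv) hθ) (hF.integrable_law (hu.mul hw) hθ)
    (hF.integrable_law (hv.mul hw) hθ) (hF.integrable_law ((hu.mul hv).mul hw) hθ)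
    (hF.integral_inner_centered hθ _) (hF.integral_inner_centered hθ _)
    (hF.integral_inner_centered hθ _)]
  rcases eq_or_ne (n : ℝ) 0 with h | h
  · simp [h]
  · field_simp

end MinimalFamily

end SampleMoments

/-! ### Taylor expansions with remainder. -/

section Taylor

variable {E F : Type*} [NormedAddCommGroup E] [NormedSpace ℝ E] [NormedAddCommGroup F]
  [NormedSpace ℝ F]

/-- Integrating a Taylor expansion of the derivative along segments. -/
theorem isBigO_taylor_of_fderiv {ψ : E → F} {y : E} {P : E → E →L[ℝ] F} {Q : E → F} {k : ℕ}
    (hd : ∀ᶠ z in 𝓝 y, DifferentiableAt ℝ ψ z)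
    (hQ : ∀ (w : E) (s : ℝ), HasDerivAt (fun s : ℝ => Q (s • w)) (P (s • w) w) s)
    (hP : (fun w => fderiv ℝ ψ (y + w) - P w) =O[𝓝 0] fun w => ‖w‖ ^ k) :
    (fun w => ψ (y + w) - ψ y - (Q w - Q 0)) =O[𝓝 0] fun w => ‖w‖ ^ (k + 1) := by
  obtain ⟨C, hC, hO⟩ := hP.exists_nonneg
  have hd' : ∀ᶠ w in 𝓝 (0 : E), DifferentiableAt ℝ ψ (y + w) := by
    have : Tendsto (fun w => y + w) (𝓝 0) (𝓝 y) := by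
      simpa using (tendsto_const_nhds (x := y)).add (tendsto_id (x := 𝓝 (0 : E)))
    exact this.eventually hd
  obtain ⟨r, hr, hb⟩ := Metric.eventually_nhds_iff_ball.1 (hO.bound.and hd')
  refine IsBigO.of_bound C ?_
  filter_upwards [Metric.ball_mem_nhds (0 : E) hr] with w hw
  have hmem : ∀ s ∈ Set.Icc (0 : ℝ) 1, s • w ∈ Metric.ball (0 : E) r := by
    intro s hs
    rw [mem_ball_zero_iff] at hw ⊢
    rw [norm_smul, Real.norm_of_nonneg hs.1]
    nlinarith [hs.2, norm_nonneg w]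
  have hder : ∀ s ∈ Set.Icc (0 : ℝ) 1, HasDerivWithinAt (fun s : ℝ => ψ (y + s • w) - Q (s • w))
      ((fderiv ℝ ψ (y + s • w) - P (s • w)) w) (Set.Icc 0 1) s := by
    intro s hs
    have h1 : HasDerivAt (fun s : ℝ => y + s • w) w s := by
      simpa using ((hasDerivAt_id s).smul_const w).const_add y
    have h2 := (hb _ (hmem s hs)).2.hasFDerivAt.comp_hasDerivAt s h1
    exact (h2.sub (hQ w s)).hasDerivWithinAt
  have hbound := (convex_Icc (0 : ℝ) 1).norm_image_sub_le_of_norm_hasDerivWithin_le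
    (C := C * ‖w‖ ^ (k + 1)) hder (fun s hs => ?_) (Set.left_mem_Icc.2 zero_le_one)
    (Set.right_mem_Icc.2 zero_le_one)
  · simp only [one_smul, zero_smul, add_zero, sub_zero, norm_one, mul_one] at hbound
    rw [Real.norm_of_nonneg (by positivity)]
    convert! hbound using 2
    abel
  · refine (ContinuousLinearMap.le_opNorm _ _).trans ?_
    have h1 := (hb _ (hmem s hs)).1
    rw [Real.norm_of_nonneg (by positivity), norm_smul, Real.norm_of_nonneg hs.1, mul_pow] at h1
    have h2 : s ^ k ≤ 1 := pow_le_one₀ hs.1 hs.2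
    calc _ ≤ C * (s ^ k * ‖w‖ ^ k) * ‖w‖ := by gcongr
      _ ≤ C * (1 * ‖w‖ ^ k) * ‖w‖ := by gcongr
      _ = _ := by ring

theorem isBigO_taylor_one {ψ : E → F} {y : E} (h : ContDiffAt ℝ 2 ψ y) :
    (fun w => ψ (y + w) - ψ y - fderiv ℝ ψ y w) =O[𝓝 0] fun w => ‖w‖ ^ 2 := by
  have h1 : ContDiffAt ℝ 1 (fderiv ℝ ψ) y := h.fderiv_right (by norm_num)
  have hsub : (fun w => fderiv ℝ ψ (y + w) - fderiv ℝ ψ y) =O[𝓝 0] fun w => ‖w‖ ^ 1 := by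
    have h2 := (h1.differentiableAt (by norm_num)).isBigO_sub
    have : Tendsto (fun w => y + w) (𝓝 0) (𝓝 y) := by
      simpa using (tendsto_const_nhds (x := y)).add (tendsto_id (x := 𝓝 (0 : E)))
    simpa [Function.comp_def] using (h2.comp_tendsto this).norm_right
  have := isBigO_taylor_of_fderiv (Q := fun w => fderiv ℝ ψ y w)
    (P := fun _ => fderiv ℝ ψ y) ((h.eventually (by simp)).mono fun z hz =>
      hz.differentiableAt (by norm_num)) (fun w s => ?_) hsub
  · simpa using this
  · simpa using (hasDerivAt_id s).smul_const (fderiv ℝ ψ y w)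

/-- The first-order expansion of the second derivative is integrated along segments twice. -/
theorem isBigO_taylor_three {ψ : E → F} {y : E} (h : ContDiffAt ℝ 4 ψ y) :
    (fun w => ψ (y + w) - ψ y - (fderiv ℝ ψ y w + (1 / 2 : ℝ) • fderiv ℝ (fderiv ℝ ψ) y w w +
      (1 / 6 : ℝ) • fderiv ℝ (fderiv ℝ (fderiv ℝ ψ)) y w w w)) =O[𝓝 0] fun w => ‖w‖ ^ 4 := by
  have h1 : ContDiffAt ℝ 3 (fderiv ℝ ψ) y := h.fderiv_right (by norm_num)
  have h2 : ContDiffAt ℝ 2 (fderiv ℝ (fderiv ℝ ψ)) y := h1.fderiv_right (by norm_num)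
  have t2 := isBigO_taylor_one h2
  set a := fderiv ℝ ψ y
  set b := fderiv ℝ (fderiv ℝ ψ) y
  set c := fderiv ℝ (fderiv ℝ (fderiv ℝ ψ)) y
  have t1 := isBigO_taylor_of_fderiv (ψ := fderiv ℝ ψ) (y := y) (k := 2)
    (P := fun w => b + c w) (Q := fun w => b w + (1 / 2 : ℝ) • c w w)
    ((h1.eventually (by simp)).mono fun z hz => hz.differentiableAt (by norm_num)) (fun w s => ?_)
    (by simpa [sub_sub] using t2)
  · simp only [map_zero, smul_zero, add_zero, sub_zero] at t1
    have t0 := isBigO_taylor_of_fderiv (ψ := ψ) (y := y) (k := 3)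
      (P := fun w => a + b w + (1 / 2 : ℝ) • c w w)
      (Q := fun w => a w + (1 / 2 : ℝ) • b w w + (1 / 6 : ℝ) • c w w w)
      ((h.eventually (by simp)).mono fun z hz => hz.differentiableAt (by norm_num)) (fun w s => ?_)
      (t1.congr_left fun w => by simp only [a]; abel)
    · simpa using t0
    · have e : (fun s : ℝ => a (s • w) + (1 / 2 : ℝ) • b (s • w) (s • w) +
          (1 / 6 : ℝ) • c (s • w) (s • w) (s • w)) = fun s : ℝ => s • a w +
          (1 / 2 * s ^ 2) • b w w + (1 / 6 * s ^ 3) • c w w w := by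
        funext s
        simp only [map_smul, smul_apply, smul_smul]
        congr 2; congr 1; ring
        congr 1; ring
      rw [e]
      convert! (((hasDerivAt_id s).smul_const (a w)).add
        ((((hasDerivAt_id s).pow 2).const_mul (1 / 2)).smul_const (b w w))).add
        ((((hasDerivAt_id s).pow 3).const_mul (1 / 6)).smul_const (c w w w)) using 1
      simp only [map_smul, smul_apply, smul_smul, add_apply, one_smul, id]
      module
  · have e : (fun s : ℝ => b (s • w) + (1 / 2 : ℝ) • c (s • w) (s • w)) =
        fun s : ℝ => s • b w + (1 / 2 * s ^ 2) • c w w := by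
      funext s
      simp only [map_smul, smul_apply, smul_smul]
      congr 2; ring
    rw [e]
    convert! ((hasDerivAt_id s).smul_const (b w)).add
      ((((hasDerivAt_id s).pow 2).const_mul (1 / 2)).smul_const (c w w)) using 1
    simp only [map_smul, smul_apply, add_apply, one_smul, id]
    module

end Taylor

/-! ### Local inverse and its second derivative. -/

section Inverse

variable {E : Type*} [NormedAddCommGroup E] [NormedSpace ℝ E] [CompleteSpace E]

/-- The second derivative of `φ` is found by differentiating `m'(φ y) ∘ φ'(y) = id` at `m θ` and
solving for the term with `φ''`. -/
theorem exists_contDiffAt_local_inverse {m : E → E} {θ : E} {A : E ≃L[ℝ] E}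
    (hm : ContDiffAt ℝ ∞ m θ) (hA : HasFDerivAt m (A : E →L[ℝ] E) θ) :
    ∃ φ : E → E, ContDiffAt ℝ ∞ φ (m θ) ∧ (∀ᶠ z in 𝓝 θ, φ (m z) = z) ∧
      fderiv ℝ φ (m θ) = A.symm ∧ ∀ u v, fderiv ℝ (fderiv ℝ φ) (m θ) u v =
        -A.symm (fderiv ℝ (fderiv ℝ m) θ (A.symm u) (A.symm v)) := by
  have hne : (∞ : WithTop ℕ∞) ≠ 0 := by simp
  have hs : HasStrictFDerivAt m (A : E →L[ℝ] E) θ := hm.hasStrictFDerivAt' hA hne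
  have hφ : ContDiffAt ℝ ∞ (hm.localInverse hA hne) (m θ) := hm.to_localInverse hA hne
  have hφθ : hm.localInverse hA hne (m θ) = θ := hm.localInverse_apply_image hA hne
  have hr : ∀ᶠ y in 𝓝 (m θ), m (hm.localInverse hA hne y) = y := hs.eventually_right_inverse
  have hl : ∀ᶠ z in 𝓝 θ, hm.localInverse hA hne (m z) = z := hs.eventually_left_inverse
  have hd : HasFDerivAt (hm.localInverse hA hne) (A.symm : E →L[ℝ] E) (m θ) :=
    hs.to_localInverse.hasFDerivAt
  generalize hm.localInverse hA hne = φ at *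
  refine ⟨φ, hφ, hl, hd.fderiv, fun u v => ?_⟩
  have hcomp : ∀ᶠ y in 𝓝 (m θ), (fderiv ℝ m (φ y)).comp (fderiv ℝ φ y) =
      ContinuousLinearMap.id ℝ E := by
    have h1 : ∀ᶠ y in 𝓝 (m θ), DifferentiableAt ℝ φ y :=
      ((hφ.of_le (m := 1) (by norm_cast)).eventually (by simp)).mono fun y hy =>
        hy.differentiableAt (by norm_num)
    have h2 : ∀ᶠ y in 𝓝 (m θ), DifferentiableAt ℝ m (φ y) := by
      have : Tendsto φ (𝓝 (m θ)) (𝓝 θ) := by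
        simpa [hφθ] using hφ.continuousAt.tendsto
      refine this.eventually (((hm.of_le (m := 1) (by norm_cast)).eventually (by simp)).mono fun y hy =>
        hy.differentiableAt (by norm_num))
    filter_upwards [h1, h2, hr.eventually_nhds] with y hy1 hy2 hy3
    have h3 := hy2.hasFDerivAt.comp y hy1.hasFDerivAt
    exact (h3.congr_of_eventuallyEq (f₁ := id)
      (hy3.mono fun z hz => hz.symm)).unique (hasFDerivAt_id y)
  have hm1 : HasFDerivAt (fderiv ℝ m) (fderiv ℝ (fderiv ℝ m) θ) (φ (m θ)) := by
    rw [hφθ]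
    exact ((hm.fderiv_right (m := 1) (by norm_cast)).differentiableAt (by norm_num)).hasFDerivAt
  have hφ1 : HasFDerivAt (fderiv ℝ φ) (fderiv ℝ (fderiv ℝ φ) (m θ)) (m θ) :=
    ((hφ.fderiv_right (m := 1) (by norm_cast)).differentiableAt (by norm_num)).hasFDerivAt
  have h4 := (hm1.comp (m θ) hd).clm_comp hφ1
  have h5 := (h4.congr_of_eventuallyEq (f₁ := fun _ => ContinuousLinearMap.id ℝ E)
    (hcomp.mono fun y hy => hy.symm)).unique (hasFDerivAt_const _ _)
  have h6 := congrArg (fun M => M u v) h5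
  simp only [Function.comp_apply, hφθ, hA.fderiv, hd.fderiv] at h6
  simp only [add_apply, ContinuousLinearMap.comp_apply, ContinuousLinearMap.compL_apply,
    ContinuousLinearMap.flip_apply, zero_apply, ContinuousLinearEquiv.coe_coe] at h6
  have h7 := congrArg A.symm (eq_neg_of_add_eq_zero_left h6)
  simpa using h7

end Inverse

/-! ### Expansion of the root of a perturbed equation. -/

section Perturbation

variable {E F ι : Type*} [NormedAddCommGroup E] [NormedSpace ℝ E] [NormedAddCommGroup F]
  [NormedSpace ℝ F] {l : Filter ι}

theorem isBigO_clm_apply₂ (Q : E →L[ℝ] E →L[ℝ] F) {a b : ι → E} {f g : ι → ℝ}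
    (ha : a =O[l] f) (hb : b =O[l] g) : (fun i => Q (a i) (b i)) =O[l] fun i => f i * g i := by
  refine IsBigO.trans (IsBigO.of_bound ‖Q‖ (Eventually.of_forall fun i => ?_))
    (ha.norm_left.mul hb.norm_left)
  rw [norm_mul, norm_norm, norm_norm, ← mul_assoc]
  exact Q.le_opNorm₂ _ _

set_option maxSynthPendingDepth 3 in
theorem isBigO_clm_apply₃ (R : E →L[ℝ] E →L[ℝ] E →L[ℝ] F) {a b c : ι → E} {f g h : ι → ℝ}
    (ha : a =O[l] f) (hb : b =O[l] g) (hc : c =O[l] h) :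
    (fun i => R (a i) (b i) (c i)) =O[l] fun i => f i * g i * h i := by
  refine IsBigO.trans (IsBigO.of_bound ‖R‖ (Eventually.of_forall fun i => ?_))
    ((ha.norm_left.mul hb.norm_left).mul hc.norm_left)
  rw [norm_mul, norm_mul, norm_norm, norm_norm, norm_norm]
  calc _ ≤ ‖R (a i) (b i)‖ * ‖c i‖ := ContinuousLinearMap.le_opNorm _ _
    _ ≤ ‖R‖ * ‖a i‖ * ‖b i‖ * ‖c i‖ := by gcongr; exact R.le_opNorm₂ _ _
    _ = _ := by ring

/-- Third-order expansion of the root `T` of the perturbed equation `m T = m θ + Z + τ • γ T`,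
with `φ` a local inverse of `m`. -/
theorem isBigO_root_expansion {T Z : ι → E} {τ : ι → ℝ} {m γ φ : E → E} {θ : E}
    (hm : ContinuousAt m θ) (hφ : ContDiffAt ℝ 4 φ (m θ)) (hφm : ∀ᶠ z in 𝓝 θ, φ (m z) = z)
    (hγ : ContDiffAt ℝ 2 γ θ) (hT : Tendsto T l (𝓝 θ))
    (hτ : Tendsto τ l (𝓝 0)) (hτ0 : ∀ᶠ i in l, 0 ≤ τ i)
    (heq : ∀ᶠ i in l, m (T i) = m θ + Z i + τ i • γ (T i)) :
    (fun i => T i - θ - (fderiv ℝ φ (m θ) (Z i) +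
      (1 / 2 : ℝ) • fderiv ℝ (fderiv ℝ φ) (m θ) (Z i) (Z i) +
      (1 / 6 : ℝ) • fderiv ℝ (fderiv ℝ (fderiv ℝ φ)) (m θ) (Z i) (Z i) (Z i) +
      τ i • (fderiv ℝ φ (m θ) (γ θ) + (fderiv ℝ φ (m θ) (fderiv ℝ γ θ (fderiv ℝ φ (m θ) (Z i))) +
        (1 / 2 : ℝ) • (fderiv ℝ (fderiv ℝ φ) (m θ) (γ θ) (Z i) +
          fderiv ℝ (fderiv ℝ φ) (m θ) (Z i) (γ θ))))))
      =O[l] fun i => ‖Z i‖ ^ 4 + τ i * ‖Z i‖ ^ 2 + τ i ^ 2 := by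
  have tay3 := isBigO_taylor_three hφ
  have tay1 := isBigO_taylor_one (hφ.of_le (m := 2) (by norm_num))
  have tayγ := isBigO_taylor_one hγ
  have hφ1 := (hφ.differentiableAt (by norm_num)).isBigO_sub
  have hγ1 := (hγ.differentiableAt (by norm_num)).isBigO_sub
  have hφθ : φ (m θ) = θ := hφm.self_of_nhds
  have hmT : Tendsto (fun i => m (T i)) l (𝓝 (m θ)) := hm.tendsto.comp hT
  have hW0 : Tendsto (fun i => m (T i) - m θ) l (𝓝 0) := by
    simpa using hmT.sub_const (m θ)
  have hT0 : Tendsto (fun i => T i - θ) l (𝓝 0) := by simpa using hT.sub_const θ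
  have hφT : ∀ᶠ i in l, φ (m (T i)) = T i := hT.eventually hφm
  set L := fderiv ℝ φ (m θ)
  set Q := fderiv ℝ (fderiv ℝ φ) (m θ)
  set R := fderiv ℝ (fderiv ℝ (fderiv ℝ φ)) (m θ)
  set G := fderiv ℝ γ θ
  have tay3' := tay3.comp_tendsto hW0
  have tay1' := tay1.comp_tendsto hW0
  have tayγ' := tayγ.comp_tendsto hT0
  have hφ1' := hφ1.comp_tendsto hmT
  have hγ1' := hγ1.comp_tendsto hT
  simp only [Function.comp_def, add_sub_cancel, hφθ] at tay3' tay1' tayγ' hφ1' hγ1'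
  set W := fun i => m (T i) - m θ with hW
  set z := fun i => ‖Z i‖ with hz
  set s := fun i => z i + τ i with hs
  have hle1 : ∀ᶠ i in l, τ i ≤ 1 := hτ.eventually_le_const one_pos
  -- comparisons of the scales
  have hZz : Z =O[l] z := (isBigO_refl Z l).norm_right
  have hzs : z =O[l] s := IsBigO.of_bound 1 (hτ0.mono fun i hi => by
    rw [Real.norm_of_nonneg (norm_nonneg _), Real.norm_of_nonneg (by positivity)]
    linarith)
  have hτs : τ =O[l] s := IsBigO.of_bound 1 (hτ0.mono fun i hi => by
    rw [Real.norm_of_nonneg hi, Real.norm_of_nonneg (by positivity)]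
    linarith [norm_nonneg (Z i)])
  have hs2 : (fun i => s i ^ 2) =O[l] fun i => z i ^ 2 + τ i := by
    refine IsBigO.of_bound 2 ((hτ0.and hle1).mono fun i hi => ?_)
    have : 0 ≤ z i := norm_nonneg _
    rw [Real.norm_of_nonneg (by positivity), Real.norm_of_nonneg (by linarith [sq_nonneg (z i)])]
    simp only [hs]
    nlinarith [sq_nonneg (z i - τ i), mul_le_mul_of_nonneg_left hi.2 hi.1]
  -- Up to constants `e` dominates both `s ^ 4` and `τ * s ^ 2`: replacing `W` by `Z` costs `O(τ)`,
  -- so a cubic term containing that difference is already negligible.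
  set e := fun i => z i ^ 4 + τ i * z i ^ 2 + τ i ^ 2 with he
  have hee : (fun i => τ i * (z i ^ 2 + τ i)) =O[l] e := by
    refine IsBigO.of_bound 1 (hτ0.mono fun i hi => ?_)
    have : 0 ≤ z i := norm_nonneg _
    rw [Real.norm_of_nonneg (by positivity), Real.norm_of_nonneg (by positivity)]
    simp only [he]
    nlinarith [pow_nonneg this 4]
  have hτs2 : (fun i => τ i * s i ^ 2) =O[l] e := ((isBigO_refl τ l).mul hs2).trans hee
  have hs4 : (fun i => s i ^ 4) =O[l] e := by
    have h1 : (fun i => s i ^ 2 * s i ^ 2) =O[l] fun i => (z i ^ 2 + τ i) * (z i ^ 2 + τ i) :=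
      hs2.mul hs2
    refine (h1.congr_left fun i => by ring).trans ?_
    refine IsBigO.of_bound 2 (hτ0.mono fun i hi => ?_)
    have : 0 ≤ z i := norm_nonneg _
    rw [Real.norm_of_nonneg (by positivity), Real.norm_of_nonneg (by positivity)]
    simp only [he]
    nlinarith [pow_nonneg this 4]
  -- successive approximations of the root
  have hD : (fun i => W i - Z i) =ᶠ[l] fun i => τ i • γ (T i) :=
    heq.mono fun i hi => by simp only [hW, hi]; abel
  have hDτ : (fun i => W i - Z i) =O[l] τ := by
    have h1 : (fun i => γ (T i)) =O[l] fun _ => (1 : ℝ) :=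
      (hγ.continuousAt.tendsto.comp hT).isBigO_one ℝ
    have h2 := (isBigO_refl τ l).smul h1
    simp only [smul_eq_mul, mul_one] at h2
    exact hD.isBigO.trans h2
  have hWs : W =O[l] s := by
    have := (hDτ.trans hτs).add (hZz.trans hzs)
    simpa using this
  have hTW : (fun i => T i - θ) =O[l] W :=
    EventuallyEq.trans_isBigO (hφT.mono fun i hi => by simp only [hi]) hφ1'
  have hTs := hTW.trans hWs
  have hγs : (fun i => γ (T i) - γ θ) =O[l] s := hγ1'.trans hTs
  have hDγ : (fun i => (W i - Z i) - τ i • γ θ) =O[l] fun i => τ i * s i := by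
    refine EventuallyEq.trans_isBigO ?_ ((isBigO_refl τ l).smul hγs)
    filter_upwards [hD] with i hi
    rw [hi, smul_sub]
  have hTL : (fun i => T i - θ - L (Z i)) =O[l] fun i => z i ^ 2 + τ i := by
    have h1 : (fun i => T i - θ - L (W i)) =O[l] fun i => z i ^ 2 + τ i := by
      refine EventuallyEq.trans_isBigO ?_ ((tay1'.trans (hWs.norm_left.pow 2)).trans hs2)
      filter_upwards [hφT] with i hi
      rw [hi]
    have h2 : (fun i => L (W i - Z i)) =O[l] fun i => z i ^ 2 + τ i := by
      refine ((L.isBigO_comp _ l).trans hDτ).trans (IsBigO.of_bound 1 (hτ0.mono fun i hi => ?_))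
      rw [Real.norm_of_nonneg hi, Real.norm_of_nonneg (by positivity)]
      nlinarith [sq_nonneg (z i)]
    refine (h1.add h2).congr_left fun i => ?_
    rw [L.map_sub (W i) (Z i)]; abel
  have hγ2 : (fun i => γ (T i) - γ θ - G (L (Z i))) =O[l] fun i => z i ^ 2 + τ i := by
    have h1 := (tayγ'.trans (hTs.norm_left.pow 2)).trans hs2
    have h2 := (G.isBigO_comp _ l).trans hTL
    refine (h1.add h2).congr_left fun i => ?_
    simp only [map_sub]; abel
  have hD2 : (fun i => (W i - Z i) - τ i • γ θ - τ i • G (L (Z i))) =O[l] e := by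
    refine EventuallyEq.trans_isBigO ?_ (((isBigO_refl τ l).smul hγ2).trans hee)
    filter_upwards [hD] with i hi
    rw [hi, smul_sub, smul_sub]
  have hsz : (fun i => τ i * s i * z i) =O[l] e := by
    refine (((isBigO_refl τ l).mul (isBigO_refl s l)).mul hzs).trans (hτs2.congr_left fun i => ?_)
    ring
  have hQ1 := (isBigO_clm_apply₂ Q hDγ hZz).trans hsz
  have hQ2 := (isBigO_clm_apply₂ Q hZz hDγ).trans (hsz.congr_left fun i => by ring)
  have hQ3 : (fun i => Q (W i - Z i) (W i - Z i)) =O[l] e := by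
    refine (isBigO_clm_apply₂ Q hDτ hDτ).trans (IsBigO.of_bound 1 (hτ0.mono fun i hi => ?_))
    have : 0 ≤ z i := norm_nonneg _
    rw [Real.norm_of_nonneg (by positivity), Real.norm_of_nonneg (by positivity)]
    simp only [he]
    nlinarith [pow_nonneg this 4, mul_nonneg hi (sq_nonneg (z i))]
  have hZs := hZz.trans hzs
  have hR1 := (isBigO_clm_apply₃ R hDτ hWs hWs).trans (hτs2.congr_left fun i => by ring)
  have hR2 := (isBigO_clm_apply₃ R hZs hDτ hWs).trans (hτs2.congr_left fun i => by ring)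
  have hR3 := (isBigO_clm_apply₃ R hZs hZs hDτ).trans (hτs2.congr_left fun i => by ring)
  have hmain : (fun i => T i - θ - (L (W i) + (1 / 2 : ℝ) • Q (W i) (W i) +
      (1 / 6 : ℝ) • R (W i) (W i) (W i))) =O[l] e := by
    refine EventuallyEq.trans_isBigO ?_ ((tay3'.trans (hWs.norm_left.pow 4)).trans hs4)
    filter_upwards [hφT] with i hi
    rw [hi]
  have hLD := (L.isBigO_comp _ l).trans hD2
  -- The polynomial in `W` is rewritten in `Z` by multilinearity. `W - Z` is needed to second order
  -- in the linear term, to first order in the mixed quadratic terms, and only in size elsewhere;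
  -- the cubic terms telescope.
  refine (((hmain.add hLD).add (((hQ1.add hQ2).add hQ3).const_smul_left (1 / 2 : ℝ))).add
    (((hR1.add hR2).add hR3).const_smul_left (1 / 6 : ℝ))).congr_left fun i => ?_
  simp only [map_sub, map_smul, sub_apply, smul_apply, Pi.smul_apply]
  module

/-- Uniform version of `isBigO_root_expansion`. -/
theorem exists_root_expansion {m γ φ : E → E} {θ : E}
    (hm : ContinuousAt m θ) (hφ : ContDiffAt ℝ 4 φ (m θ)) (hφm : ∀ᶠ z in 𝓝 θ, φ (m z) = z)
    (hγ : ContDiffAt ℝ 2 γ θ) :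
    ∃ (R : E →L[ℝ] E →L[ℝ] E →L[ℝ] E) (M : E →L[ℝ] E) (C r : ℝ), 0 ≤ C ∧ 0 < r ∧
      ∀ (T Z : E) (τ : ℝ), ‖T - θ‖ < r → ‖Z‖ < r → 0 ≤ τ → τ < r →
        m T = m θ + Z + τ • γ T →
        ‖T - θ - (fderiv ℝ φ (m θ) Z + (1 / 2 : ℝ) • fderiv ℝ (fderiv ℝ φ) (m θ) Z Z + R Z Z Z +
          τ • (fderiv ℝ φ (m θ) (γ θ) + M Z))‖ ≤ C * (‖Z‖ ^ 4 + τ * ‖Z‖ ^ 2 + τ ^ 2) := by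
  -- Uniformity comes from indexing by all triples `(T, Z, τ)`, with the neighbourhood filter of
  -- `(θ, 0, 0)` restricted to solutions with `0 ≤ τ`; the asymptotic bound is then a bound on a
  -- ball.
  have key := isBigO_root_expansion (ι := E × E × ℝ)
    (l := 𝓝 (θ, 0, 0) ⊓ 𝓟 {q | 0 ≤ q.2.2 ∧ m q.1 = m θ + q.2.1 + q.2.2 • γ q.1})
    (T := fun q => q.1) (Z := fun q => q.2.1) (τ := fun q => q.2.2) hm hφ hφm hγ
    ((continuous_fst.tendsto (θ, (0 : E), (0 : ℝ))).mono_left inf_le_left)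
    (((continuous_snd.comp continuous_snd).tendsto (θ, (0 : E), (0 : ℝ))).mono_left inf_le_left)
    (eventually_inf_principal.2 (Eventually.of_forall fun q hq => hq.1))
    (eventually_inf_principal.2 (Eventually.of_forall fun q hq => hq.2))
  obtain ⟨C, hC, hb⟩ := key.exists_nonneg
  obtain ⟨r, hr, hball⟩ := Metric.eventually_nhds_iff_ball.1 (eventually_inf_principal.1 hb.bound)
  refine ⟨(1 / 6 : ℝ) • fderiv ℝ (fderiv ℝ (fderiv ℝ φ)) (m θ),
    (fderiv ℝ φ (m θ)).comp ((fderiv ℝ γ θ).comp (fderiv ℝ φ (m θ))) +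
      (1 / 2 : ℝ) • (fderiv ℝ (fderiv ℝ φ) (m θ) (γ θ) +
        (fderiv ℝ (fderiv ℝ φ) (m θ)).flip (γ θ)), C, r, hC, hr, ?_⟩
  intro T Z τ hT hZ hτ0 hτ heq
  have hmem : (T, Z, τ) ∈ Metric.ball (θ, (0 : E), (0 : ℝ)) r := by
    rw [Metric.mem_ball, Prod.dist_eq, Prod.dist_eq, dist_eq_norm, dist_zero_right, dist_zero_right]
    exact max_lt hT (max_lt hZ (by simpa [abs_of_nonneg hτ0] using hτ))
  have := hball _ hmem ⟨hτ0, heq⟩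
  rw [Real.norm_of_nonneg (by positivity)] at this
  simpa using this

end Perturbation

/-! ### Localization and expansion of penalized maximum likelihood estimates. -/

section Localization

variable {X : Type*} [MeasurableSpace X] {p : ℕ} {ν : Measure X} {t : X → 𝔼 p} {Θ : Set (𝔼 p)}

/-- The log-likelihood of a sample, penalized by the function `G` of the parameter. -/
def penalizedLogLik (ν : Measure X) (t : X → 𝔼 p) (G : (𝔼 p) → ℝ) (n : ℕ) (x : Fin n → X)
    (θ : 𝔼 p) : ℝ :=
  ∑ i, (⟪θ, t (x i)⟫ - cumulant ν t θ) + G θ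

variable {G : (𝔼 p) → ℝ} {γ : (𝔼 p) → 𝔼 p} {θ₀ : 𝔼 p}

theorem natCast_smul_deviation (n : ℕ) (x : Fin n → X) :
    (n : ℝ) • deviation ν t θ₀ n x = ∑ i, (t (x i) - mean ν t θ₀) := by
  rcases eq_or_ne n 0 with rfl | h
  · simp
  · rw [deviation, smul_inv_smul₀ (by exact_mod_cast h)]

/-- The randomness enters only through a term linear in `θ - θ₀`, against which the deterministic
divergence competes. -/
theorem penalizedLogLik_sub (n : ℕ) (x : Fin n → X) (θ : 𝔼 p) :
    penalizedLogLik ν t G n x θ - penalizedLogLik ν t G n x θ₀ =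
      n * (⟪θ - θ₀, deviation ν t θ₀ n x⟫ - divergence ν t θ₀ θ) + (G θ - G θ₀) := by
  have h1 : n * ⟪θ - θ₀, deviation ν t θ₀ n x⟫ =
      ∑ i, (⟪θ, t (x i)⟫ - ⟪θ₀, t (x i)⟫) - n * ⟪θ - θ₀, mean ν t θ₀⟫ := by
    rw [← inner_smul_right, natCast_smul_deviation, inner_sum]
    simp_rw [inner_sub_right, inner_sub_left]
    simp [Finset.sum_sub_distrib, mul_sub]
  rw [mul_sub, h1, divergence]
  simp only [penalizedLogLik, Finset.sum_sub_distrib, Finset.sum_const, Finset.card_univ,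
    Fintype.card_fin, nsmul_eq_mul]
  ring

namespace MinimalFamily

variable (hF : MinimalFamily ν t Θ)
include hF

/-- Away from the true parameter the penalized likelihood is small, if the sample mean of the
statistic is close to its expectation. -/
theorem exists_penalizedLogLik_lt {ρ : ℝ} (hρ : 0 < ρ) (hball : Metric.closedBall θ₀ ρ ⊆ Θ)
    {a s M : ℝ} (hG : ∀ θ ∈ Θ, G θ ≤ M + s * ‖θ - θ₀‖ + a * divergence ν t θ₀ θ) :
    ∃ (ε : ℝ) (N : ℕ), 0 < ε ∧ ∀ n ≥ N, ∀ x, ‖deviation ν t θ₀ n x‖ ≤ ε →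
      ∀ θ ∈ Θ, ρ ≤ ‖θ - θ₀‖ → penalizedLogLik ν t G n x θ < penalizedLogLik ν t G n x θ₀ := by
  obtain ⟨c, hc, hdiv⟩ := hF.exists_divergence_ge hρ hball
  set M' := |M - G θ₀| + 1 with hM'
  have hM'0 : 0 < M' := by positivity
  -- Put `R = ‖θ - θ₀‖`. The random term is at most `n * c * R / 4`; for `n ≥ a` the divergence left
  -- after paying for `G` is at least `(n - a) * c * R`. The second bound on `n` makes the remaining
  -- `(3 * c / 4) * n * R` cover `(a * c + s) * R` and the constant `M'`, which is at most `M' / ρ *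
  -- R`; the `+ 1` in `M'` gives strictness.
  refine ⟨c / 4, max ⌈a⌉₊ ⌈(a * c + s + M' / ρ) / (3 * c / 4)⌉₊, by positivity,
    fun n hn x hx θ hθ hr => ?_⟩
  have hna : a ≤ n := (Nat.le_ceil a).trans (by exact_mod_cast (le_max_left _ _).trans hn)
  have hn2 : a * c + s + M' / ρ ≤ n * (3 * c / 4) := by
    rw [← div_le_iff₀ (by positivity)]
    exact (Nat.le_ceil _).trans (by exact_mod_cast (le_max_right _ _).trans hn)
  rw [← sub_neg, penalizedLogLik_sub]
  have h1 : ⟪θ - θ₀, deviation ν t θ₀ n x⟫ ≤ ‖θ - θ₀‖ * (c / 4) :=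
    (real_inner_le_norm _ _).trans (by gcongr)
  have h2 := hG θ hθ
  have h3 := hdiv θ hθ hr
  set d := divergence ν t θ₀ θ
  set R := ‖θ - θ₀‖
  have h4 : n * ⟪θ - θ₀, deviation ν t θ₀ n x⟫ ≤ n * (R * (c / 4)) := by gcongr
  have h5 : (n - a) * (c * R) ≤ (n - a) * d := by
    gcongr
  have h6 : (a * c + s + M' / ρ) * R ≤ n * (3 * c / 4) * R := by
    gcongr
  have h7 : M' ≤ M' / ρ * R := by
    rw [div_mul_eq_mul_div, le_div_iff₀ hρ]
    gcongr
  have h8 : M - G θ₀ < M' := by linarith [le_abs_self (M - G θ₀)]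
  nlinarith

/-- A maximum over the compact ball is global, since values outside are below the value at the
centre. -/
theorem exists_isMaxOn_penalizedLogLik {ρ : ℝ} (hρ : 0 < ρ) (hball : Metric.closedBall θ₀ ρ ⊆ Θ)
    (hGc : ContinuousOn G Θ) {n : ℕ} {x : Fin n → X}
    (hlt : ∀ θ ∈ Θ, ρ ≤ ‖θ - θ₀‖ →
      penalizedLogLik ν t G n x θ < penalizedLogLik ν t G n x θ₀) :
    ∃ θ ∈ Θ, IsMaxOn (penalizedLogLik ν t G n x) Θ θ := by
  have hcont : ContinuousOn (penalizedLogLik ν t G n x) (Metric.closedBall θ₀ ρ) := by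
    have h1 := hF.contDiffOn_cumulant.continuousOn.mono hball
    have h2 := hGc.mono hball
    unfold penalizedLogLik
    fun_prop
  obtain ⟨θ, hθ, hmax⟩ := (isCompact_closedBall θ₀ ρ).exists_isMaxOn
    ⟨θ₀, Metric.mem_closedBall_self hρ.le⟩ hcont
  refine ⟨θ, hball hθ, fun θ' hθ' => ?_⟩
  rcases le_total ‖θ' - θ₀‖ ρ with h | h
  · exact hmax (mem_closedBall_iff_norm.2 h)
  · exact (hlt θ' hθ' h).le.trans (hmax (Metric.mem_closedBall_self hρ.le))

/-- The likelihood equation divided by `n`. It is the perturbed equation of `exists_root_expansion`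
with `τ = 1 / n`. -/
theorem mean_eq_of_isMaxOn (hG : ∀ θ ∈ Θ, HasFDerivAt G (innerSL ℝ (γ θ)) θ) {n : ℕ} (hn : 1 ≤ n)
    {x : Fin n → X} {θ : 𝔼 p} (hθ : θ ∈ Θ) (hmax : IsMaxOn (penalizedLogLik ν t G n x) Θ θ) :
    mean ν t θ = mean ν t θ₀ + deviation ν t θ₀ n x + (n : ℝ)⁻¹ • γ θ := by
  have hn' : (n : ℝ) ≠ 0 := by exact_mod_cast (by omega : n ≠ 0)
  have hinner : ∀ v : 𝔼 p, HasFDerivAt (fun θ : 𝔼 p => ⟪θ, v⟫) (innerSL ℝ v) θ := by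
    intro v
    refine ((innerSL ℝ v).hasFDerivAt (x := θ)).congr_of_eventuallyEq
      (Eventually.of_forall fun y => ?_)
    simp [real_inner_comm]
  have hder : HasFDerivAt (penalizedLogLik ν t G n x)
      (∑ i, (innerSL ℝ (t (x i)) - innerSL ℝ (mean ν t θ)) + innerSL ℝ (γ θ)) θ :=
    (HasFDerivAt.fun_sum fun i _ => (hinner (t (x i))).sub (hF.hasFDerivAt_cumulant hθ)).add
      (hG θ hθ)
  have h0 := (hmax.isLocalMax (hF.isOpen.mem_nhds hθ)).hasFDerivAt_eq_zero hder
  simp_rw [← map_sub] at h0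
  rw [← map_sum, ← map_add] at h0
  have h1 : ∑ i, (t (x i) - mean ν t θ) + γ θ = 0 := by
    rw [← norm_eq_zero, ← innerSL_apply_norm (𝕜 := ℝ), h0, norm_zero]
  have h2 : (n : ℝ) • deviation ν t θ₀ n x + (n : ℝ) • mean ν t θ₀ - (n : ℝ) • mean ν t θ + γ θ
      = 0 := by
    rw [natCast_smul_deviation, ← h1]
    simp only [Finset.sum_sub_distrib, Finset.sum_const, Finset.card_univ, Fintype.card_fin,
      Nat.cast_smul_eq_nsmul]
    abel
  have h3 := congrArg (fun v => (n : ℝ)⁻¹ • v) h2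
  simp only [smul_add, smul_sub, inv_smul_smul₀ hn', smul_zero] at h3
  rw [← sub_eq_zero, ← neg_eq_zero, ← h3]
  abel

/-- The covariance operator as a continuous linear equivalence. -/
theorem exists_covEquiv {θ : 𝔼 p} (hθ : θ ∈ Θ) :
    ∃ A : (𝔼 p) ≃L[ℝ] (𝔼 p), (A : (𝔼 p) →L[ℝ] (𝔼 p)) = cov ν t θ := by
  have hinj : Function.Injective (cov ν t θ : (𝔼 p) →ₗ[ℝ] (𝔼 p)) := by
    rw [injective_iff_map_eq_zero]
    intro u hu
    by_contra hne
    have h1 := hF.inner_cov_pos hθ hne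
    rw [ContinuousLinearMap.coe_coe] at hu
    rw [hu, inner_zero_right] at h1
    exact h1.false
  refine ⟨(LinearEquiv.ofInjectiveEndo _ hinj).toContinuousLinearEquiv, ?_⟩
  ext1 u
  simp

/-- Deterministic third-order expansion of a penalized maximum likelihood estimate. -/
theorem exists_estimate_expansion (hθ₀ : θ₀ ∈ Θ) {A : (𝔼 p) ≃L[ℝ] (𝔼 p)}
    (hA : (A : (𝔼 p) →L[ℝ] (𝔼 p)) = cov ν t θ₀)
    (hG : ∀ θ ∈ Θ, HasFDerivAt G (innerSL ℝ (γ θ)) θ) (hγ : ContDiffAt ℝ 2 γ θ₀)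
    {a s M : ℝ} (hGle : ∀ θ ∈ Θ, G θ ≤ M + s * ‖θ - θ₀‖ + a * divergence ν t θ₀ θ) :
    ∃ (Q : (𝔼 p) →L[ℝ] (𝔼 p) →L[ℝ] (𝔼 p)) (R : (𝔼 p) →L[ℝ] (𝔼 p) →L[ℝ] (𝔼 p) →L[ℝ] (𝔼 p))
      (N : (𝔼 p) →L[ℝ] (𝔼 p)),
      (∀ u v, Q u v = -A.symm (fderiv ℝ (fderiv ℝ (mean ν t)) θ₀ (A.symm u) (A.symm v))) ∧
      ∀ δ > 0, ∃ (C ε : ℝ) (n₀ : ℕ), 0 ≤ C ∧ 0 < ε ∧ 1 ≤ n₀ ∧ ∀ n ≥ n₀, ∀ x : Fin n → X,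
        ‖deviation ν t θ₀ n x‖ ≤ ε →
        (∃ θ ∈ Θ, IsMaxOn (penalizedLogLik ν t G n x) Θ θ) ∧
        ∀ θ ∈ Θ, IsMaxOn (penalizedLogLik ν t G n x) Θ θ → ‖θ - θ₀‖ ≤ δ ∧
          ‖θ - θ₀ - (A.symm (deviation ν t θ₀ n x) +
            (1 / 2 : ℝ) • Q (deviation ν t θ₀ n x) (deviation ν t θ₀ n x) +
            R (deviation ν t θ₀ n x) (deviation ν t θ₀ n x) (deviation ν t θ₀ n x) +
            (n : ℝ)⁻¹ • (A.symm (γ θ₀) + N (deviation ν t θ₀ n x)))‖ ≤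
          C * (‖deviation ν t θ₀ n x‖ ^ 4 + (n : ℝ)⁻¹ ^ 2) := by
  have hm : ContDiffAt ℝ ∞ (mean ν t) θ₀ := hF.contDiffOn_mean.contDiffAt (hF.isOpen.mem_nhds hθ₀)
  have hmd : HasFDerivAt (mean ν t) (A : (𝔼 p) →L[ℝ] (𝔼 p)) θ₀ := by
    rw [hA]; exact hF.hasFDerivAt_mean hθ₀
  obtain ⟨φ, hφ, hφm, hφ1, hφ2⟩ := exists_contDiffAt_local_inverse hm hmd
  obtain ⟨R, N, C, r, hC, hr, hexp⟩ := exists_root_expansion hm.continuousAt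
    (hφ.of_le (by norm_cast)) hφm hγ
  rw [hφ1] at hexp
  refine ⟨fderiv ℝ (fderiv ℝ φ) (mean ν t θ₀), R, N, hφ2, fun δ hδ => ?_⟩
  obtain ⟨ρ₀, hρ₀, hball⟩ := Metric.isOpen_iff.1 hF.isOpen θ₀ hθ₀
  -- The three bounds serve the required closeness, the range of the root expansion, and the
  -- inclusion of the closed ball in `Θ`.
  set ρ := min (min δ r) (ρ₀ / 2) with hρdef
  have hρ : 0 < ρ := by positivity
  have hball' : Metric.closedBall θ₀ ρ ⊆ Θ := fun y hy => hball (Metric.mem_ball.2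
    ((Metric.mem_closedBall.1 hy).trans_lt ((min_le_right _ _).trans_lt (by linarith))))
  obtain ⟨ε, n₁, hε, hloc⟩ := hF.exists_penalizedLogLik_lt hρ hball' hGle
  -- The factor two absorbs the cross term `τ * ‖Z‖ ^ 2` by the arithmetic-geometric mean
  -- inequality; the `+ 1` in the threshold gives `1 / n < r` strictly.
  refine ⟨C * 2, min ε (r / 2), max n₁ (⌈r⁻¹⌉₊ + 1), by positivity, by positivity,
    (by omega : 1 ≤ ⌈r⁻¹⌉₊ + 1).trans (le_max_right _ _), fun n hn x hx => ?_⟩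
  have hlt := hloc n ((le_max_left _ _).trans hn) x (hx.trans (min_le_left _ _))
  have hn1 : ⌈r⁻¹⌉₊ + 1 ≤ n := (le_max_right _ _).trans hn
  have hn0 : 1 ≤ n := by omega
  refine ⟨hF.exists_isMaxOn_penalizedLogLik hρ hball'
    (fun θ hθ => (hG θ hθ).continuousAt.continuousWithinAt) hlt, fun θ hθ hmax => ?_⟩
  have hθρ : ‖θ - θ₀‖ < ρ := by
    by_contra! h
    exact (hlt θ hθ h).not_ge (hmax hθ₀)
  refine ⟨hθρ.le.trans ((min_le_left _ _).trans (min_le_left _ _)), ?_⟩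
  have hτ : (n : ℝ)⁻¹ < r := by
    rw [inv_lt_comm₀ (by exact_mod_cast hn0) hr]
    have h1 : r⁻¹ ≤ (⌈r⁻¹⌉₊ : ℝ) := Nat.le_ceil _
    have h2 : ((⌈r⁻¹⌉₊ : ℝ)) + 1 ≤ n := by exact_mod_cast hn1
    linarith
  refine (hexp θ (deviation ν t θ₀ n x) (n : ℝ)⁻¹
    (hθρ.trans_le ((min_le_left _ _).trans (min_le_right _ _)))
    (hx.trans_lt ((min_le_right _ _).trans_lt (by linarith))) (by positivity) hτ
    (hF.mean_eq_of_isMaxOn hG hn0 hθ hmax)).trans ?_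
  rw [mul_assoc]
  gcongr
  nlinarith [sq_nonneg (‖deviation ν t θ₀ n x‖ ^ 2 - (n : ℝ)⁻¹),
    sq_nonneg (‖deviation ν t θ₀ n x‖ ^ 2), sq_nonneg (n : ℝ)⁻¹]

end MinimalFamily

end Localization

/-! ### Bias restricted to a neighbourhood of the parameter. -/

section Bias

variable {X : Type*} [MeasurableSpace X] {p : ℕ} {ν : Measure X} {t : X → 𝔼 p} {Θ : Set (𝔼 p)}

theorem eq_sum_inner_single (v : 𝔼 p) :
    v = ∑ i, ⟪EuclideanSpace.single i (1 : ℝ), v⟫ • EuclideanSpace.single i (1 : ℝ) := by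
  have := (EuclideanSpace.basisFun (Fin p) ℝ).sum_repr' v
  simpa using this.symm

namespace MinimalFamily

variable (hF : MinimalFamily ν t Θ) {θ : 𝔼 p}
include hF

theorem integrable_of_norm_deviation (hθ : θ ∈ Θ) {n : ℕ} (hn : 1 ≤ n) {F : Type*}
    [NormedAddCommGroup F] {q : (𝔼 p) → F} (hq : Continuous q) {c : ℝ}
    (hle : ∀ v, ‖q v‖ ≤ c * (1 + ‖v‖ ^ 4)) :
    Integrable (fun x => q (deviation ν t θ n x)) (sampleLaw ν t θ n) := by
  have := hF.isProbabilityMeasure_sampleLaw hθ n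
  obtain ⟨C, -, hI⟩ := hF.exists_integral_norm_deviation_pow_four_le hθ
  refine (((integrable_const 1).add (hI n hn).1).const_mul c).mono' ?_ (ae_of_all _ fun x => hle _)
  exact hq.comp_aestronglyMeasurable (hF.measurable_deviation n).aestronglyMeasurable

theorem integrable_inner_deviation (hθ : θ ∈ Θ) {n : ℕ} (hn : 1 ≤ n) (u : 𝔼 p) :
    Integrable (fun x => ⟪u, deviation ν t θ n x⟫) (sampleLaw ν t θ n) := by
  refine hF.integrable_of_norm_deviation hθ hn (q := fun v => ⟪u, v⟫) (by fun_prop) (c := ‖u‖)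
    fun v => (norm_inner_le_norm _ _).trans ?_
  gcongr
  nlinarith [sq_nonneg (‖v‖ ^ 2 - 1 / 2), sq_nonneg (‖v‖ - 1 / 2)]

theorem integrable_inner_mul_inner_deviation (hθ : θ ∈ Θ) {n : ℕ} (hn : 1 ≤ n) (u v : 𝔼 p) :
    Integrable (fun x => ⟪u, deviation ν t θ n x⟫ * ⟪v, deviation ν t θ n x⟫)
      (sampleLaw ν t θ n) := by
  refine hF.integrable_of_norm_deviation hθ hn (q := fun z => ⟪u, z⟫ * ⟪v, z⟫) (by fun_prop)
    (c := ‖u‖ * ‖v‖) fun z => ?_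
  rw [norm_mul]
  calc _ ≤ (‖u‖ * ‖z‖) * (‖v‖ * ‖z‖) :=
        mul_le_mul (norm_inner_le_norm _ _) (norm_inner_le_norm _ _) (norm_nonneg _) (by positivity)
    _ = ‖u‖ * ‖v‖ * ‖z‖ ^ 2 := by ring
    _ ≤ _ := by
      gcongr
      nlinarith [sq_nonneg (‖z‖ ^ 2 - 1)]

theorem integrable_inner_mul_inner_mul_inner_deviation (hθ : θ ∈ Θ) {n : ℕ} (hn : 1 ≤ n)
    (u v w : 𝔼 p) :
    Integrable (fun x => ⟪u, deviation ν t θ n x⟫ * ⟪v, deviation ν t θ n x⟫ *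
      ⟪w, deviation ν t θ n x⟫) (sampleLaw ν t θ n) := by
  refine hF.integrable_of_norm_deviation hθ hn (q := fun z => ⟪u, z⟫ * ⟪v, z⟫ * ⟪w, z⟫)
    (by fun_prop) (c := ‖u‖ * ‖v‖ * ‖w‖) fun z => ?_
  rw [norm_mul, norm_mul]
  calc _ ≤ (‖u‖ * ‖z‖) * (‖v‖ * ‖z‖) * (‖w‖ * ‖z‖) := by
        gcongr <;> exact norm_inner_le_norm _ _
    _ = ‖u‖ * ‖v‖ * ‖w‖ * ‖z‖ ^ 3 := by ring
    _ ≤ _ := by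
      gcongr
      nlinarith [sq_nonneg (‖z‖ ^ 2 - ‖z‖), sq_nonneg (‖z‖ ^ 2 - 1), norm_nonneg z]

theorem integral_clm_deviation (hθ : θ ∈ Θ) {n : ℕ} (hn : 1 ≤ n) (L : (𝔼 p) →L[ℝ] (𝔼 p)) :
    Integrable (fun x => L (deviation ν t θ n x)) (sampleLaw ν t θ n) ∧
    ∫ x, L (deviation ν t θ n x) ∂(sampleLaw ν t θ n) = 0 := by
  have h1 : ∀ v : 𝔼 p, L v = ∑ i, ⟪EuclideanSpace.single i (1 : ℝ), v⟫ •
      L (EuclideanSpace.single i (1 : ℝ)) := by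
    intro v
    conv_lhs => rw [eq_sum_inner_single v, map_sum]
    simp only [map_smul]
  simp_rw [fun x => h1 (deviation ν t θ n x)]
  have h2 := fun i => (hF.integrable_inner_deviation hθ hn
    (EuclideanSpace.single i (1 : ℝ))).smul_const (L (EuclideanSpace.single i (1 : ℝ)))
  refine ⟨integrable_finsetSum _ fun i _ => h2 i, ?_⟩
  rw [integral_finsetSum _ fun i _ => h2 i]
  refine Finset.sum_eq_zero fun i _ => ?_
  rw [integral_smul_const, hF.integral_inner_deviation hθ, zero_smul]

/-- A quadratic form in `Z` is contracted with the covariance `cov / n`; for the quadratic part of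
the expansion this is the source of the `1 / n` bias. -/
theorem integral_bilin_deviation (hθ : θ ∈ Θ) {n : ℕ} (hn : 1 ≤ n)
    (Q : (𝔼 p) →L[ℝ] (𝔼 p) →L[ℝ] (𝔼 p)) :
    Integrable (fun x => Q (deviation ν t θ n x) (deviation ν t θ n x)) (sampleLaw ν t θ n) ∧
    ∫ x, Q (deviation ν t θ n x) (deviation ν t θ n x) ∂(sampleLaw ν t θ n) =
      (n : ℝ)⁻¹ • ∑ j, Q (cov ν t θ (EuclideanSpace.single j (1 : ℝ)))
        (EuclideanSpace.single j (1 : ℝ)) := by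
  set e := fun i : Fin p => EuclideanSpace.single i (1 : ℝ) with he
  have h1 : ∀ v : 𝔼 p, Q v v = ∑ j, ∑ i, (⟪e i, v⟫ * ⟪e j, v⟫) • Q (e i) (e j) := by
    intro v
    conv_lhs => rw [eq_sum_inner_single v]
    simp only [map_sum, map_smul, sum_apply, smul_apply, smul_smul, Finset.smul_sum]
    refine Finset.sum_congr rfl fun j _ => Finset.sum_congr rfl fun i _ => ?_
    rw [mul_comm]
  simp_rw [h1]
  have h2 := fun i j => (hF.integrable_inner_mul_inner_deviation hθ hn (e i) (e j)).smul_const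
    (Q (e i) (e j))
  have h3 := fun j => integrable_finsetSum Finset.univ fun i _ => h2 i j
  refine ⟨integrable_finsetSum _ fun j _ => h3 j, ?_⟩
  rw [integral_finsetSum _ fun j _ => h3 j, Finset.smul_sum]
  refine Finset.sum_congr rfl fun j _ => ?_
  rw [integral_finsetSum _ fun i _ => h2 i j]
  simp_rw [integral_smul_const, hF.integral_inner_mul_inner_deviation hθ]
  conv_rhs => rw [eq_sum_inner_single (cov ν t θ (e j))]
  simp only [map_sum, map_smul, sum_apply, smul_apply, smul_smul, Finset.smul_sum]
  rfl

theorem integral_trilin_deviation (hθ : θ ∈ Θ)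
    (R : (𝔼 p) →L[ℝ] (𝔼 p) →L[ℝ] (𝔼 p) →L[ℝ] (𝔼 p)) :
    ∃ k : 𝔼 p, ∀ n : ℕ, 1 ≤ n →
    Integrable (fun x => R (deviation ν t θ n x) (deviation ν t θ n x) (deviation ν t θ n x))
      (sampleLaw ν t θ n) ∧
    ∫ x, R (deviation ν t θ n x) (deviation ν t θ n x) (deviation ν t θ n x)
      ∂(sampleLaw ν t θ n) = ((n : ℝ) ^ 2)⁻¹ • k := by
  set e := fun i : Fin p => EuclideanSpace.single i (1 : ℝ) with he
  have h1 : ∀ v : 𝔼 p, R v v v =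
      ∑ k, ∑ j, ∑ i, (⟪e i, v⟫ * ⟪e j, v⟫ * ⟪e k, v⟫) • R (e i) (e j) (e k) := by
    intro v
    conv_lhs => rw [eq_sum_inner_single v]
    simp only [map_sum, map_smul, sum_apply, smul_apply, smul_smul, Finset.smul_sum]
    refine Finset.sum_congr rfl fun k _ => Finset.sum_congr rfl fun j _ =>
      Finset.sum_congr rfl fun i _ => ?_
    congr 1
    ring
  choose κ hκ using fun i j k =>
    hF.integral_inner_mul_inner_mul_inner_deviation hθ (e i) (e j) (e k)
  refine ⟨∑ k, ∑ j, ∑ i, κ i j k • R (e i) (e j) (e k), fun n hn => ?_⟩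
  simp_rw [h1]
  have h2 := fun i j k => (hF.integrable_inner_mul_inner_mul_inner_deviation hθ hn
    (e i) (e j) (e k)).smul_const (R (e i) (e j) (e k))
  have h3 := fun j k => integrable_finsetSum Finset.univ fun i _ => h2 i j k
  have h4 := fun k => integrable_finsetSum Finset.univ fun j _ => h3 j k
  refine ⟨integrable_finsetSum _ fun k _ => h4 k, ?_⟩
  rw [integral_finsetSum _ fun k _ => h4 k, Finset.smul_sum]
  refine Finset.sum_congr rfl fun k _ => ?_
  rw [integral_finsetSum _ fun j _ => h3 j k, Finset.smul_sum]
  refine Finset.sum_congr rfl fun j _ => ?_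
  rw [integral_finsetSum _ fun i _ => h2 i j k, Finset.smul_sum]
  refine Finset.sum_congr rfl fun i _ => ?_
  rw [integral_smul_const, hκ, smul_smul, inv_mul_eq_div]

set_option maxSynthPendingDepth 3 in
/-- A statistic with a third-order expansion in the deviation of the sample mean has the bias
given by the quadratic part of the expansion, restricted to a neighbourhood of the parameter. -/
theorem isBigO_truncated_bias (hθ : θ ∈ Θ) {T : ∀ n : ℕ, (Fin n → X) → 𝔼 p}
    (hT : ∀ n, Measurable (T n)) {L N : (𝔼 p) →L[ℝ] (𝔼 p)}
    {Q : (𝔼 p) →L[ℝ] (𝔼 p) →L[ℝ] (𝔼 p)} {R : (𝔼 p) →L[ℝ] (𝔼 p) →L[ℝ] (𝔼 p) →L[ℝ] (𝔼 p)}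
    {b₁ : 𝔼 p} {δ C ε : ℝ} {n₀ : ℕ} (hδ : 0 < δ) (hC : 0 ≤ C) (hε : 0 < ε)
    (hexp : ∀ n ≥ n₀, ∀ x : Fin n → X, ‖deviation ν t θ n x‖ ≤ ε → ‖T n x - θ‖ ≤ δ ∧
      ‖T n x - θ - (L (deviation ν t θ n x) +
        (1 / 2 : ℝ) • Q (deviation ν t θ n x) (deviation ν t θ n x) +
        R (deviation ν t θ n x) (deviation ν t θ n x) (deviation ν t θ n x) +
        (n : ℝ)⁻¹ • (b₁ + N (deviation ν t θ n x)))‖ ≤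
      C * (‖deviation ν t θ n x‖ ^ 4 + (n : ℝ)⁻¹ ^ 2)) :
    (fun n : ℕ => (∫ x in {x | ‖T n x - θ‖ ≤ δ}, (T n x - θ) ∂(sampleLaw ν t θ n)) -
      (1 / (n : ℝ)) • ((1 / 2 : ℝ) • ∑ j, Q (cov ν t θ (EuclideanSpace.single j (1 : ℝ)))
        (EuclideanSpace.single j (1 : ℝ)) + b₁)) =O[atTop] fun n : ℕ => 1 / (n : ℝ) ^ 2 := by
  obtain ⟨k, hk⟩ := hF.integral_trilin_deviation hθ R
  obtain ⟨C₄, hC₄, hI₄⟩ := hF.exists_integral_norm_deviation_pow_four_le hθ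
  -- For `‖Z‖ > ε` each power satisfies `‖Z‖ ^ j ≤ ‖Z‖ ^ 4 / ε ^ (4 - j)`; `C'` collects the
  -- resulting coefficients of all terms.
  set C' := C + δ / ε ^ 4 + ‖L‖ / ε ^ 3 + ‖Q‖ / ε ^ 2 + ‖R‖ / ε + ‖b₁‖ / ε ^ 4 + ‖N‖ / ε ^ 3
    with hC'
  have hC'0 : 0 ≤ C' := by positivity
  refine IsBigO.of_bound (C' * (C₄ + 1) + ‖k‖) ?_
  filter_upwards [eventually_ge_atTop (max n₀ 1)] with n hn
  have hn0 : n₀ ≤ n := (le_max_left _ _).trans hn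
  have hn1 : 1 ≤ n := (le_max_right _ _).trans hn
  have hn' : (1 : ℝ) ≤ n := by exact_mod_cast hn1
  have := hF.isProbabilityMeasure_sampleLaw hθ n
  set P := sampleLaw ν t θ n
  set Z := deviation ν t θ n
  set S := {x | ‖T n x - θ‖ ≤ δ} with hS
  have hSm : MeasurableSet S :=
    measurableSet_le ((hT n).sub_const θ).norm measurable_const
  obtain ⟨hL, hL0⟩ := hF.integral_clm_deviation hθ hn1 L
  obtain ⟨hN, hN0⟩ := hF.integral_clm_deviation hθ hn1 N
  obtain ⟨hQ, hQ0⟩ := hF.integral_bilin_deviation hθ hn1 Q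
  obtain ⟨hR, hR0⟩ := hk n hn1
  set poly := fun x => L (Z x) + (1 / 2 : ℝ) • Q (Z x) (Z x) + R (Z x) (Z x) (Z x) +
    (n : ℝ)⁻¹ • (b₁ + N (Z x)) with hpoly
  have hQ' : Integrable (fun x => (1 / 2 : ℝ) • Q (Z x) (Z x)) P := hQ.fun_smul _
  have hbN : Integrable (fun x => b₁ + N (Z x)) P := (integrable_const _).add hN
  have hbN' : Integrable (fun x => (n : ℝ)⁻¹ • (b₁ + N (Z x))) P := hbN.fun_smul _
  have hLQ : Integrable (fun x => L (Z x) + (1 / 2 : ℝ) • Q (Z x) (Z x)) P := hL.add hQ'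
  have hLQR : Integrable (fun x => L (Z x) + (1 / 2 : ℝ) • Q (Z x) (Z x) + R (Z x) (Z x) (Z x)) P :=
    hLQ.add hR
  have hpolyI : Integrable poly P := hLQR.add hbN'
  have hpoly0 : ∫ x, poly x ∂P = (1 / (n : ℝ)) • ((1 / 2 : ℝ) •
      ∑ j, Q (cov ν t θ (EuclideanSpace.single j (1 : ℝ))) (EuclideanSpace.single j (1 : ℝ)) + b₁)
      + ((n : ℝ) ^ 2)⁻¹ • k := by
    simp only [hpoly]
    rw [integral_add hLQR hbN', integral_add hLQ hR,
      integral_add hL hQ', integral_smul, integral_smul, integral_add (integrable_const _) hN,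
      hL0, hN0, hQ0, hR0]
    simp only [integral_const, probReal_univ, one_smul]
    module
  have hindle : ∀ x, ‖S.indicator (fun x => T n x - θ) x‖ ≤ δ := by
    intro x
    by_cases hx : x ∈ S
    · rw [Set.indicator_of_mem hx]
      exact hx
    · rw [Set.indicator_of_notMem hx, norm_zero]
      exact hδ.le
  have hind : Integrable (S.indicator fun x => T n x - θ) P :=
    Integrable.of_bound (((hT n).sub_const θ).indicator hSm).aestronglyMeasurable δ
      (ae_of_all _ hindle)
  -- The bound holds for every sample: for `‖Z‖ ≤ ε` the sample lies in `S` and the expansion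
  -- applies, otherwise the truncated error and the polynomial are each bounded by multiples of `‖Z‖
  -- ^ 4`. Thus the fourth moment alone controls the error.
  have hpt : ∀ x, ‖S.indicator (fun x => T n x - θ) x - poly x‖ ≤
      C' * (‖Z x‖ ^ 4 + (n : ℝ)⁻¹ ^ 2) := by
    intro x
    rcases le_or_gt ‖Z x‖ ε with hx | hx
    · obtain ⟨hx1, hx2⟩ := hexp n hn0 x hx
      rw [Set.indicator_of_mem (show x ∈ S from hx1)]
      refine hx2.trans ?_
      gcongr
      rw [hC']
      simp only [add_assoc]
      exact le_add_of_nonneg_right (by positivity)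
    · have hz0 : 0 < ‖Z x‖ := hε.trans hx
      have p1 : ∀ j ≤ 4, ‖Z x‖ ^ j ≤ ‖Z x‖ ^ 4 / ε ^ (4 - j) := by
        intro j hj
        rw [le_div_iff₀ (by positivity)]
        calc _ ≤ ‖Z x‖ ^ j * ‖Z x‖ ^ (4 - j) := by gcongr
          _ = _ := by rw [← pow_add]; congr 1; omega
      have q0 := p1 0 (by norm_num)
      have q1 := p1 1 (by norm_num)
      have q2 := p1 2 (by norm_num)
      have q3 := p1 3 (by norm_num)
      simp only [pow_zero, pow_one, Nat.sub_zero, Nat.reduceSub] at q0 q1 q2 q3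
      have hninv : (n : ℝ)⁻¹ ≤ 1 := inv_le_one_of_one_le₀ hn'
      have hL' : ‖L (Z x)‖ ≤ ‖L‖ * ‖Z x‖ := L.le_opNorm _
      have hN' : ‖(n : ℝ)⁻¹ • (b₁ + N (Z x))‖ ≤ ‖b₁‖ + ‖N‖ * ‖Z x‖ := by
        rw [norm_smul, Real.norm_of_nonneg (by positivity)]
        calc _ ≤ 1 * (‖b₁‖ + ‖N (Z x)‖) := by gcongr; exact norm_add_le _ _
          _ ≤ _ := by rw [one_mul]; gcongr; exact N.le_opNorm _
      have hQ' : ‖(1 / 2 : ℝ) • Q (Z x) (Z x)‖ ≤ ‖Q‖ * ‖Z x‖ ^ 2 := by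
        rw [norm_smul, Real.norm_of_nonneg (by norm_num)]
        have := Q.le_opNorm₂ (Z x) (Z x)
        nlinarith [norm_nonneg (Q (Z x) (Z x))]
      have hR' : ‖R (Z x) (Z x) (Z x)‖ ≤ ‖R‖ * ‖Z x‖ ^ 3 := by
        calc _ ≤ ‖R (Z x) (Z x)‖ * ‖Z x‖ := ContinuousLinearMap.le_opNorm _ _
          _ ≤ ‖R‖ * ‖Z x‖ * ‖Z x‖ * ‖Z x‖ := by gcongr; exact R.le_opNorm₂ _ _
          _ = _ := by ring
      calc _ ≤ δ + (‖L‖ * ‖Z x‖ + ‖Q‖ * ‖Z x‖ ^ 2 + ‖R‖ * ‖Z x‖ ^ 3 + (‖b₁‖ + ‖N‖ * ‖Z x‖)) := by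
            refine (norm_sub_le _ _).trans (add_le_add (hindle x) ?_)
            refine (norm_add_le _ _).trans (add_le_add ?_ hN')
            refine (norm_add_le _ _).trans (add_le_add ?_ hR')
            exact (norm_add_le _ _).trans (add_le_add hL' hQ')
        _ ≤ δ * (‖Z x‖ ^ 4 / ε ^ 4) + (‖L‖ * (‖Z x‖ ^ 4 / ε ^ 3) + ‖Q‖ * (‖Z x‖ ^ 4 / ε ^ 2) +
            ‖R‖ * (‖Z x‖ ^ 4 / ε) + (‖b₁‖ * (‖Z x‖ ^ 4 / ε ^ 4) + ‖N‖ * (‖Z x‖ ^ 4 / ε ^ 3))) := by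
            gcongr
            · exact le_mul_of_one_le_right hδ.le q0
            · exact le_mul_of_one_le_right (norm_nonneg _) q0
        _ = (C' - C) * ‖Z x‖ ^ 4 := by rw [hC']; ring
        _ ≤ C' * (‖Z x‖ ^ 4 + (n : ℝ)⁻¹ ^ 2) := by
            gcongr
            · linarith
            · exact le_add_of_nonneg_right (by positivity)
  obtain ⟨hI4, hI4le⟩ := hI₄ n hn1
  have hbound : ‖∫ x, (S.indicator (fun x => T n x - θ) x - poly x) ∂P‖ ≤
      C' * (C₄ + 1) / (n : ℝ) ^ 2 := by
    refine (norm_integral_le_of_norm_le ((hI4.add (integrable_const _)).const_mul C')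
      (ae_of_all _ hpt)).trans ?_
    simp only [Pi.add_apply]
    rw [integral_const_mul, integral_add hI4 (integrable_const _)]
    simp only [integral_const, probReal_univ, one_smul]
    calc _ ≤ C' * (C₄ / n ^ 2 + (n : ℝ)⁻¹ ^ 2) := by gcongr
      _ = _ := by field_simp
  rw [integral_sub hind hpolyI, integral_indicator hSm, hpoly0] at hbound
  rw [Real.norm_of_nonneg (by positivity), add_mul]
  have hk' : ‖((n : ℝ) ^ 2)⁻¹ • k‖ = ‖k‖ * (1 / (n : ℝ) ^ 2) := by
    rw [norm_smul, Real.norm_of_nonneg (by positivity), mul_comm, one_div]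
  rw [← hk']
  calc _ = ‖(∫ x in S, (T n x - θ) ∂P) - ((1 / (n : ℝ)) • ((1 / 2 : ℝ) •
      ∑ j, Q (cov ν t θ (EuclideanSpace.single j (1 : ℝ))) (EuclideanSpace.single j (1 : ℝ)) + b₁)
      + ((n : ℝ) ^ 2)⁻¹ • k) + ((n : ℝ) ^ 2)⁻¹ • k‖ := by congr 1; abel
    _ ≤ _ := (norm_add_le _ _).trans (add_le_add_left (hbound.trans (by rw [mul_one_div])) _)

end MinimalFamily

end Bias

/-! ### From the truncated bias to the full bias. -/

section Moments

variable {X : Type*} [MeasurableSpace X] {p : ℕ}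

/-- Truncation at a level `v`, in place of Hölder's inequality: integrated over a rare event, it
leaves a moment divided by `v ^ (r - 1)` plus `v` times the probability. -/
theorem le_rpow_div_add {y v r : ℝ} (hy : 0 ≤ y) (hv : 0 < v) (hr : 1 < r) :
    y ≤ y ^ r / v ^ (r - 1) + v := by
  rcases le_total y v with h | h
  · have : 0 ≤ y ^ r / v ^ (r - 1) := by positivity
    linarith
  · have hy0 : 0 < y := hv.trans_le h
    have h1 : y ^ r = y * y ^ (r - 1) := by
      rw [← Real.rpow_one_add' hy (by linarith)]
      congr 1; ring
    have h2 : y ≤ y ^ r / v ^ (r - 1) := by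
      rw [le_div_iff₀ (by positivity), h1]
      gcongr
    linarith

theorem exists_exp_neg_le {c : ℝ} (hc : 0 < c) (j : ℕ) :
    ∃ C : ℝ, 0 ≤ C ∧ ∀ n : ℕ, 1 ≤ n → Real.exp (-c * n) ≤ C / (n : ℝ) ^ j := by
  refine ⟨(Nat.factorial j : ℝ) / c ^ j, by positivity, fun n hn => ?_⟩
  have hn' : (0 : ℝ) < n := by exact_mod_cast hn
  have h1 := Real.pow_div_factorial_le_exp (c * n) (by positivity) j
  rw [neg_mul, Real.exp_neg, inv_le_comm₀ (Real.exp_pos _) (by positivity)]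
  refine le_trans (le_of_eq ?_) h1
  rw [mul_pow]
  field_simp

/-- Exponential concentration and the truncated bias determine the bias itself, if a moment of
order larger than one grows at most polynomially. -/
theorem bias_of_polynomialMoment {P : ∀ n : ℕ, Measure (Fin n → X)}
    (hP : ∀ n, IsProbabilityMeasure (P n)) {T : ∀ n : ℕ, (Fin n → X) → 𝔼 p}
    (hT : ∀ n, Measurable (T n)) {θ b : 𝔼 p}
    (htail : ∃ C c : ℝ, 0 < c ∧ ∀ n : ℕ,
      P n {x | 1 < ‖T n x - θ‖} ≤ ENNReal.ofReal (C * Real.exp (-c * n)))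
    (hbias : (fun n : ℕ => (∫ x in {x | ‖T n x - θ‖ ≤ 1}, (T n x - θ) ∂(P n)) -
      (1 / (n : ℝ)) • b) =O[atTop] fun n : ℕ => 1 / (n : ℝ) ^ 2)
    (hmom : HasPolynomialMoment P T) :
    (∀ᶠ n : ℕ in atTop, Integrable (T n) (P n)) ∧
    (fun n : ℕ => ((∫ x, T n x ∂(P n)) - θ) - (1 / (n : ℝ)) • b)
      =O[atTop] fun n : ℕ => 1 / (n : ℝ) ^ 2 := by
  obtain ⟨r, hr, k, C, hmom⟩ := hmom
  obtain ⟨C₁, c, hc, htail⟩ := htail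
  have hr0 : 0 < r := by linarith
  have hpow : ∀ᶠ n : ℕ in atTop, Integrable (fun x => ‖T n x‖ ^ r) (P n) ∧
      ∫ x, ‖T n x‖ ^ r ∂(P n) ≤ |C| * (n : ℝ) ^ k := by
    filter_upwards [hmom] with n hn
    have hmeas : Measurable fun x => ‖T n x‖ ^ r := (hT n).norm.pow_const r
    have heq : ∫⁻ x, ENNReal.ofReal (‖T n x‖ ^ r) ∂(P n) = ∫⁻ x, ‖T n x‖ₑ ^ r ∂(P n) := by
      refine lintegral_congr fun x => ?_
      rw [← ENNReal.ofReal_rpow_of_nonneg (norm_nonneg _) hr0.le, ofReal_norm]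
    have hI : Integrable (fun x => ‖T n x‖ ^ r) (P n) := by
      refine ⟨hmeas.aestronglyMeasurable, ?_⟩
      rw [hasFiniteIntegral_iff_ofReal (ae_of_all _ fun x => by positivity), heq]
      exact hn.trans_lt ENNReal.ofReal_lt_top
    refine ⟨hI, ?_⟩
    rw [integral_eq_lintegral_of_nonneg_ae (ae_of_all _ fun x => by positivity)
      hmeas.aestronglyMeasurable, heq]
    refine ENNReal.toReal_le_of_le_ofReal (by positivity) (hn.trans (ENNReal.ofReal_le_ofReal ?_))
    gcongr
    exact le_abs_self C
  have hint : ∀ᶠ n : ℕ in atTop, Integrable (T n) (P n) := by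
    filter_upwards [hpow] with n hn
    have := hP n
    refine (hn.1.add (integrable_const 1)).mono' (hT n).aestronglyMeasurable
      (ae_of_all _ fun x => ?_)
    simpa using le_rpow_div_add (norm_nonneg (T n x)) one_pos hr
  refine ⟨hint, ?_⟩
  -- Truncation at `v = n ^ q` with `q * (r - 1) ≥ k + 2` brings a moment of size `n ^ k` down to
  -- `n⁻²`, while the exponential tail, bounded by a multiple of `n ^ (-(q + 2))`, still beats `v`.
  obtain ⟨q, hq⟩ := exists_nat_ge ((k + 2 : ℝ) / (r - 1))
  rw [div_le_iff₀ (by linarith)] at hq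
  obtain ⟨C₂, hC₂, hexp⟩ := exists_exp_neg_le hc (q + 2)
  refine (hbias.add (g := fun n : ℕ => 1 / (n : ℝ) ^ 2)
    (f₂ := fun n : ℕ => ∫ x in {x | 1 < ‖T n x - θ‖}, (T n x - θ) ∂(P n)) ?_).congr' ?_
      EventuallyEq.rfl
  · refine IsBigO.of_bound (|C| + (1 + ‖θ‖) * (|C₁| * C₂)) ?_
    filter_upwards [hpow, hint, eventually_ge_atTop 1] with n hn hi hn1
    have := hP n
    have hn' : (1 : ℝ) ≤ n := by exact_mod_cast hn1
    set S := {x | 1 < ‖T n x - θ‖} with hS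
    have hSm : MeasurableSet S := measurableSet_lt measurable_const ((hT n).sub_const θ).norm
    have hPS : (P n).real S ≤ |C₁| * C₂ / (n : ℝ) ^ (q + 2) := by
      rw [measureReal_def]
      refine ENNReal.toReal_le_of_le_ofReal (by positivity)
        ((htail n).trans (ENNReal.ofReal_le_ofReal ?_))
      calc _ ≤ |C₁| * Real.exp (-c * n) := by gcongr; exact le_abs_self _
        _ ≤ |C₁| * (C₂ / (n : ℝ) ^ (q + 2)) := by gcongr; exact hexp n hn1
        _ = _ := by ring
    set v : ℝ := (n : ℝ) ^ q with hv
    have hv1 : 1 ≤ v := one_le_pow₀ hn'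
    have hv0 : 0 < v := by positivity
    have hvr : (n : ℝ) ^ (k + 2) ≤ v ^ (r - 1) := by
      rw [hv, ← Real.rpow_natCast n q, ← Real.rpow_mul (by positivity), ← Real.rpow_natCast]
      refine Real.rpow_le_rpow_of_exponent_le hn' ?_
      push_cast
      exact hq
    have hpt : ∀ x, ‖T n x - θ‖ ≤ ‖T n x‖ ^ r / v ^ (r - 1) + (v + ‖θ‖) := by
      intro x
      linarith [norm_sub_le (T n x) θ, le_rpow_div_add (norm_nonneg (T n x)) hv0 hr]
    have hfin : Integrable (fun x => ‖T n x‖ ^ r / v ^ (r - 1)) (P n) := hn.1.div_const _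
    have h1 : ‖∫ x in S, (T n x - θ) ∂(P n)‖ ≤
        ∫ x in S, (‖T n x‖ ^ r / v ^ (r - 1) + (v + ‖θ‖)) ∂(P n) :=
      norm_integral_le_of_norm_le (hfin.add (integrable_const _)).integrableOn (ae_of_all _ hpt)
    rw [integral_add hfin.integrableOn (integrable_const _)] at h1
    have h2 : ∫ x in S, ‖T n x‖ ^ r / v ^ (r - 1) ∂(P n) ≤ |C| / (n : ℝ) ^ 2 := by
      refine (setIntegral_le_integral hfin (ae_of_all _ fun x => by positivity)).trans ?_
      rw [integral_div, div_le_div_iff₀ (by positivity) (by positivity)]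
      calc _ ≤ |C| * (n : ℝ) ^ k * (n : ℝ) ^ 2 := by gcongr; exact hn.2
        _ = |C| * (n : ℝ) ^ (k + 2) := by ring
        _ ≤ _ := by gcongr
    have h3 : ∫ _ in S, (v + ‖θ‖) ∂(P n) ≤ (1 + ‖θ‖) * (|C₁| * C₂) / (n : ℝ) ^ 2 := by
      rw [setIntegral_const, smul_eq_mul]
      calc _ ≤ |C₁| * C₂ / (n : ℝ) ^ (q + 2) * (v + ‖θ‖ * v) := by
            gcongr
            exact le_mul_of_one_le_right (norm_nonneg _) hv1
        _ = _ := by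
            rw [pow_add, ← hv]
            field_simp
    rw [Real.norm_of_nonneg (by positivity), add_mul, mul_one_div, mul_one_div]
    exact h1.trans (add_le_add h2 h3)
  · filter_upwards [hint] with n hi
    have := hP n
    have hSm : MeasurableSet {x | ‖T n x - θ‖ ≤ 1} :=
      measurableSet_le ((hT n).sub_const θ).norm measurable_const
    have h1 := integral_add_compl hSm (hi.sub (integrable_const θ))
    have h2 : {x | ‖T n x - θ‖ ≤ 1}ᶜ = {x | 1 < ‖T n x - θ‖} := by
      ext x; simp
    simp only [Pi.sub_apply] at h1
    rw [integral_sub hi (integrable_const _), h2] at h1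
    simp only [integral_const, probReal_univ, one_smul] at h1
    rw [← h1]
    abel

end Moments

/-! ### Bias of a penalized maximum likelihood estimator. -/

section Penalized

variable {X : Type*} [MeasurableSpace X] {p : ℕ} {ν : Measure X} {t : X → 𝔼 p} {Θ : Set (𝔼 p)}
  {G : (𝔼 p) → ℝ} {γ : (𝔼 p) → 𝔼 p} {θ₀ : 𝔼 p}

namespace MinimalFamily

variable (hF : MinimalFamily ν t Θ)
include hF

/-- The bias of a penalized maximum likelihood estimator. -/
theorem hasBiasExpansion_of_isMaxOn (hθ₀ : θ₀ ∈ Θ) {A : (𝔼 p) ≃L[ℝ] (𝔼 p)}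
    (hA : (A : (𝔼 p) →L[ℝ] (𝔼 p)) = cov ν t θ₀)
    (hG : ∀ θ ∈ Θ, HasFDerivAt G (innerSL ℝ (γ θ)) θ) (hγ : ContDiffAt ℝ 2 γ θ₀)
    {a s M : ℝ} (hGle : ∀ θ ∈ Θ, G θ ≤ M + s * ‖θ - θ₀‖ + a * divergence ν t θ₀ θ)
    {T : ∀ n : ℕ, (Fin n → X) → 𝔼 p} (hT : ∀ n, Measurable (T n))
    (hmax : ∀ n, 1 ≤ n → ∀ x, (∃ θ ∈ Θ, IsMaxOn (penalizedLogLik ν t G n x) Θ θ) →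
      T n x ∈ Θ ∧ IsMaxOn (penalizedLogLik ν t G n x) Θ (T n x)) :
    HasBiasExpansion (sampleLaw ν t θ₀) T θ₀ (A.symm (γ θ₀ - (1 / 2 : ℝ) •
      ∑ j, fderiv ℝ (fderiv ℝ (mean ν t)) θ₀ (EuclideanSpace.single j (1 : ℝ))
        (A.symm (EuclideanSpace.single j (1 : ℝ))))) := by
  obtain ⟨Q, R, N, hQ, hexp⟩ := hF.exists_estimate_expansion hθ₀ hA hG hγ hGle
  have htail : ∀ δ : ℝ, 0 < δ → ∃ C c : ℝ, 0 < c ∧ ∀ n : ℕ,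
      sampleLaw ν t θ₀ n {x | δ < ‖T n x - θ₀‖} ≤ ENNReal.ofReal (C * Real.exp (-c * n)) := by
    intro δ hδ
    obtain ⟨_, ε, n₀, _, hε, hn₀, h⟩ := hexp δ hδ
    obtain ⟨C, c, hC, hc, hdev⟩ := hF.exists_measure_deviation_le hθ₀ hε
    -- The second entry makes the bound at least one for `n < n₀`, where the expansion says nothing.
    refine ⟨max C (Real.exp (c * n₀)), c, hc, fun n => ?_⟩
    rcases le_or_gt n₀ n with hn | hn
    · refine (measure_mono fun x hx => ?_).trans ((hdev n (hn₀.trans hn)).trans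
        (ENNReal.ofReal_le_ofReal (by gcongr; exact le_max_left _ _)))
      by_contra hx'
      obtain ⟨hex, hall⟩ := h n hn x (not_lt.1 hx')
      obtain ⟨h1, h2⟩ := hmax n (hn₀.trans hn) x hex
      exact absurd (hall _ h1 h2).1 (not_le.2 hx)
    · have := hF.isProbabilityMeasure_sampleLaw hθ₀ n
      refine prob_le_one.trans ?_
      rw [ENNReal.one_le_ofReal]
      calc (1 : ℝ) ≤ Real.exp (c * n₀) * Real.exp (-c * n) := by
            rw [← Real.exp_add]
            refine Real.one_le_exp ?_
            have : (n : ℝ) ≤ n₀ := by exact_mod_cast hn.le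
            nlinarith
        _ ≤ _ := by gcongr; exact le_max_right _ _
  have hbias : ∀ δ : ℝ, 0 < δ → (fun n : ℕ =>
      (∫ x in {x | ‖T n x - θ₀‖ ≤ δ}, (T n x - θ₀) ∂(sampleLaw ν t θ₀ n)) -
      (1 / (n : ℝ)) • (A.symm (γ θ₀ - (1 / 2 : ℝ) •
      ∑ j, fderiv ℝ (fderiv ℝ (mean ν t)) θ₀ (EuclideanSpace.single j (1 : ℝ))
        (A.symm (EuclideanSpace.single j (1 : ℝ)))))) =O[atTop] fun n : ℕ => 1 / (n : ℝ) ^ 2 := by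
    intro δ hδ
    obtain ⟨C, ε, n₀, hC, hε, hn₀, h⟩ := hexp δ hδ
    have key := hF.isBigO_truncated_bias hθ₀ hT (L := (A.symm : (𝔼 p) →L[ℝ] (𝔼 p))) (N := N)
      (Q := Q) (R := R) (b₁ := A.symm (γ θ₀)) hδ hC hε (n₀ := n₀) fun n hn x hx => ?_
    · refine key.congr_left fun n => ?_
      congr 2
      -- In `Q (A eⱼ) eⱼ` the inverse cancels `A` in the first slot only, leaving `-A⁻¹ D²m(eⱼ,
      -- A⁻¹eⱼ)`.
      simp_rw [hQ, ← hA]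
      simp only [ContinuousLinearEquiv.coe_coe, ContinuousLinearEquiv.symm_apply_apply, map_sub,
        map_smul, map_sum, Finset.sum_neg_distrib]
      module
    · obtain ⟨hex, hall⟩ := h n hn x hx
      obtain ⟨h1, h2⟩ := hmax n (hn₀.trans hn) x hex
      exact hall _ h1 h2
  exact ⟨htail, hbias, bias_of_polynomialMoment
    (fun n => hF.isProbabilityMeasure_sampleLaw hθ₀ n) hT (htail 1 one_pos) (hbias 1 one_pos)⟩

end MinimalFamily

end Penalized

/-! ### Derivative of the determinant. -/

section Jacobi

variable {p : ℕ}

theorem contDiff_det {n : WithTop ℕ∞} :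
    ContDiff ℝ n fun M : Fin p → Fin p → ℝ => (Matrix.of M).det := by
  simp_rw [Matrix.det_apply]
  refine ContDiff.sum fun σ _ => ContDiff.const_smul _ (contDiff_prod fun i _ => ?_)
  exact contDiff_apply_apply ℝ ℝ (σ i) i

/-- Jacobi's formula for the derivative of the determinant. -/
theorem hasDerivAt_det {M : ℝ → Fin p → Fin p → ℝ} {M' : Fin p → Fin p → ℝ} {s : ℝ}
    (hM : HasDerivAt M M' s) (hdet : (Matrix.of (M s)).det ≠ 0) :
    HasDerivAt (fun s => (Matrix.of (M s)).det)
      ((Matrix.of (M s)).det * ((Matrix.of (M s))⁻¹ * Matrix.of M').trace) s := by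
  have hd := ((contDiff_det (p := p) (n := 1)).differentiable (by norm_num) (M s)).hasFDerivAt
  have h1 := hd.comp_hasDerivAt s hM
  -- The curve may be replaced by a line of the same velocity. Along it the determinant is `det (M
  -- s) * det (1 + r B)`, whose linear coefficient in `r` is `det (M s) * trace B`.
  have hline : HasDerivAt (fun r : ℝ => M s + r • M') M' 0 := by
    simpa using ((hasDerivAt_id (0 : ℝ)).smul_const M').const_add (M s)
  have h2 := HasFDerivAt.comp_hasDerivAt (f := fun r : ℝ => M s + r • M') (0 : ℝ)
    (by simpa using hd) hline
  set B := (Matrix.of (M s))⁻¹ * Matrix.of M' with hB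
  have h3 : ∀ r : ℝ, (Matrix.of (M s + r • M')).det =
      (Matrix.of (M s)).det * (1 + r • B).det := by
    intro r
    rw [← Matrix.det_mul, hB, mul_add, mul_one, mul_smul_comm,
      Matrix.mul_nonsing_inv_cancel_left _ _ (isUnit_iff_ne_zero.2 hdet)]
    rfl
  have h4 : HasDerivAt (fun r : ℝ => (1 + r • B).det) B.trace 0 := by
    have e : (fun r : ℝ => (1 + r • B).det) = fun r => 1 + B.trace * r +
        (Matrix.det (1 + (Polynomial.X : Polynomial ℝ) • B.map Polynomial.C)).divX.divX.eval r
          * r ^ 2 := by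
      funext r
      exact Matrix.det_one_add_smul r B
    rw [e]
    have := (((hasDerivAt_id (0 : ℝ)).const_mul B.trace).const_add 1).add
      ((Polynomial.hasDerivAt (Matrix.det (1 + (Polynomial.X : Polynomial ℝ) •
        B.map Polynomial.C)).divX.divX 0).mul ((hasDerivAt_id (0 : ℝ)).pow 2))
    convert! this using 1
    simp
  have h5 := h4.const_mul (Matrix.of (M s)).det
  have h6 : HasDerivAt (fun r : ℝ => (Matrix.of (M s + r • M')).det)
      ((Matrix.of (M s)).det * B.trace) 0 := by
    simpa only [h3] using h5
  rw [← h2.unique h6]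
  exact h1

end Jacobi

/-! ### Fisher information of the sample and its log-determinant. -/

section Information

variable {X : Type*} [MeasurableSpace X] {p : ℕ} {ν : Measure X} {t : X → 𝔼 p} {Θ : Set (𝔼 p)}

/-- The covariance matrix of the canonical statistic: the information of one observation. -/
def covMatrix (ν : Measure X) (t : X → 𝔼 p) (θ : 𝔼 p) : Matrix (Fin p) (Fin p) ℝ :=
  Matrix.of fun i j => ⟪EuclideanSpace.single i (1 : ℝ),
    cov ν t θ (EuclideanSpace.single j (1 : ℝ))⟫

theorem sampleDensity_pos (n : ℕ) (θ : 𝔼 p) (x : Fin n → X) : 0 < sampleDensity ν t n θ x :=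
  Finset.prod_pos fun i _ => expDensity_pos θ (x i)

theorem log_sampleDensity (n : ℕ) (θ : 𝔼 p) (x : Fin n → X) :
    Real.log (sampleDensity ν t n θ x) = ∑ i, (⟪θ, t (x i)⟫ - cumulant ν t θ) := by
  simp only [sampleDensity, expDensity]
  rw [← Real.exp_sum, Real.log_exp]

namespace MinimalFamily

variable (hF : MinimalFamily ν t Θ) {θ : 𝔼 p}
include hF

theorem score_sampleDensity (hθ : θ ∈ Θ) (n : ℕ) (x : Fin n → X) (i : Fin p) :
    score (sampleDensity ν t n) θ x i =
      ∑ k, ⟪EuclideanSpace.single i (1 : ℝ), t (x k) - mean ν t θ⟫ := by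
  have hinner : ∀ v : 𝔼 p, HasFDerivAt (fun θ : 𝔼 p => ⟪θ, v⟫) (innerSL ℝ v) θ := by
    intro v
    refine ((innerSL ℝ v).hasFDerivAt (x := θ)).congr_of_eventuallyEq
      (Eventually.of_forall fun y => ?_)
    simp [real_inner_comm]
  have hder : HasFDerivAt (fun θ' => Real.log (sampleDensity ν t n θ' x))
      (∑ k, (innerSL ℝ (t (x k)) - innerSL ℝ (mean ν t θ))) θ := by
    simp_rw [log_sampleDensity]
    exact HasFDerivAt.fun_sum fun k _ => (hinner (t (x k))).sub (hF.hasFDerivAt_cumulant hθ)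
  rw [score, hder.fderiv, sum_apply]
  refine Finset.sum_congr rfl fun k _ => ?_
  rw [← map_sub, innerSL_apply_apply, real_inner_comm]

theorem integrable_expDensity (hθ : θ ∈ Θ) : Integrable (expDensity ν t θ) ν := by
  have : expDensity ν t θ = fun x => Real.exp (-cumulant ν t θ) * Real.exp ⟪θ, t x⟫ :=
    funext (expDensity_eq θ)
  rw [this]
  exact (hF.integrable θ hθ).const_mul _

/-- Checked on boxes, where the indicator times the joint density is a product over the
observations. It lets the Fisher information be computed as an expectation under independence. -/
theorem sampleLaw_eq_withDensity [SigmaFinite ν] (hθ : θ ∈ Θ) (n : ℕ) :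
    sampleLaw ν t θ n =
      (sampleBase ν n).withDensity fun x => ENNReal.ofReal (sampleDensity ν t n θ x) := by
  classical
  have := hF.isProbabilityMeasure_law hθ
  have hI := hF.integrable_expDensity hθ
  rw [sampleLaw_eq_pi, sampleBase]
  refine Measure.pi_eq fun s hs => ?_
  have hsm : MeasurableSet (Set.univ.pi s) := MeasurableSet.univ_pi hs
  have hprodI : Integrable (fun x : Fin n → X => sampleDensity ν t n θ x)
      (Measure.pi fun _ => ν) :=
    Integrable.fintype_prod (f := fun _ => expDensity ν t θ) fun _ => hI
  have hind : ∀ x : Fin n → X, (Set.univ.pi s).indicator (sampleDensity ν t n θ) x =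
      ∏ i, (s i).indicator (expDensity ν t θ) (x i) := by
    intro x
    by_cases hx : x ∈ Set.univ.pi s
    · rw [Set.indicator_of_mem hx, sampleDensity]
      exact Finset.prod_congr rfl fun i _ => (Set.indicator_of_mem (hx i trivial) _).symm
    · rw [Set.indicator_of_notMem hx]
      obtain ⟨i, hi⟩ : ∃ i, x i ∉ s i := by simpa [Set.mem_pi] using hx
      exact (Finset.prod_eq_zero (Finset.mem_univ i) (Set.indicator_of_notMem hi _)).symm
  rw [withDensity_apply _ hsm, ← ofReal_integral_eq_lintegral_ofReal hprodI.integrableOn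
    (ae_of_all _ fun x => (sampleDensity_pos n θ x).le), ← integral_indicator hsm]
  simp_rw [hind]
  rw [integral_fintype_prod_eq_prod (fun i => (s i).indicator (expDensity ν t θ)),
    ENNReal.ofReal_prod_of_nonneg fun i _ => integral_nonneg fun x =>
      Set.indicator_nonneg (fun y _ => (expDensity_pos θ y).le) x]
  refine Finset.prod_congr rfl fun i _ => ?_
  rw [integral_indicator (hs i), ofReal_integral_eq_lintegral_ofReal hI.integrableOn
    (ae_of_all _ fun x => (expDensity_pos θ x).le), law, withDensity_apply _ (hs i)]

/-- The score is a sum of independent centred terms, so only the `n` diagonal covariances survive.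
-/
theorem fisherInfo_sampleDensity [SigmaFinite ν] (hθ : θ ∈ Θ) (n : ℕ) :
    fisherInfo (sampleBase ν n) (sampleDensity ν t n) θ = (n : ℝ) • covMatrix ν t θ := by
  have := hF.isProbabilityMeasure_law hθ
  ext i j
  simp only [fisherInfo, covMatrix, Matrix.of_apply, Matrix.smul_apply, smul_eq_mul]
  have hi := (hF.growth_centered θ).inner_left (EuclideanSpace.single i (1 : ℝ))
  have hj := (hF.growth_centered θ).inner_left (EuclideanSpace.single j (1 : ℝ))
  have hmeas : Measurable fun x : Fin n → X => sampleDensity ν t n θ x := by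
    have := measurable_expDensity (ν := ν) hF.meas θ
    unfold sampleDensity
    fun_prop
  have h1 : ∫ x, score (sampleDensity ν t n) θ x i * score (sampleDensity ν t n) θ x j *
      sampleDensity ν t n θ x ∂(sampleBase ν n) =
      ∫ x, score (sampleDensity ν t n) θ x i * score (sampleDensity ν t n) θ x j
        ∂(sampleLaw ν t θ n) := by
    rw [hF.sampleLaw_eq_withDensity hθ, integral_withDensity_eq_integral_toReal_smul
      hmeas.ennreal_ofReal (ae_of_all _ fun _ => ENNReal.ofReal_lt_top)]
    refine integral_congr_ae (ae_of_all _ fun x => ?_)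
    simp only [ENNReal.toReal_ofReal (sampleDensity_pos n θ x).le, smul_eq_mul]
    ring
  rw [h1]
  simp_rw [hF.score_sampleDensity hθ, sampleLaw_eq_pi]
  rw [integral_sum_mul_sum
    (f := fun y => ⟪EuclideanSpace.single i (1 : ℝ), t y - mean ν t θ⟫)
    (g := fun y => ⟪EuclideanSpace.single j (1 : ℝ), t y - mean ν t θ⟫)
    (hF.integrable_law hi hθ) (hF.integrable_law hj hθ) (hF.integrable_law (hi.mul hj) hθ)
    (hF.integral_inner_centered hθ _), hF.inner_cov hθ]

theorem covMatrix_det_pos (hθ : θ ∈ Θ) : 0 < (covMatrix ν t θ).det := by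
  refine Matrix.PosDef.det_pos (Matrix.PosDef.of_dotProduct_mulVec_pos ?_ fun v hv => ?_)
  · ext i j
    simp only [Matrix.conjTranspose_apply, star_trivial, covMatrix, Matrix.of_apply]
    exact hF.inner_cov_comm hθ _ _
  · set u : 𝔼 p := WithLp.toLp 2 v with hu
    have hune : u ≠ 0 := fun h => hv (by simpa [hu] using congrArg WithLp.ofLp h)
    have hsum : u = ∑ i, v i • EuclideanSpace.single i (1 : ℝ) := by
      conv_lhs => rw [eq_sum_inner_single u]
      refine Finset.sum_congr rfl fun i _ => ?_
      simp [EuclideanSpace.inner_single_left, hu]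
    refine (hF.inner_cov_pos hθ hune).trans_eq ?_
    rw [hsum]
    simp only [map_sum, map_smul, inner_sum, sum_inner, inner_smul_left, inner_smul_right,
      dotProduct, Matrix.mulVec, covMatrix, Matrix.of_apply, star_trivial, conj_trivial,
      Finset.mul_sum]
    rw [Finset.sum_comm]
    refine Finset.sum_congr rfl fun i _ => Finset.sum_congr rfl fun j _ => ?_
    ring

theorem contDiffOn_log_det_covMatrix :
    ContDiffOn ℝ ∞ (fun θ => (1 / 2 : ℝ) * Real.log (covMatrix ν t θ).det) Θ := by
  refine contDiffOn_const.mul (ContDiffOn.log ?_ fun θ hθ => (hF.covMatrix_det_pos hθ).ne')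
  have h1 : ContDiffOn ℝ ∞ (fun θ => fun i j : Fin p => (⟪EuclideanSpace.single i (1 : ℝ),
      cov ν t θ (EuclideanSpace.single j (1 : ℝ))⟫ : ℝ)) Θ := by
    rw [contDiffOn_pi]
    intro i
    rw [contDiffOn_pi]
    intro j
    have h2 : ContDiffOn ℝ ∞ (cov ν t) Θ :=
      (hF.contDiffOn_mean.fderiv_of_isOpen hF.isOpen (by norm_cast)).congr
        fun θ hθ => (hF.hasFDerivAt_mean hθ).fderiv.symm
    exact contDiffOn_const.inner ℝ (h2.clm_apply contDiffOn_const)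
  exact contDiff_det.comp_contDiffOn h1

/-- The gradient of half the log-determinant of the information. -/
theorem fderiv_log_det_covMatrix (hθ : θ ∈ Θ) {A : (𝔼 p) ≃L[ℝ] (𝔼 p)}
    (hA : (A : (𝔼 p) →L[ℝ] (𝔼 p)) = cov ν t θ) (u : 𝔼 p) :
    fderiv ℝ (fun θ => (1 / 2 : ℝ) * Real.log (covMatrix ν t θ).det) θ u =
      ⟪(1 / 2 : ℝ) • ∑ j, fderiv ℝ (fderiv ℝ (mean ν t)) θ (EuclideanSpace.single j (1 : ℝ))
        (A.symm (EuclideanSpace.single j (1 : ℝ))), u⟫ := by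
  set e := fun i : Fin p => EuclideanSpace.single i (1 : ℝ) with he
  set B := fderiv ℝ (fderiv ℝ (mean ν t)) θ with hB
  have hm : ContDiffAt ℝ ∞ (mean ν t) θ := hF.contDiffOn_mean.contDiffAt (hF.isOpen.mem_nhds hθ)
  have hcov : cov ν t =ᶠ[𝓝 θ] fderiv ℝ (mean ν t) := by
    filter_upwards [hF.isOpen.mem_nhds hθ] with θ' hθ'
    exact (hF.hasFDerivAt_mean hθ').fderiv.symm
  have hBd : HasFDerivAt (cov ν t) B θ :=
    (((hm.fderiv_right (m := 1) (by norm_cast)).differentiableAt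
      (by norm_num)).hasFDerivAt).congr_of_eventuallyEq hcov
  have hentry : ∀ v w : 𝔼 p, HasFDerivAt (fun θ' => (⟪v, cov ν t θ' w⟫ : ℝ))
      ((innerSL ℝ v).comp (B.flip w)) θ := by
    intro v w
    exact (innerSL ℝ v).hasFDerivAt.comp θ (hBd.clm_apply (hasFDerivAt_const w θ) |>.congr_fderiv
      (by ext; simp))
  -- Symmetry of second derivatives, and below it the derivative of the self-adjointness of `cov`:
  -- together they make `⟪v, B a w⟫` symmetric in all three arguments.
  have hsym : ∀ a b : 𝔼 p, B a b = B b a := fun a b =>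
    (hm.isSymmSndFDerivAt (by
      rw [minSmoothness_of_isRCLikeNormedField]; norm_cast)).eq a b
  have hadj : ∀ a v w : 𝔼 p, ⟪v, B a w⟫ = ⟪w, B a v⟫ := by
    intro a v w
    have h1 := (hentry w v).congr_of_eventuallyEq (f₁ := fun θ' => (⟪v, cov ν t θ' w⟫ : ℝ)) (by
      filter_upwards [hF.isOpen.mem_nhds hθ] with θ' hθ'
      exact hF.inner_cov_comm hθ' w v)
    have h2 := congrArg (fun L => L a) ((hentry v w).unique h1)
    simpa using h2
  have hAsym : ∀ v w : 𝔼 p, ⟪v, A.symm w⟫ = ⟪w, A.symm v⟫ := by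
    intro v w
    have h1 := hF.inner_cov_comm hθ (A.symm v) (A.symm w)
    rw [← hA] at h1
    simp only [ContinuousLinearEquiv.coe_coe, ContinuousLinearEquiv.apply_symm_apply] at h1
    rw [real_inner_comm, h1, real_inner_comm]
  have hdet := hF.covMatrix_det_pos hθ
  -- the derivative along the line through `θ` in direction `u`
  have hline : HasDerivAt (fun s : ℝ => θ + s • u) u 0 := by
    simpa using ((hasDerivAt_id (0 : ℝ)).smul_const u).const_add θ
  have hM : HasDerivAt (fun s : ℝ => fun i j : Fin p => (⟪e i, cov ν t (θ + s • u) (e j)⟫ : ℝ))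
      (fun i j => ⟪e i, B u (e j)⟫) 0 := by
    rw [hasDerivAt_pi]
    intro i
    rw [hasDerivAt_pi]
    intro j
    have := HasFDerivAt.comp_hasDerivAt (f := fun s : ℝ => θ + s • u) (0 : ℝ)
      (by simpa using hentry (e i) (e j)) hline
    simpa [Function.comp_def] using this
  have hM0 : (Matrix.of fun i j : Fin p => (⟪e i, cov ν t (θ + (0 : ℝ) • u) (e j)⟫ : ℝ)) =
      covMatrix ν t θ := by
    simp [covMatrix, he]
  have h1 := hasDerivAt_det hM (by rw [hM0]; exact hdet.ne')
  have h2 := (h1.log (by rw [hM0]; exact hdet.ne')).const_mul (1 / 2 : ℝ)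
  rw [hM0, mul_div_cancel_left₀ _ hdet.ne'] at h2
  have hGd : DifferentiableAt ℝ (fun θ => (1 / 2 : ℝ) * Real.log (covMatrix ν t θ).det) θ :=
    (hF.contDiffOn_log_det_covMatrix.contDiffAt (hF.isOpen.mem_nhds hθ)).differentiableAt (by simp)
  have hGd' : HasFDerivAt (fun θ => (1 / 2 : ℝ) * Real.log (covMatrix ν t θ).det)
      (fderiv ℝ (fun θ => (1 / 2 : ℝ) * Real.log (covMatrix ν t θ).det) θ) (θ + (0 : ℝ) • u) := by
    rw [zero_smul, add_zero]
    exact hGd.hasFDerivAt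
  have h3 := HasFDerivAt.comp_hasDerivAt (f := fun s : ℝ => θ + s • u) (0 : ℝ) hGd' hline
  have h4 : fderiv ℝ (fun θ => (1 / 2 : ℝ) * Real.log (covMatrix ν t θ).det) θ u =
      1 / 2 * ((covMatrix ν t θ)⁻¹ * Matrix.of fun i j => ⟪e i, B u (e j)⟫).trace :=
    h3.unique h2
  have hinv : (covMatrix ν t θ)⁻¹ = Matrix.of fun i j => (⟪e i, A.symm (e j)⟫ : ℝ) := by
    refine Matrix.inv_eq_right_inv ?_
    ext i j
    simp only [Matrix.mul_apply, covMatrix, Matrix.of_apply]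
    have h5 : ⟪e i, A (A.symm (e j))⟫ = ∑ k, ⟪e i, cov ν t θ (e k)⟫ * ⟪e k, A.symm (e j)⟫ := by
      conv_lhs => rw [eq_sum_inner_single (A.symm (e j))]
      simp only [map_sum, map_smul, inner_sum, inner_smul_right]
      refine Finset.sum_congr rfl fun k _ => ?_
      rw [mul_comm, ← hA]
      rfl
    rw [← h5, ContinuousLinearEquiv.apply_symm_apply, he]
    simp [EuclideanSpace.inner_single_left, Matrix.one_apply]
  rw [h4, hinv, inner_smul_left, sum_inner, Matrix.trace]
  simp only [conj_trivial]
  congr 1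
  refine Finset.sum_congr rfl fun i _ => ?_
  simp only [Matrix.diag_apply, Matrix.mul_apply, Matrix.of_apply]
  conv_rhs => rw [eq_sum_inner_single (A.symm (e i))]
  simp only [map_sum, map_smul, sum_inner, inner_smul_left, conj_trivial]
  refine Finset.sum_congr rfl fun k _ => ?_
  -- Total symmetry moves `u` out of the slot of the differentiation direction, turning the trace of
  -- Jacobi's formula into the contraction that appears in the bias.
  rw [hAsym (e i) (e k), hsym u (e i), hadj (e i) (e k) u, real_inner_comm u]

end MinimalFamily

end Information

/-! ### The three kinds of estimates as penalized maximum likelihood estimates. -/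

section Estimates

variable {X : Type*} [MeasurableSpace X] {p : ℕ} {ν : Measure X} {t : X → 𝔼 p} {Θ : Set (𝔼 p)}

theorem isMaxOn_iff_of_strictMono {E : Type*} {S : Set E} {f J : E → ℝ} {ψ : ℝ → ℝ}
    (hψ : StrictMono ψ) (h : ∀ z ∈ S, f z = ψ (J z)) {z : E} (hz : z ∈ S) :
    IsMaxOn f S z ↔ IsMaxOn J S z := by
  simp only [isMaxOn_iff]
  refine forall₂_congr fun y hy => ?_
  rw [h y hy, h z hz, hψ.le_iff_le]

/-- Half the log-determinant of the information of one observation. -/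
def halfLogDet (ν : Measure X) (t : X → 𝔼 p) (θ : 𝔼 p) : ℝ :=
  (1 / 2 : ℝ) * Real.log (covMatrix ν t θ).det

theorem isMLE_iff {n : ℕ} {x : Fin n → X} {θ : 𝔼 p} :
    IsMLE Θ (sampleDensity ν t n) x θ ↔
      θ ∈ Θ ∧ IsMaxOn (penalizedLogLik ν t (fun _ => 0) n x) Θ θ := by
  refine and_congr_right fun hθ => isMaxOn_iff_of_strictMono Real.exp_strictMono
    (fun z _ => ?_) hθ
  rw [penalizedLogLik, add_zero, ← log_sampleDensity, Real.exp_log (sampleDensity_pos n z x)]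

/-- Being bounded above for one sample of size `m`, the penalized log-likelihood bounds `G` by a
constant minus the log-likelihood of that sample, which is `m` times a divergence minus a linear
term. Hence `a = m`, which larger samples outweigh. -/
theorem exists_penalty_le {G : (𝔼 p) → ℝ} {m : ℕ} {x : Fin m → X} {θ' : 𝔼 p}
    (hmax : IsMaxOn (penalizedLogLik ν t G m x) Θ θ') (θ₀ : 𝔼 p) :
    ∃ a s M : ℝ, ∀ θ ∈ Θ, G θ ≤ M + s * ‖θ - θ₀‖ + a * divergence ν t θ₀ θ := by
  refine ⟨m, m * ‖deviation ν t θ₀ m x‖, G θ₀ + (penalizedLogLik ν t G m x θ' -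
    penalizedLogLik ν t G m x θ₀), fun θ hθ => ?_⟩
  have h1 : penalizedLogLik ν t G m x θ ≤ penalizedLogLik ν t G m x θ' := hmax hθ
  have h2 := penalizedLogLik_sub (ν := ν) (t := t) (G := G) (θ₀ := θ₀) m x θ
  have h3 : |⟪θ - θ₀, deviation ν t θ₀ m x⟫| ≤ ‖θ - θ₀‖ * ‖deviation ν t θ₀ m x‖ :=
    abs_real_inner_le_norm _ _
  have h4 : (m : ℝ) * -⟪θ - θ₀, deviation ν t θ₀ m x⟫ ≤
      m * (‖θ - θ₀‖ * ‖deviation ν t θ₀ m x‖) := by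
    gcongr
    exact (neg_le_abs _).trans h3
  linarith

namespace MinimalFamily

variable (hF : MinimalFamily ν t Θ)
include hF

theorem isFirthEstimate_iff [SigmaFinite ν] {n : ℕ} (hn : 1 ≤ n) {x : Fin n → X} {θ : 𝔼 p} :
    IsFirthEstimate Θ (sampleBase ν n) (sampleDensity ν t n) x θ ↔
      θ ∈ Θ ∧ IsMaxOn (penalizedLogLik ν t (halfLogDet ν t) n x) Θ θ := by
  have hn' : (0 : ℝ) < n := by exact_mod_cast hn
  have hψ : StrictMono fun y : ℝ => Real.exp y * Real.sqrt ((n : ℝ) ^ p) := fun a b hab => by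
    have : 0 < Real.sqrt ((n : ℝ) ^ p) := Real.sqrt_pos.2 (by positivity)
    simp only
    gcongr
  refine and_congr_right fun hθ => isMaxOn_iff_of_strictMono hψ (fun z hz => ?_) hθ
  have hdet := hF.covMatrix_det_pos hz
  rw [firthLikelihood, hF.fisherInfo_sampleDensity hz, Matrix.det_smul, Fintype.card_fin,
    Real.sqrt_mul (by positivity), penalizedLogLik, ← log_sampleDensity, Real.exp_add,
    Real.exp_log (sampleDensity_pos n z x), halfLogDet, one_div_mul_eq_div, Real.exp_half,
    Real.exp_log hdet]
  ring

/-- The prior contributes the full log-determinant and the objective removes half of it, so half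
remains; the constants are `log c` and half of `log (n ^ p)`. -/
theorem isMMLEstimate_iff [SigmaFinite ν] {n : ℕ} (hn : 1 ≤ n) {h : (𝔼 p) → ℝ}
    (hh : ∃ c : ℝ, 0 < c ∧ ∀ θ ∈ Θ,
      h θ = c * (fisherInfo (sampleBase ν n) (sampleDensity ν t n) θ).det)
    {x : Fin n → X} {θ : 𝔼 p} :
    IsMMLEstimate Θ h (sampleBase ν n) (sampleDensity ν t n) x θ ↔
      θ ∈ Θ ∧ IsMaxOn (penalizedLogLik ν t (halfLogDet ν t) n x) Θ θ := by
  obtain ⟨c, hc, hh⟩ := hh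
  have hn' : (0 : ℝ) < n := by exact_mod_cast hn
  have hψ : StrictMono fun y : ℝ => y + (Real.log c + 1 / 2 * Real.log ((n : ℝ) ^ p)) :=
    fun a b hab => by simpa using hab
  refine and_congr_right fun hθ => isMaxOn_iff_of_strictMono hψ (fun z hz => ?_) hθ
  have hdet := hF.covMatrix_det_pos hz
  have hnp : (0 : ℝ) < (n : ℝ) ^ p := by positivity
  rw [mmlObjective, hh z hz, hF.fisherInfo_sampleDensity hz, Matrix.det_smul, Fintype.card_fin,
    Real.log_mul hc.ne' (by positivity), Real.log_mul hnp.ne' hdet.ne', log_sampleDensity,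
    penalizedLogLik, halfLogDet]
  ring

end MinimalFamily

end Estimates

end MMLFirth

end

/-! ### The main theorem. -/

theorem proposition3p1 {X : Type*} [MeasurableSpace X] {p : ℕ} (hp : 1 ≤ p)
    (ν : Measure X) [SigmaFinite ν]
    (t : X → EuclideanSpace ℝ (Fin p)) (ht : Measurable t)
    -- the parameter set: an open part of the natural parameter space
    (Θ : Set (EuclideanSpace ℝ (Fin p))) (hΘ : IsOpen Θ)
    (hint : ∀ θ ∈ Θ, Integrable (fun x => Real.exp ⟪θ, t x⟫) ν)
    -- minimality: `t` is not almost everywhere in an affine hyperplane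
    (hmin : ∀ a : EuclideanSpace ℝ (Fin p), a ≠ 0 → ∀ c : ℝ, ¬ ∀ᵐ x ∂ν, ⟪a, t x⟫ = c)
    -- the prior for a sample of size `n`, proportional to the determinant of the information
    (h : ℕ → EuclideanSpace ℝ (Fin p) → ℝ)
    (hh : ∀ n : ℕ, 1 ≤ n → ∃ c : ℝ, 0 < c ∧ ∀ θ ∈ Θ,
      h n θ = c * (MMLFirth.fisherInfo (MMLFirth.sampleBase ν n)
        (MMLFirth.sampleDensity ν t n) θ).det) :
    -- the MML87 estimates are Firth's penalized-likelihood estimates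
    (∀ n : ℕ, 1 ≤ n → ∀ (x : Fin n → X) (θ' : EuclideanSpace ℝ (Fin p)),
      MMLFirth.IsMMLEstimate Θ (h n) (MMLFirth.sampleBase ν n)
          (MMLFirth.sampleDensity ν t n) x θ' ↔
        MMLFirth.IsFirthEstimate Θ (MMLFirth.sampleBase ν n)
          (MMLFirth.sampleDensity ν t n) x θ') ∧
    -- the first-order term of the bias, present for the MLE, vanishes for the MML87 estimator
    (∀ θ ∈ Θ, ∃ b : EuclideanSpace ℝ (Fin p),
      (∀ T : ∀ n : ℕ, (Fin n → X) → EuclideanSpace ℝ (Fin p),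
        MMLFirth.IsEstimator
          (fun n x θ' => MMLFirth.IsMLE Θ (MMLFirth.sampleDensity ν t n) x θ') T →
        MMLFirth.HasBiasExpansion (MMLFirth.sampleLaw ν t θ) T θ b) ∧
      -- provided that there is an MML87 estimate for at least one sample of some size
      ((∃ m : ℕ, 1 ≤ m ∧ ∃ (x : Fin m → X) (θ' : EuclideanSpace ℝ (Fin p)),
          MMLFirth.IsMMLEstimate Θ (h m) (MMLFirth.sampleBase ν m)
            (MMLFirth.sampleDensity ν t m) x θ') →
        ∀ T : ∀ n : ℕ, (Fin n → X) → EuclideanSpace ℝ (Fin p),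
          MMLFirth.IsEstimator
            (fun n x θ' => MMLFirth.IsMMLEstimate Θ (h n) (MMLFirth.sampleBase ν n)
              (MMLFirth.sampleDensity ν t n) x θ') T →
          MMLFirth.HasBiasExpansion (MMLFirth.sampleLaw ν t θ) T θ 0)) := by
  have hF : MMLFirth.MinimalFamily ν t Θ := ⟨hp, ht, hΘ, hint, hmin⟩
  refine ⟨fun n hn x θ' => ?_, fun θ hθ => ?_⟩
  · rw [hF.isMMLEstimate_iff hn (hh n hn), hF.isFirthEstimate_iff hn]
  · obtain ⟨A, hA⟩ := hF.exists_covEquiv hθ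
    -- The vector `b` is read off from the case of zero penalty; it depends on `θ` only.
    refine ⟨_, fun T hT => hF.hasBiasExpansion_of_isMaxOn (G := fun _ => 0) (γ := fun _ => 0)
      (a := 0) (s := 0) (M := 0) hθ hA (fun θ' _ => ?_) contDiffAt_const (fun θ' _ => by simp)
      (fun n => (hT n).1) (fun n _ x hex => ?_), ?_⟩
    · simpa using hasFDerivAt_const (0 : ℝ) θ'
    · obtain ⟨θ', hθ', hmax⟩ := hex
      exact MMLFirth.isMLE_iff.1 ((hT n).2 x ⟨θ', MMLFirth.isMLE_iff.2 ⟨hθ', hmax⟩⟩)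
    · rintro ⟨m, hm, x₀, θ₁, hθ₁⟩ T hT
      -- The one assumed estimate supplies the growth bound on the penalty, here centred at the true
      -- parameter `θ`.
      obtain ⟨a, s, M, hle⟩ := MMLFirth.exists_penalty_le
        ((hF.isMMLEstimate_iff hm (hh m hm)).1 hθ₁).2 θ
      have hsmooth : ContDiffOn ℝ (⊤ : ℕ∞) (MMLFirth.halfLogDet ν t) Θ :=
        hF.contDiffOn_log_det_covMatrix
      have hgrad : ∀ θ' ∈ Θ, HasFDerivAt (MMLFirth.halfLogDet ν t) (innerSL ℝ
          ((InnerProductSpace.toDual ℝ (EuclideanSpace ℝ (Fin p))).symm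
            (fderiv ℝ (MMLFirth.halfLogDet ν t) θ'))) θ' := by
        intro θ' hθ'
        have h1 := ((hsmooth.contDiffAt (hΘ.mem_nhds hθ')).differentiableAt (by simp)).hasFDerivAt
        refine h1.congr_fderiv ?_
        ext1 u
        simp
      have hγ : ContDiffAt ℝ 2 (fun θ' =>
          (InnerProductSpace.toDual ℝ (EuclideanSpace ℝ (Fin p))).symm
            (fderiv ℝ (MMLFirth.halfLogDet ν t) θ')) θ := by
        have h1 : ContDiffAt ℝ 2 (fderiv ℝ (MMLFirth.halfLogDet ν t)) θ :=
          (hsmooth.contDiffAt (hΘ.mem_nhds hθ)).fderiv_right (by norm_cast)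
        exact (InnerProductSpace.toDual ℝ
          (EuclideanSpace ℝ (Fin p))).symm.toContinuousLinearEquiv.contDiff.contDiffAt.comp θ h1
      have key := hF.hasBiasExpansion_of_isMaxOn hθ hA hgrad hγ hle (fun n => (hT n).1)
        (fun n hn x hex => ?_)
      · convert key using 1
        -- The cancellation: the gradient of the penalty equals the quadratic contribution to the
        -- bias.
        have h0 : (InnerProductSpace.toDual ℝ (EuclideanSpace ℝ (Fin p))).symm
            (fderiv ℝ (MMLFirth.halfLogDet ν t) θ) = (1 / 2 : ℝ) • ∑ j,
              fderiv ℝ (fderiv ℝ (MMLFirth.mean ν t)) θ (EuclideanSpace.single j (1 : ℝ))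
                (A.symm (EuclideanSpace.single j (1 : ℝ))) := by
          refine ext_inner_right ℝ fun u => ?_
          rw [InnerProductSpace.toDual_symm_apply]
          exact hF.fderiv_log_det_covMatrix hθ hA u
        rw [h0, sub_self, map_zero]
      · obtain ⟨θ', hθ', hmax⟩ := hex
        exact (hF.isMMLEstimate_iff hn (hh n hn)).1
          ((hT n).2 x ⟨θ', (hF.isMMLEstimate_iff hn (hh n hn)).2 ⟨hθ', hmax⟩⟩)
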